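/- **Setting.** Let $D=\{(x,y)\in\mathbb R^2: x\ge 0,\ y\ge 0,\ x+y<1\}$, let $n\ge 2$ be an integer and $\alpha\in[0,1)$. Let $\mathcal E_0,H_0,\mathcal E_1,H_1:[0,1)\to\mathbb C$ belong to $C([0,1))\cap C^n((0,1))$, let $x^\alpha\mathcal E_0'$, $x^\alpha H_0'$, $y^\alpha\mathcal E_1'$, $y^\alpha H_1'$ extend continuously to $[0,1)$, and assume $\mathcal E_0(0)=\mathcal E_1(0)=1$, $H_0(0)=H_1(0)=0$, $f_0:=\mathrm{Re}\,\mathcal E_0-|H_0|^2>0$ and $f_1:=\mathrm{Re}\,\mathcal E_1-|H_1|^2>0$ on $[0,1)$. Such data are called admissible. A *$C^n$-solution of the Goursat problem* with these data is a pair of functions $\mathcal E,H\in C(D)\cap C^n(\mathrm{Int}\,D)$ such that, for some $\beta\in[0,1)$, the functions $x^\beta u_x,\ y^\beta u_y,\ x^\beta y^\beta u_{xy}$ ($u=\mathcal E,H$) extend continuously from $\mathrm{Int}\,D$ to $D$; such that in $\mathrm{Int}\,D$ $$(\mathrm{Re}\,\mathcal E-|H|^2)\Big(\mathcal E_{xy}-\tfrac{\mathcal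 E_x+\mathcal E_y}{2(1-x-y)}\Big)=\mathcal E_x\mathcal E_y-\bar H(\mathcal E_xH_y+\mathcal E_yH_x),$$ $$(\mathrm{Re}\,\mathcal E-|H|^2)\Big(H_{xy}-\tfrac{H_x+H_y}{2(1-x-y)}\Big)=\tfrac12(\mathcal E_xH_y+\mathcal E_yH_x)-2\bar HH_xH_y;$$ such that $\mathcal E(x,0)=\mathcal E_0(x)$, $H(x,0)=H_0(x)$, $\mathcal E(0,y)=\mathcal E_1(y)$, $H(0,y)=H_1(y)$ for $x,y\in[0,1)$; and such that $\mathrm{Re}\,\mathcal E-|H|^2>0$ on $D$. For $(x,y)\in D$ let $\mathcal S_{(x,y)}$ be the Riemann surface of pairs $(\lambda,k)$ with $\lambda^2=\frac{k-(1-y)}{k-x}$, uniformized by $F_{(x,y)}(\lambda,k)=z=\frac{1+\lambda}{1-\lambda}$. Let $\Sigma_0$ and $\Sigma_1$ be the sets of its points (on both sheets) over $k\in[0,x]$ and over $k\in[1-y,1]$. For $0\le s\le x$, $0\le t\le y$ and $P=(\lambda,k)\in\mathcal S_{(x,y)}\setminus(\Sigma_0\cup\Sigma_1)$ put $$\lambda(s,t,P)=\lambda\,\sqrt{\tfrac{k-(1-t)}{k-(1-y)}}\,\sqrt{\tfrac{k-x}{k-s}}\qquad\text{(principal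 roots),}$$ that is, the analytic continuation of $\pm\sqrt{(k-(1-t))/(k-s)}$ from the two sheets. Let $$M(a,h,f,\ell)=\begin{pmatrix}\bar a&\ell\bar a&\frac{i}{\sqrt f}h\\ \ell a&a&-\ell\frac{i}{\sqrt f}h\\ \frac{i}{\sqrt f}\bar h&\ell\frac{i}{\sqrt f}\bar h&\frac12(a+\bar a)\end{pmatrix},\quad A_0=\frac{\mathcal E_0'-2\bar H_0H_0'}{2f_0},\quad B_1=\frac{\mathcal E_1'-2\bar H_1H_1'}{2f_1},$$ and let the boundary eigenfunctions $\Phi_0(\cdot,P)$ on $[0,x]$ and $\Phi_1(\cdot,P)$ on $[0,y]$ be the continuous solutions of $$\Phi_0(s,P)=I+\int_0^sM\big(A_0,H_0',f_0,\lambda(\sigma,0,P)\big)\,\Phi_0(\sigma,P)\,d\sigma,\qquad \Phi_1(t,P)=I+\int_0^tM\big(B_1,H_1',f_1,\lambda(0,\tau,P)^{-1}\big)\,\Phi_1(\tau,P)\,d\tau,$$ where $A_0,H_0',f_0$ are evaluated at $\sigma$ and $B_1,H_1',f_1$ at $\tau$. Let $\Gamma=\Gamma_0\cup\Gamma_1$,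 where $\Gamma_0,\Gamma_1$ are clockwise oriented rectifiable simple closed curves in $\mathbb C$ that encircle $F_{(x,y)}(\Sigma_0)$ and $F_{(x,y)}(\Sigma_1)$ respectively, neither meet nor encircle $0$, and are disjoint and not nested. Let $v(x,y,z)=\Phi_0(x,F_{(x,y)}^{-1}(z))$ for $z\in\Gamma_0$ and $v(x,y,z)=\Phi_1(y,F_{(x,y)}^{-1}(z))$ for $z\in\Gamma_1$. The Riemann–Hilbert problem at $(x,y)$ asks for a $3\times3$-matrix valued function $m(x,y,\cdot)$, analytic on $\mathbb C\setminus\Gamma$, with continuous boundary values $m_+$, $m_-$ on $\Gamma$ from the left- and right-hand side of $\Gamma$, such that $m_+=m_-v$ on $\Gamma$ and $m(x,y,z)=I+O(z^{-1})$ as $z\to\infty$. **Theorem.** Let $\{\mathcal E_0,H_0,\mathcal E_1,H_1\}$ be admissible data. 1. There is at most one $C^n$-solution $\{\mathcal E,H\}$ (on $D$) of the Goursat problem with these data. 2. If $\{\mathcal E,H\}$ is a $C^n$-solution, then for every $(x,y)\in D$ and every contour $\Gamma$ as above, the jump matrix $v(x,y,\cdot)$ is well defined on $\Gamma$, the Riemann–Hilbert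 problem at $(x,y)$ has a unique solution $m(x,y,\cdot)$, and, with $\hat m=m(x,y,0)$, one has $\hat m_{33}+\hat m_{11}+\hat m_{21}\ne0$ and $$\mathcal E(x,y)=\frac{\hat m_{33}+\hat m_{11}-\hat m_{21}}{\hat m_{33}+\hat m_{11}+\hat m_{21}},\qquad H(x,y)=\frac{-i\,\hat m_{23}}{\hat m_{33}+\hat m_{11}+\hat m_{21}}.$$ 3. For $(x,y)\in D$, the values $\mathcal E(x,y)$ and $H(x,y)$ of a $C^n$-solution depend only on $\mathcal E_0,H_0$ on $[0,x]$ and on $\mathcal E_1,H_1$ on $[0,y]$: if two sets of admissible data (possibly with different $n$ and $\alpha$) agree on these intervals and both have solutions, the two solutions have the same values at $(x,y)$. -/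

import Mathlib

open Set Filter Topology

noncomputable section

namespace ErnstMaxwell

/-- Complex `3 × 3` matrices. -/
abbrev Mat3 : Type := Matrix (Fin 3) (Fin 3) ℂ

/-! ### The Goursat problem -/

/-- The triangle `D = {(x,y) : x ≥ 0, y ≥ 0, x + y < 1}`. -/
def triangle : Set (ℝ × ℝ) := {p | 0 ≤ p.1 ∧ 0 ≤ p.2 ∧ p.1 + p.2 < 1}

/-- Partial derivative with respect to `x`. -/
def dx (u : ℝ × ℝ → ℂ) (p : ℝ × ℝ) : ℂ := deriv (fun s : ℝ => u (s, p.2)) p.1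

/-- Partial derivative with respect to `y`. -/
def dy (u : ℝ × ℝ → ℂ) (p : ℝ × ℝ) : ℂ := deriv (fun t : ℝ => u (p.1, t)) p.2

/-- The combination `f = Re E - |H|²` of the values `e, h` of the two potentials. -/
def fVal (e h : ℂ) : ℝ := e.re - ‖h‖ ^ 2

/-- The hyperbolic Ernst–Maxwell equations at the point `p = (x,y)`. -/
def ErnstMaxwellAt (E H : ℝ × ℝ → ℂ) (p : ℝ × ℝ) : Prop :=
  (fVal (E p) (H p) : ℂ) * (dy (dx E) p - (dx E p + dy E p) / (2 * (1 - (p.1 : ℂ) - (p.2 : ℂ))))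
      = dx E p * dy E p - star (H p) * (dx E p * dy H p + dy E p * dx H p) ∧
  (fVal (E p) (H p) : ℂ) * (dy (dx H) p - (dx H p + dy H p) / (2 * (1 - (p.1 : ℂ) - (p.2 : ℂ))))
      = 1 / 2 * (dx E p * dy H p + dy E p * dx H p) - 2 * star (H p) * dx H p * dy H p

/-- `u`, which is only looked at on `s`, has a continuous extension to the larger set `t`.
With `s` the interior of `t` this is the meaning of `u ∈ C(t)` for an expression `u`
(such as `x ^ α * E_x`) that is only defined in the interior. -/
def ExtendsContinuously {X : Type*} [TopologicalSpace X] (u : X → ℂ) (s t : Set X) : Prop :=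
  ∃ g : X → ℂ, ContinuousOn g t ∧ EqOn g u s

/-- Boundary data `E₀(x), H₀(x)` on `y = 0` and `E₁(y), H₁(y)` on `x = 0`; only the values on
`[0,1)` matter. -/
structure GoursatData where
  E0 : ℝ → ℂ
  H0 : ℝ → ℂ
  E1 : ℝ → ℂ
  H1 : ℝ → ℂ

/-- The regularity required of each of the four boundary functions:
`u ∈ C([0,1)) ∩ C^n((0,1))` and `x ^ α * u' ∈ C([0,1))`. -/
def DataRegular (n : ℕ) (α : ℝ) (u : ℝ → ℂ) : Prop :=
  ContinuousOn u (Ico 0 1) ∧ ContDiffOn ℝ n u (Ioo 0 1) ∧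
    ExtendsContinuously (fun s : ℝ => ((s ^ α : ℝ) : ℂ) * deriv u s) (Ioo 0 1) (Ico 0 1)

/-- The standing assumptions on the boundary data. -/
def GoursatData.Admissible (d : GoursatData) (n : ℕ) (α : ℝ) : Prop :=
  DataRegular n α d.E0 ∧ DataRegular n α d.H0 ∧ DataRegular n α d.E1 ∧ DataRegular n α d.H1 ∧
  d.E0 0 = 1 ∧ d.E1 0 = 1 ∧ d.H0 0 = 0 ∧ d.H1 0 = 0 ∧
  (∀ s ∈ Ico (0 : ℝ) 1, 0 < fVal (d.E0 s) (d.H0 s)) ∧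
  (∀ s ∈ Ico (0 : ℝ) 1, 0 < fVal (d.E1 s) (d.H1 s))

/-- The regularity required of each component of a `C^n`-solution:
`u ∈ C(D) ∩ C^n(Int D)` and `x ^ α * u_x`, `y ^ α * u_y`, `x ^ α * y ^ α * u_xy ∈ C(D)`. -/
def SolutionRegular (n : ℕ) (α : ℝ) (u : ℝ × ℝ → ℂ) : Prop :=
  ContinuousOn u triangle ∧ ContDiffOn ℝ n u (interior triangle) ∧
  ExtendsContinuously (fun p : ℝ × ℝ => ((p.1 ^ α : ℝ) : ℂ) * dx u p)
    (interior triangle) triangle ∧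
  ExtendsContinuously (fun p : ℝ × ℝ => ((p.2 ^ α : ℝ) : ℂ) * dy u p)
    (interior triangle) triangle ∧
  ExtendsContinuously (fun p : ℝ × ℝ => ((p.1 ^ α * p.2 ^ α : ℝ) : ℂ) * dy (dx u) p)
    (interior triangle) triangle

/-- `{E, H}` is a `C^n`-solution of the Goursat problem in `D` with data `d`. -/
structure IsGoursatSolution (n : ℕ) (d : GoursatData) (E H : ℝ × ℝ → ℂ) : Prop where
  regular : ∃ α ∈ Ico (0 : ℝ) 1, SolutionRegular n α E ∧ SolutionRegular n α H
  equations : ∀ p ∈ interior triangle, ErnstMaxwellAt E H p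
  bottom : ∀ x ∈ Ico (0 : ℝ) 1, E (x, 0) = d.E0 x ∧ H (x, 0) = d.H0 x
  left : ∀ y ∈ Ico (0 : ℝ) 1, E (0, y) = d.E1 y ∧ H (0, y) = d.H1 y
  pos : ∀ p ∈ triangle, 0 < fVal (E p) (H p)

/-! ### The Riemann surface and its uniformization -/

/-- The inverse of the uniformizing map `F_(x,y) : (λ,k) ↦ z = (1 + λ)/(1 - λ)` of the surface
`λ² = (k - (1-y))/(k - x)`, as a pair `(λ, k)`: from `z` one gets `λ = (z - 1)/(z + 1)`, and then
`k = ((1-y) - x λ²)/(1 - λ²)`. It is used for finite `z ≠ 0, -1`, where `λ` and `k` are finite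
(`z = 0, ∞` are the two points over `k = ∞`, and `z = -1` is the branch point `k = x`). -/
def surfacePoint (x y : ℝ) (z : ℂ) : ℂ × ℂ :=
  ((z - 1) / (z + 1), ((1 - y) * (z + 1) ^ 2 - x * (z - 1) ^ 2) / (4 * z))

/-- `F_(x,y)(Σ₀)`, where `Σ₀ = [0⁺,x] ∪ [x,0⁻]` consists of the points of the surface over
the segment `[0,x]` of the `k`-plane, on both sheets. -/
def sigma0 (x y : ℝ) : Set ℂ := {z | z ≠ 0 ∧ ∃ s ∈ Icc 0 x, (surfacePoint x y z).2 = (s : ℂ)}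

/-- `F_(x,y)(Σ₁)`, where `Σ₁ = [1⁻,1-y] ∪ [1-y,1⁺]` consists of the points of the surface over
the segment `[1-y,1]` of the `k`-plane, on both sheets. -/
def sigma1 (x y : ℝ) : Set ℂ := {z | z ≠ 0 ∧ ∃ s ∈ Icc (1 - y) 1, (surfacePoint x y z).2 = (s : ℂ)}

/-- The function `λ(s,t,P)` at a point `P = (λ,k)` of the surface belonging to `(x,y)`, for
`0 ≤ s ≤ x` and `0 ≤ t ≤ y`. Its square is `(k - (1-t))/(k - s)`. Each of the two principal roots
is analytic in `k` off `[1-y,1-t]` resp. off `[s,x]` and tends to `1` as `k → ∞`; so, for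
`k ∉ [0,1]`, on the sheet `P = k^±` this is `±` the root of `(k - (1-t))/(k - s)` with positive
real part, and it is the analytic continuation of this to the surface minus `Σ₀ ∪ Σ₁`. -/
def lamAt (x y s t : ℝ) (P : ℂ × ℂ) : ℂ :=
  P.1 * Complex.sqrt ((P.2 - (1 - t)) / (P.2 - (1 - y))) * Complex.sqrt ((P.2 - x) / (P.2 - s))

/-! ### The boundary eigenfunctions -/

/-- The common form of the two matrices of the Lax pair: `a` stands for `A` or `B`, `h` for `H_x` or
`H_y`, `f` for `Re E - |H|²`, and `l` for `λ` or `1/λ`. -/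
def laxMatrix (a h : ℂ) (f : ℝ) (l : ℂ) : Mat3 :=
  !![star a, l * star a, Complex.I / (√f : ℂ) * h;
     l * a, a, -(l * (Complex.I / (√f : ℂ)) * h);
     Complex.I / (√f : ℂ) * star h, l * (Complex.I / (√f : ℂ)) * star h, (a + star a) / 2]

/-- `A₀` (or `B₁`): the function `(E' - 2 conj(H) H') / (2 f)` of one real variable. -/
def logCoeff (E H : ℝ → ℂ) (s : ℝ) : ℂ :=
  (deriv E s - 2 * star (H s) * deriv H s) / (2 * (fVal (E s) (H s) : ℂ))

/-- The matrix `U₀(s, P)` for `P` on the surface belonging to `(x,y)`. -/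
def matU0 (d : GoursatData) (x y : ℝ) (P : ℂ × ℂ) (s : ℝ) : Mat3 :=
  laxMatrix (logCoeff d.E0 d.H0 s) (deriv d.H0 s) (fVal (d.E0 s) (d.H0 s)) (lamAt x y s 0 P)

/-- The matrix `V₁(t, P)` for `P` on the surface belonging to `(x,y)`. -/
def matV1 (d : GoursatData) (x y : ℝ) (P : ℂ × ℂ) (t : ℝ) : Mat3 :=
  laxMatrix (logCoeff d.E1 d.H1 t) (deriv d.H1 t) (fVal (d.E1 t) (d.H1 t)) (1 / lamAt x y 0 t P)

/-- `W` is the value at `T` of the continuous solution `Φ` on `[0,T]` of the Volterra equation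
`Φ(s) = I + ∫₀ˢ A(t) Φ(t) dt`. -/
def IsVolterraValue (A : ℝ → Mat3) (T : ℝ) (W : Mat3) : Prop :=
  ∃ Φ : ℝ → Mat3, ContinuousOn Φ (Icc 0 T) ∧
    (∀ s ∈ Icc 0 T, ∀ i j, Φ s i j = (1 : Mat3) i j + ∫ t in (0 : ℝ)..s, (A t * Φ t) i j) ∧
    Φ T = W

/-! ### Contours -/

/-- The trace of a path parametrized by `[0,1]`. -/
def trace (γ : ℝ → ℂ) : Set ℂ := γ '' Icc 0 1

/-- The winding number of the closed path `γ` about a point off its trace. -/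
def wind (γ : ℝ → ℂ) (z : ℂ) : ℂ :=
  (2 * (Real.pi : ℂ) * Complex.I)⁻¹ * ∫ t in (0 : ℝ)..1, deriv γ t / (γ t - z)

/-- The points encircled by a clockwise oriented loop: its right-hand side. -/
def inside (γ : ℝ → ℂ) : Set ℂ := {z | z ∉ trace γ ∧ wind γ z = -1}

/-- The points not encircled by a clockwise oriented loop: its left-hand side. -/
def outside (γ : ℝ → ℂ) : Set ℂ := {z | z ∉ trace γ ∧ wind γ z = 0}

/-- A (rectifiable) simple closed curve, oriented clockwise. -/
structure IsClockwiseLoop (γ : ℝ → ℂ) : Prop where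
  lipschitz : ∃ K, LipschitzOnWith K γ (Icc 0 1)
  closed : γ 0 = γ 1
  simple : InjOn γ (Ico 0 1)
  clockwise : ∀ z, z ∉ trace γ → wind γ z = 0 ∨ wind γ z = -1

/-- `Γ₀` and `Γ₁` are clockwise loops encircling `F_(x,y)(Σ₀)` and `F_(x,y)(Σ₁)` respectively,
neither encircling nor meeting zero, and lying apart from each other. -/
structure AdmissibleContours (x y : ℝ) (γ₀ γ₁ : ℝ → ℂ) : Prop where
  loop0 : IsClockwiseLoop γ₀
  loop1 : IsClockwiseLoop γ₁
  encircles0 : sigma0 x y ⊆ inside γ₀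
  encircles1 : sigma1 x y ⊆ inside γ₁
  zero0 : 0 ∈ outside γ₀
  zero1 : 0 ∈ outside γ₁
  apart : Disjoint (trace γ₀ ∪ inside γ₀) (trace γ₁ ∪ inside γ₁)

/-! ### The Riemann–Hilbert problem -/

/-- `v` is the jump matrix on `Γ = Γ₀ ∪ Γ₁`: `v(z) = Φ₀(x, F⁻¹(z))` on `Γ₀` and
`v(z) = Φ₁(y, F⁻¹(z))` on `Γ₁`. -/
def IsJumpMatrix (d : GoursatData) (x y : ℝ) (γ₀ γ₁ : ℝ → ℂ) (v : ℂ → Mat3) : Prop :=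
  (∀ z ∈ trace γ₀, IsVolterraValue (matU0 d x y (surfacePoint x y z)) x (v z)) ∧
  (∀ z ∈ trace γ₁, IsVolterraValue (matV1 d x y (surfacePoint x y z)) y (v z))

/-- `m₊` and `m₋` are the boundary values of `m` on the loop `γ` from its left- and right-hand
side. -/
def HasBoundaryValues (γ : ℝ → ℂ) (m mplus mminus : ℂ → Mat3) : Prop :=
  ∀ z ∈ trace γ, Tendsto m (𝓝[outside γ] z) (𝓝 (mplus z)) ∧
    Tendsto m (𝓝[inside γ] z) (𝓝 (mminus z))

/-- `m` solves the Riemann–Hilbert problem on `Γ = Γ₀ ∪ Γ₁` with jump matrix `v`. The values of `m`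
on `Γ` itself play no role. -/
structure IsRHSolution (γ₀ γ₁ : ℝ → ℂ) (v m : ℂ → Mat3) : Prop where
  analytic : ∀ i j, DifferentiableOn ℂ (fun z => m z i j) (trace γ₀ ∪ trace γ₁)ᶜ
  jump : ∃ mplus mminus : ℂ → Mat3,
    ContinuousOn mplus (trace γ₀ ∪ trace γ₁) ∧ ContinuousOn mminus (trace γ₀ ∪ trace γ₁) ∧
    HasBoundaryValues γ₀ m mplus mminus ∧ HasBoundaryValues γ₁ m mplus mminus ∧
    ∀ z ∈ trace γ₀ ∪ trace γ₁, mplus z = mminus z * v z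
  infinity : ∀ i j, (fun z => m z i j - (1 : Mat3) i j) =O[cocompact ℂ] (fun z : ℂ => z⁻¹)

end ErnstMaxwell

end

open ErnstMaxwell

/-! Fix the corner (x,y). Put U = M(A, H_x, f, λ) and V = M(B, H_y, f, 1/λ), where λ(s,t,z)² =
(k-(1-t))/(k-s). For fixed z this λ satisfies λ_s = λ(1-λ²)/(2(1-s-t)) and λ_t = (1/λ-λ)/(2(1-s-t)),
and with these two relations the Ernst–Maxwell equations give the zero curvature identity U_t - V_s
+ [U,V] = 0 (`laxForm_flat`, `laxDeriv_swap`). Parallel transport from (0,0) to (x,y) is therefore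
the same along the bottom and right edges of the rectangle as along its left and top edges
(`transport_lax`): R(z)Φ₀(z) = T(z)Φ₁(z) =: F(z), where Φ₀, Φ₁ are the boundary eigenfunctions and
R, T the transports along the right and top edges.

The point is where these factors are holomorphic. On the right edge one of the two square roots in λ
is identically 1, so R is holomorphic off F(Σ₁); likewise T is holomorphic off F(Σ₀), and F off the
union. Since F = Rv on Γ₀ and F = Tv on Γ₁, the function equal to R inside Γ₀, to T inside Γ₁ and to
F elsewhere has jump v. Multiplied from the left by F(∞)⁻¹ it solves the Riemann–Hilbert problem
(`rhFactorization`, `isRHSolution`).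

The points z = ∞ and z = 0 lie over k = ∞, and there λ is constantly 1 and -1. For λ = 1 the Lax
system has the explicit solution `gauge`, so F(∞) = N := `gauge` of the values at (x,y). The map z ↦
1/z exchanges the sheets and changes the sign of λ, which amounts to conjugation by S =
diag(1,-1,1). Hence F(0) = SNS and m(0) = N⁻¹SNS, and this relation is solved for the potentials in
`potentials_eq_of_gauge`.

Uniqueness of m: the quotient of any solution by the invertible one just built is continuous across
Γ, holomorphic off Γ, and tends to I at infinity. A rectifiable curve is removable for continuous
functions (`differentiable_of_linearlyCovered`), so Liouville's theorem applies. The jump matrix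
depends only on the data on [0,x] and [0,y], and circles serve as contours, so uniqueness and local
dependence of the solution of the Goursat problem follow from the formulas for its values.

The coefficients are singular like s^(-β), β < 1, at the edges. Transport is therefore built from
the Peano–Baker series with majorant exp ∫ C s^(-β) ds. Its dependence on parameters follows from
Duhamel's formula and dominated convergence. -/

noncomputable section

namespace ErnstMaxwell

open MeasureTheory
open scoped Interval

attribute [local instance] Matrix.linftyOpNormedRing Matrix.linftyOpNormedAlgebra

/-! ### Linear differential equations with an integrable singularity -/

/-- `A` is continuous on `(0,T)` with a singularity at `0` of order at most `β`. -/
structure WeaklySingular {F : Type*} [NormedAddCommGroup F] (A : ℝ → F) (β C T : ℝ) : Prop where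
  cont : ContinuousOn A (Ioo 0 T)
  bound : ∀ s ∈ Ioo 0 T, ‖A s‖ ≤ C * s ^ (-β)

section WeaklySingular

variable {F : Type*} [NormedAddCommGroup F]

theorem WeaklySingular.mono {A : ℝ → F} {β C T T' : ℝ} (h : WeaklySingular A β C T) (hT : T' ≤ T) :
    WeaklySingular A β C T' :=
  ⟨h.cont.mono (Ioo_subset_Ioo_right hT), fun s hs => h.bound s ⟨hs.1, hs.2.trans_le hT⟩⟩

theorem WeaklySingular.mul_continuous {R : Type*} [NormedRing R] {A Φ : ℝ → R} {β C T B : ℝ}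
    (h : WeaklySingular A β C T) (hC : 0 ≤ C) (hΦ : ContinuousOn Φ (Ioo 0 T))
    (hB : ∀ s ∈ Ioo 0 T, ‖Φ s‖ ≤ B) : WeaklySingular (fun s => A s * Φ s) β (C * B) T := by
  refine ⟨h.cont.mul hΦ, fun s hs => ?_⟩
  have h1 := Real.rpow_nonneg hs.1.le (-β)
  calc ‖A s * Φ s‖ ≤ ‖A s‖ * ‖Φ s‖ := norm_mul_le _ _
    _ ≤ (C * s ^ (-β)) * B := by
      gcongr
      · exact h.bound s hs
      · exact hB s hs
    _ = _ := by ring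

theorem WeaklySingular.continuous_mul {R : Type*} [NormedRing R] {A Φ : ℝ → R} {β C T B : ℝ}
    (h : WeaklySingular A β C T) (hB0 : 0 ≤ B) (hΦ : ContinuousOn Φ (Ioo 0 T))
    (hB : ∀ s ∈ Ioo 0 T, ‖Φ s‖ ≤ B) : WeaklySingular (fun s => Φ s * A s) β (C * B) T := by
  refine ⟨hΦ.mul h.cont, fun s hs => ?_⟩
  calc ‖Φ s * A s‖ ≤ ‖Φ s‖ * ‖A s‖ := norm_mul_le _ _
    _ ≤ B * (C * s ^ (-β)) := by
      gcongr
      · exact hB s hs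
      · exact h.bound s hs
    _ = _ := by ring

theorem intervalIntegrable_mul_rpow_neg {β : ℝ} (hβ : β < 1) (C a b : ℝ) :
    IntervalIntegrable (fun s : ℝ => C * s ^ (-β)) volume a b :=
  (intervalIntegral.intervalIntegrable_rpow' (by linarith)).const_mul C

/-- Bounds are available on the open interval, integrals run over the half-open one; a single point
is null. -/
theorem ae_mem_Ioo_of_mem_uIoc {T : ℝ} (hT : 0 ≤ T) :
    ∀ᵐ s : ℝ, s ∈ Ι (0 : ℝ) T → s ∈ Ioo 0 T := by
  have : ∀ᵐ s : ℝ, s ≠ T := by simp [ae_iff]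
  filter_upwards [this] with s hs h
  rw [uIoc_of_le hT] at h
  exact ⟨h.1, lt_of_le_of_ne h.2 hs⟩

theorem aestronglyMeasurable_uIoc {A : ℝ → F} {T : ℝ} (hT : 0 ≤ T) (hA : ContinuousOn A (Ioo 0 T)) :
    AEStronglyMeasurable A (volume.restrict (Ι (0 : ℝ) T)) := by
  rw [uIoc_of_le hT, Measure.restrict_congr_set Ioo_ae_eq_Ioc.symm]
  exact hA.aestronglyMeasurable measurableSet_Ioo

theorem WeaklySingular.intervalIntegrable {A : ℝ → F} {β C T : ℝ} (h : WeaklySingular A β C T)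
    (hβ : β < 1) (hT : 0 ≤ T) : IntervalIntegrable A volume 0 T := by
  refine (intervalIntegrable_mul_rpow_neg hβ C 0 T).mono_fun' (aestronglyMeasurable_uIoc hT h.cont) ?_
  rw [EventuallyLE, ae_restrict_iff' measurableSet_uIoc]
  filter_upwards [ae_mem_Ioo_of_mem_uIoc hT] with s hs h'
  exact h.bound s (hs h')

variable [NormedSpace ℝ F]

theorem WeaklySingular.hasDerivAt_integral {A : ℝ → F} {β C T s : ℝ} (h : WeaklySingular A β C T)
    (hβ : β < 1) (hs : s ∈ Ioo 0 T) [CompleteSpace F] :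
    HasDerivAt (fun u => ∫ σ in (0 : ℝ)..u, A σ) (A s) s := by
  apply intervalIntegral.integral_hasDerivAt_right
  · exact (h.mono hs.2.le).intervalIntegrable hβ hs.1.le
  · exact h.cont.stronglyMeasurableAtFilter isOpen_Ioo s hs
  · exact h.cont.continuousAt (isOpen_Ioo.mem_nhds hs)

theorem WeaklySingular.continuousOn_integral {A : ℝ → F} {β C T : ℝ} (h : WeaklySingular A β C T)
    (hβ : β < 1) (hT : 0 ≤ T) :
    ContinuousOn (fun u => ∫ σ in (0 : ℝ)..u, A σ) (Icc 0 T) := by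
  have := intervalIntegral.continuousOn_primitive_interval' (h.intervalIntegrable hβ hT)
    (left_mem_uIcc)
  rwa [uIcc_of_le hT] at this

/-- A function on `[0,T]` which is constant in the interior, continuous up to the ends. -/
theorem eq_of_hasDerivAt_zero [CompleteSpace F] {Y : ℝ → F} {T s : ℝ}
    (hc : ContinuousOn Y (Icc 0 T)) (hd : ∀ s ∈ Ioo 0 T, HasDerivAt Y 0 s) (hs : s ∈ Icc 0 T) :
    Y s = Y 0 := by
  have := intervalIntegral.integral_eq_sub_of_hasDerivAt_of_le (f' := fun _ => 0) hs.1
    (hc.mono (Icc_subset_Icc_right hs.2)) (fun x hx => hd x ⟨hx.1, hx.2.trans_le hs.2⟩)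
    intervalIntegrable_const
  rw [intervalIntegral.integral_zero, eq_comm, sub_eq_zero] at this
  exact this

/-- The fundamental theorem of calculus survives the singularity at 0: the derivative is only needed
inside, where it is dominated by an integrable power. -/
theorem WeaklySingular.integral_deriv [CompleteSpace F] {Y A : ℝ → F} {β C T s : ℝ} (hβ : β < 1)
    (h : WeaklySingular A β C T)
    (hc : ContinuousOn Y (Icc 0 T)) (hd : ∀ s ∈ Ioo 0 T, HasDerivAt Y (A s) s) (hs : s ∈ Icc 0 T) :
    ∫ σ in (0 : ℝ)..s, A σ = Y s - Y 0 :=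
  intervalIntegral.integral_eq_sub_of_hasDerivAt_of_le hs.1
    (hc.mono (Icc_subset_Icc_right hs.2)) (fun x hx => hd x ⟨hx.1, hx.2.trans_le hs.2⟩)
    ((h.mono hs.2).intervalIntegrable hβ hs.1)

end WeaklySingular

/-! ### Parallel transport: the Peano–Baker series, its inverse, and dependence on parameters. -/

section Transport

variable {𝔸 : Type*} [NormedRing 𝔸] [NormedAlgebra ℝ 𝔸]

/-- The terms of the Peano–Baker series. -/
def peanoBaker (A : ℝ → 𝔸) : ℕ → ℝ → 𝔸
  | 0 => fun _ => 1
  | k + 1 => fun s => ∫ σ in (0 : ℝ)..s, A σ * peanoBaker A k σ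

/-- The solution of `Φ' = A Φ`, `Φ(0) = 1`. -/
def transport (A : ℝ → 𝔸) (s : ℝ) : 𝔸 := ∑' k, peanoBaker A k s

/-- The integral of `C s ^ (-β)` over `[0,s]`. -/
def singularIntegral (β C s : ℝ) : ℝ := C * s ^ (1 - β) / (1 - β)

theorem singularIntegral_nonneg {β C s : ℝ} (hβ : β < 1) (hC : 0 ≤ C) (hs : 0 ≤ s) :
    0 ≤ singularIntegral β C s :=
  div_nonneg (mul_nonneg hC (Real.rpow_nonneg hs _)) (by linarith)

theorem singularIntegral_mono {β C s t : ℝ} (hβ : β < 1) (hC : 0 ≤ C) (hs : 0 ≤ s) (hst : s ≤ t) :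
    singularIntegral β C s ≤ singularIntegral β C t := by
  have : 0 < 1 - β := by linarith
  unfold singularIntegral
  gcongr

theorem hasDerivAt_singularIntegral {β C s : ℝ} (hβ : β < 1) (hs : 0 < s) :
    HasDerivAt (singularIntegral β C) (C * s ^ (-β)) s := by
  have h1 : (1 - β) ≠ 0 := by linarith
  have := ((Real.hasDerivAt_rpow_const (p := 1 - β) (Or.inl hs.ne')).const_mul C).div_const (1 - β)
  refine this.congr_deriv ?_
  rw [show 1 - β - 1 = -β by ring]
  field_simp

theorem continuous_singularIntegral {β C : ℝ} (hβ : β < 1) : Continuous (singularIntegral β C) := by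
  unfold singularIntegral
  have := Real.continuous_rpow_const (q := 1 - β) (by linarith)
  fun_prop

/-- With S the primitive of C s^(-β), the integrand is the derivative of S^(k+1)/(k+1)!. So iterated
integrals have the size of exponential series terms in spite of the singularity. -/
theorem integral_singularIntegral_pow {β C s : ℝ} (hβ : β < 1) (hs : 0 ≤ s) (k : ℕ) :
    ∫ σ in (0 : ℝ)..s, C * σ ^ (-β) * (singularIntegral β C σ ^ k / k.factorial) =
      singularIntegral β C s ^ (k + 1) / (k + 1).factorial := by
  have h0 : singularIntegral β C 0 = 0 := by
    simp [singularIntegral, Real.zero_rpow (show 1 - β ≠ 0 by linarith)]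
  rw [intervalIntegral.integral_eq_sub_of_hasDerivAt_of_le (f := fun σ =>
    singularIntegral β C σ ^ (k + 1) / (k + 1).factorial) hs]
  · simp [h0]
  · exact (((continuous_singularIntegral hβ).pow _).div_const _).continuousOn
  · intro x hx
    have := ((hasDerivAt_singularIntegral (C := C) hβ hx.1).fun_pow (k + 1)).div_const
      ((k + 1).factorial : ℝ)
    refine this.congr_deriv ?_
    rw [Nat.factorial_succ]
    have : ((k : ℝ) + 1) ≠ 0 := by positivity
    have : (k.factorial : ℝ) ≠ 0 := by positivity
    push_cast
    field_simp
  · exact (intervalIntegrable_mul_rpow_neg hβ C 0 s).mul_continuousOn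
      (((continuous_singularIntegral hβ).pow _).div_const _).continuousOn

variable [CompleteSpace 𝔸] [NormOneClass 𝔸]

/-- Continuity and bound go through the induction together, because the integral defining the next
term exists on account of both. -/
theorem peanoBaker_aux {A : ℝ → 𝔸} {β C T : ℝ} (hβ : β < 1) (hC : 0 ≤ C) (hT : 0 ≤ T)
    (h : WeaklySingular A β C T) (k : ℕ) : ContinuousOn (peanoBaker A k) (Icc 0 T) ∧
      ∀ s ∈ Icc 0 T, ‖peanoBaker A k s‖ ≤ singularIntegral β C s ^ k / k.factorial := by
  induction k with
  | zero => exact ⟨continuousOn_const, fun s _ => by simp [peanoBaker]⟩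
  | succ k ih =>
    obtain ⟨hc, hb⟩ := ih
    have hw : WeaklySingular (fun s => A s * peanoBaker A k s) β
        (C * (singularIntegral β C T ^ k / k.factorial)) T := by
      refine h.mul_continuous hC (hc.mono Ioo_subset_Icc_self) fun s hs => ?_
      refine (hb s (Ioo_subset_Icc_self hs)).trans ?_
      have := singularIntegral_mono hβ hC hs.1.le hs.2.le
      have := singularIntegral_nonneg hβ hC hs.1.le
      gcongr
    refine ⟨hw.continuousOn_integral hβ hT, fun s hs => ?_⟩
    rw [← integral_singularIntegral_pow hβ hs.1]
    refine intervalIntegral.norm_integral_le_of_norm_le hs.1 ?_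
      ((intervalIntegrable_mul_rpow_neg hβ C 0 s).mul_continuousOn
        (((continuous_singularIntegral hβ).pow _).div_const _).continuousOn)
    have : ∀ᵐ t : ℝ, t ≠ s := by simp [ae_iff]
    filter_upwards [this] with t ht h'
    have ht : t ∈ Ioo 0 T := ⟨h'.1, (lt_of_le_of_ne h'.2 ht).trans_le hs.2⟩
    refine (norm_mul_le _ _).trans ?_
    have := Real.rpow_nonneg ht.1.le (-β)
    exact mul_le_mul (h.bound t ht) (hb t (Ioo_subset_Icc_self ht)) (norm_nonneg _) (by positivity)

theorem peanoBaker_le {A : ℝ → 𝔸} {β C T : ℝ} (hβ : β < 1) (hC : 0 ≤ C) (hT : 0 ≤ T)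
    (h : WeaklySingular A β C T) (k : ℕ) {s : ℝ} (hs : s ∈ Icc 0 T) :
    ‖peanoBaker A k s‖ ≤ singularIntegral β C T ^ k / k.factorial := by
  refine ((peanoBaker_aux hβ hC hT h k).2 s hs).trans ?_
  have := singularIntegral_mono hβ hC hs.1 hs.2
  have := singularIntegral_nonneg hβ hC hs.1
  gcongr

/-- The exponential bound for a solution and its inverse. -/
def transportBound (β C T : ℝ) : ℝ := Real.exp (singularIntegral β C T)

theorem transportBound_nonneg (β C T : ℝ) : 0 ≤ transportBound β C T := (Real.exp_pos _).le

theorem continuousOn_transport {A : ℝ → 𝔸} {β C T : ℝ} (hβ : β < 1) (hC : 0 ≤ C) (hT : 0 ≤ T)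
    (h : WeaklySingular A β C T) : ContinuousOn (transport A) (Icc 0 T) :=
  continuousOn_tsum (fun k => (peanoBaker_aux hβ hC hT h k).1)
    (Real.summable_pow_div_factorial _) (fun k _ hs => peanoBaker_le hβ hC hT h k hs)

theorem norm_transport_le {A : ℝ → 𝔸} {β C T : ℝ} (hβ : β < 1) (hC : 0 ≤ C) (hT : 0 ≤ T)
    (h : WeaklySingular A β C T) {s : ℝ} (hs : s ∈ Icc 0 T) :
    ‖transport A s‖ ≤ transportBound β C T := by
  have h1 := NormedSpace.expSeries_div_hasSum_exp (𝔸 := ℝ) (singularIntegral β C T)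
  rw [← Real.exp_eq_exp_ℝ] at h1
  exact tsum_of_norm_bounded h1 (fun k => peanoBaker_le hβ hC hT h k hs)

/-- Termwise integration of the series, justified by dominated convergence; the integrated series is
the original one without its zeroth term. -/
theorem transport_eq_integral {A : ℝ → 𝔸} {β C T : ℝ} (hβ : β < 1) (hC : 0 ≤ C) (hT : 0 ≤ T)
    (h : WeaklySingular A β C T) {s : ℝ} (hs : s ∈ Icc 0 T) :
    transport A s = 1 + ∫ σ in (0 : ℝ)..s, A σ * transport A σ := by
  have hsum : ∀ σ ∈ Icc 0 T, Summable fun k => peanoBaker A k σ := fun σ hσ =>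
    Summable.of_norm_bounded (Real.summable_pow_div_factorial (singularIntegral β C T))
      (fun k => peanoBaker_le hβ hC hT h k hσ)
  have hG := Real.summable_pow_div_factorial (singularIntegral β C T)
  have key : HasSum (fun k => ∫ σ in (0 : ℝ)..s, A σ * peanoBaker A k σ)
      (∫ σ in (0 : ℝ)..s, A σ * transport A σ) := by
    refine intervalIntegral.hasSum_integral_of_dominated_convergence
      (fun k σ => C * σ ^ (-β) * (singularIntegral β C T ^ k / k.factorial)) ?_ ?_ ?_ ?_ ?_
    · intro k
      refine aestronglyMeasurable_uIoc hs.1 ?_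
      exact (h.cont.mono (Ioo_subset_Ioo_right hs.2)).mul ((peanoBaker_aux hβ hC hT h k).1.mono
        (Ioo_subset_Icc_self.trans (Icc_subset_Icc_right hs.2)))
    · intro k
      filter_upwards [ae_mem_Ioo_of_mem_uIoc hs.1] with σ hσ h'
      have hσ : σ ∈ Ioo 0 T := ⟨(hσ h').1, (hσ h').2.trans_le hs.2⟩
      refine (norm_mul_le _ _).trans ?_
      have := Real.rpow_nonneg hσ.1.le (-β)
      exact mul_le_mul (h.bound σ hσ) (peanoBaker_le hβ hC hT h k (Ioo_subset_Icc_self hσ))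
        (norm_nonneg _) (by positivity)
    · exact Eventually.of_forall fun σ _ => hG.mul_left _
    · simp_rw [tsum_mul_left]
      exact (intervalIntegrable_mul_rpow_neg hβ C 0 s).mul_const _
    · refine Eventually.of_forall fun σ h' => ?_
      rw [uIoc_of_le hs.1] at h'
      exact (hsum σ ⟨h'.1.le, h'.2.trans hs.2⟩).hasSum.mul_left _
  rw [← key.tsum_eq, transport, (hsum s hs).tsum_eq_zero_add]
  rfl

theorem transport_zero (A : ℝ → 𝔸) : transport A 0 = 1 := by
  rw [transport, tsum_eq_single 0]
  · rfl
  · intro k hk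
    obtain ⟨k, rfl⟩ := Nat.exists_eq_succ_of_ne_zero hk
    simp [peanoBaker]

theorem hasDerivAt_transport {A : ℝ → 𝔸} {β C T : ℝ} (hβ : β < 1) (hC : 0 ≤ C)
    (h : WeaklySingular A β C T) {s : ℝ} (hs : s ∈ Ioo 0 T) :
    HasDerivAt (transport A) (A s * transport A s) s := by
  have hT : 0 ≤ T := (hs.1.trans hs.2).le
  have hw : WeaklySingular (fun s => A s * transport A s) β (C * transportBound β C T) T :=
    h.mul_continuous hC ((continuousOn_transport hβ hC hT h).mono Ioo_subset_Icc_self)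
      fun s hs => norm_transport_le hβ hC hT h (Ioo_subset_Icc_self hs)
  refine ((hw.hasDerivAt_integral hβ hs).const_add 1).congr_of_eventuallyEq ?_
  filter_upwards [isOpen_Ioo.mem_nhds hs] with u hu
  exact transport_eq_integral hβ hC hT h (Ioo_subset_Icc_self hu)

open MulOpposite in
/-- The solution of `Ψ' = -Ψ A`, `Ψ(0) = 1`. -/
def cotransport (A : ℝ → 𝔸) (s : ℝ) : 𝔸 := unop (transport (fun σ => -op (A σ)) s)

theorem WeaklySingular.neg_op {A : ℝ → 𝔸} {β C T : ℝ} (h : WeaklySingular A β C T) :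
    WeaklySingular (fun σ => -MulOpposite.op (A σ)) β C T :=
  ⟨(MulOpposite.continuous_op.comp_continuousOn h.cont).neg, fun s hs => by
    rw [norm_neg, MulOpposite.norm_op]
    exact h.bound s hs⟩

theorem cotransport_zero (A : ℝ → 𝔸) : cotransport A 0 = 1 := by
  simp [cotransport, transport_zero]

theorem continuousOn_cotransport {A : ℝ → 𝔸} {β C T : ℝ} (hβ : β < 1) (hC : 0 ≤ C) (hT : 0 ≤ T)
    (h : WeaklySingular A β C T) : ContinuousOn (cotransport A) (Icc 0 T) :=
  MulOpposite.continuous_unop.comp_continuousOn (continuousOn_transport hβ hC hT h.neg_op)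

theorem norm_cotransport_le {A : ℝ → 𝔸} {β C T : ℝ} (hβ : β < 1) (hC : 0 ≤ C) (hT : 0 ≤ T)
    (h : WeaklySingular A β C T) {s : ℝ} (hs : s ∈ Icc 0 T) :
    ‖cotransport A s‖ ≤ transportBound β C T :=
  norm_transport_le hβ hC hT h.neg_op hs

theorem hasDerivAt_cotransport {A : ℝ → 𝔸} {β C T : ℝ} (hβ : β < 1) (hC : 0 ≤ C)
    (h : WeaklySingular A β C T) {s : ℝ} (hs : s ∈ Ioo 0 T) :
    HasDerivAt (cotransport A) (-(cotransport A s * A s)) s := by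
  have h1 := hasDerivAt_transport hβ hC h.neg_op hs
  have h2 := ((MulOpposite.opContinuousLinearEquiv ℝ (M := 𝔸)).symm :
    𝔸ᵐᵒᵖ →L[ℝ] 𝔸).hasFDerivAt.comp_hasDerivAt s h1
  refine h2.congr_deriv ?_
  simp [cotransport]

/-- The derivative -ΨAΦ + ΨAΦ vanishes. This one cancellation yields both invertibility of the
transport and uniqueness of solutions. -/
theorem cotransport_mul_eq {A Φ : ℝ → 𝔸} {β C T : ℝ} (hβ : β < 1) (hC : 0 ≤ C) (hT : 0 ≤ T)
    (h : WeaklySingular A β C T) (hΦ : ContinuousOn Φ (Icc 0 T))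
    (hΦ' : ∀ s ∈ Ioo 0 T, HasDerivAt Φ (A s * Φ s) s) {s : ℝ} (hs : s ∈ Icc 0 T) :
    cotransport A s * Φ s = Φ 0 := by
  have := eq_of_hasDerivAt_zero (Y := fun s => cotransport A s * Φ s)
    ((continuousOn_cotransport hβ hC hT h).mul hΦ) (fun s hs => by
      refine ((hasDerivAt_cotransport hβ hC h hs).mul (hΦ' s hs)).congr_deriv ?_
      noncomm_ring) hs
  simpa [cotransport_zero] using this

theorem cotransport_mul_transport {A : ℝ → 𝔸} {β C T : ℝ} (hβ : β < 1) (hC : 0 ≤ C) (hT : 0 ≤ T)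
    (h : WeaklySingular A β C T) {s : ℝ} (hs : s ∈ Icc 0 T) :
    cotransport A s * transport A s = 1 := by
  rw [cotransport_mul_eq hβ hC hT h (continuousOn_transport hβ hC hT h)
    (fun s hs => hasDerivAt_transport hβ hC h hs) hs, transport_zero]

variable [IsDedekindFiniteMonoid 𝔸]

/-- The differential equations give only a left inverse directly; Dedekind finiteness of the algebra
makes it two-sided. -/
theorem transport_mul_cotransport {A : ℝ → 𝔸} {β C T : ℝ} (hβ : β < 1) (hC : 0 ≤ C) (hT : 0 ≤ T)
    (h : WeaklySingular A β C T) {s : ℝ} (hs : s ∈ Icc 0 T) :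
    transport A s * cotransport A s = 1 :=
  mul_eq_one_symm (cotransport_mul_transport hβ hC hT h hs)

theorem eq_transport_mul {A Φ : ℝ → 𝔸} {β C T : ℝ} (hβ : β < 1) (hC : 0 ≤ C) (hT : 0 ≤ T)
    (h : WeaklySingular A β C T) (hΦ : ContinuousOn Φ (Icc 0 T))
    (hΦ' : ∀ s ∈ Ioo 0 T, HasDerivAt Φ (A s * Φ s) s) {s : ℝ} (hs : s ∈ Icc 0 T) :
    Φ s = transport A s * Φ 0 := by
  rw [← cotransport_mul_eq hβ hC hT h hΦ hΦ' hs, ← mul_assoc,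
    transport_mul_cotransport hβ hC hT h hs, one_mul]

/-- Duhamel's formula. -/
theorem transport_sub_transport {A B : ℝ → 𝔸} {β C T : ℝ} (hβ : β < 1) (hC : 0 ≤ C) (hT : 0 ≤ T)
    (hA : WeaklySingular A β C T) (hB : WeaklySingular B β C T) {s : ℝ} (hs : s ∈ Icc 0 T) :
    transport B s - transport A s =
      transport A s * ∫ σ in (0 : ℝ)..s, cotransport A σ * (B σ - A σ) * transport B σ := by
  have hsub : WeaklySingular (fun σ => B σ - A σ) β (C + C) T :=
    ⟨hB.cont.sub hA.cont, fun s hs => (norm_sub_le _ _).trans (by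
      rw [add_mul]; exact add_le_add (hB.bound s hs) (hA.bound s hs))⟩
  have hw := (hsub.continuous_mul (transportBound_nonneg β C T)
    ((continuousOn_cotransport hβ hC hT hA).mono Ioo_subset_Icc_self)
    fun s hs => norm_cotransport_le hβ hC hT hA (Ioo_subset_Icc_self hs)).mul_continuous
      (by have := transportBound_nonneg β C T; positivity)
    ((continuousOn_transport hβ hC hT hB).mono Ioo_subset_Icc_self)
    fun s hs => norm_transport_le hβ hC hT hB (Ioo_subset_Icc_self hs)
  -- The integrand is the derivative of Ψ_A Φ_B, where Ψ_A is inverse to Φ_A.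
  rw [hw.integral_deriv hβ (Y := fun s => cotransport A s * transport B s)
    ((continuousOn_cotransport hβ hC hT hA).mul (continuousOn_transport hβ hC hT hB)) ?_ hs]
  · simp only [cotransport_zero, transport_zero, mul_sub, mul_one, ← mul_assoc]
    rw [transport_mul_cotransport hβ hC hT hA hs, one_mul]
  · intro s hs
    refine ((hasDerivAt_cotransport hβ hC hA hs).mul
      (hasDerivAt_transport hβ hC hB hs)).congr_deriv ?_
    noncomm_ring

/-- The common core of continuity and differentiability with respect to parameters. -/
theorem tendsto_smul_transport_sub {ι 𝕜 : Type*} [NormedField 𝕜] [NormedAlgebra 𝕜 𝔸]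
    [SMulCommClass ℝ 𝕜 𝔸]
    {l : Filter ι} [l.IsCountablyGenerated] {A : ι → ℝ → 𝔸} {A₀ D Φ : ℝ → 𝔸} {c : ι → 𝕜}
    {β C C' T : ℝ} (hβ : β < 1) (hC : 0 ≤ C) (hC' : 0 ≤ C') (hT : 0 ≤ T)
    (hA : ∀ᶠ p in l, WeaklySingular (A p) β C T) (hA₀ : WeaklySingular A₀ β C T)
    (hb : ∀ᶠ p in l, ∀ s ∈ Ioo 0 T, ‖c p • (A p s - A₀ s)‖ ≤ C' * s ^ (-β))
    (hlim : ∀ s ∈ Ioo 0 T, Tendsto (fun p => c p • (A p s - A₀ s) * transport (A p) s) l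
      (𝓝 (D s * Φ s))) :
    Tendsto (fun p => c p • (transport (A p) T - transport A₀ T)) l
      (𝓝 (transport A₀ T * ∫ σ in (0 : ℝ)..T, cotransport A₀ σ * (D σ * Φ σ))) := by
  have hTT : T ∈ Icc 0 T := right_mem_Icc.2 hT
  set B := transportBound β C T
  have hB : 0 ≤ B := transportBound_nonneg β C T
  have h1 : Tendsto (fun p => ∫ σ in (0 : ℝ)..T,
      cotransport A₀ σ * (c p • (A p σ - A₀ σ) * transport (A p) σ)) l
      (𝓝 (∫ σ in (0 : ℝ)..T, cotransport A₀ σ * (D σ * Φ σ))) := by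
    refine intervalIntegral.tendsto_integral_filter_of_dominated_convergence
      (fun σ => (B * C' * B) * σ ^ (-β)) ?_ ?_ (intervalIntegrable_mul_rpow_neg hβ _ 0 T) ?_
    · filter_upwards [hA] with p hp
      refine aestronglyMeasurable_uIoc hT ?_
      exact ((continuousOn_cotransport hβ hC hT hA₀).mono Ioo_subset_Icc_self).mul
        (((hp.cont.sub hA₀.cont).const_smul (c p)).mul
        ((continuousOn_transport hβ hC hT hp).mono Ioo_subset_Icc_self))
    · filter_upwards [hA, hb] with p hp hbp
      filter_upwards [ae_mem_Ioo_of_mem_uIoc hT] with σ hσ h'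
      have hσ := hσ h'
      have h2 := norm_cotransport_le hβ hC hT hA₀ (Ioo_subset_Icc_self hσ)
      have h3 := norm_transport_le hβ hC hT hp (Ioo_subset_Icc_self hσ)
      have h4 := Real.rpow_nonneg hσ.1.le (-β)
      calc _ ≤ ‖cotransport A₀ σ‖ * (‖c p • (A p σ - A₀ σ)‖ * ‖transport (A p) σ‖) :=
            (norm_mul_le _ _).trans (by gcongr; exact norm_mul_le _ _)
        _ ≤ B * ((C' * σ ^ (-β)) * B) := by
            gcongr
            exact hbp σ hσ
        _ = _ := by ring
    · filter_upwards [ae_mem_Ioo_of_mem_uIoc hT] with σ hσ h'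
      exact (hlim σ (hσ h')).const_mul _
  refine (h1.const_mul (transport A₀ T)).congr' ?_
  filter_upwards [hA] with p hp
  rw [transport_sub_transport hβ hC hT hA₀ hp hTT, ← mul_smul_comm, ← intervalIntegral.integral_smul]
  congr 1
  refine intervalIntegral.integral_congr fun σ _ => ?_
  simp only [mul_assoc, mul_smul_comm, smul_mul_assoc]

/-- Scalar c = 1 and limit 0 in the common core: A p - A₀ tends to 0 pointwise while the transports
stay below the fixed exponential bound. -/
theorem tendsto_transport {ι : Type*} {l : Filter ι} [l.IsCountablyGenerated]
    {A : ι → ℝ → 𝔸} {A₀ : ℝ → 𝔸} {β C T : ℝ} (hβ : β < 1) (hC : 0 ≤ C) (hT : 0 ≤ T)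
    (hA : ∀ᶠ p in l, WeaklySingular (A p) β C T) (hA₀ : WeaklySingular A₀ β C T)
    (hlim : ∀ s ∈ Ioo 0 T, Tendsto (fun p => A p s) l (𝓝 (A₀ s))) :
    Tendsto (fun p => transport (A p) T) l (𝓝 (transport A₀ T)) := by
  have := tendsto_smul_transport_sub (𝕜 := ℝ) (c := fun _ => 1) (D := 0) (Φ := 0) hβ hC
    (add_nonneg hC hC) hT hA hA₀ ?_ ?_
  · simpa [tendsto_sub_nhds_zero_iff] using this
  · filter_upwards [hA] with p hp s hs
    rw [one_smul]
    exact (norm_sub_le _ _).trans (by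
      rw [add_mul]; exact add_le_add (hp.bound s hs) (hA₀.bound s hs))
  · intro s hs
    have h1 : Tendsto (fun p => ‖A p s - A₀ s‖ * transportBound β C T) l (𝓝 0) := by
      have := ((hlim s hs).sub_const (A₀ s)).norm.mul_const (transportBound β C T)
      simpa using this
    have h0 : (0 : ℝ → 𝔸) s * (0 : ℝ → 𝔸) s = 0 := by simp
    rw [h0]
    refine squeeze_zero_norm' ?_ h1
    filter_upwards [hA] with p hp
    rw [one_smul]
    exact (norm_mul_le _ _).trans (mul_le_mul_of_nonneg_left
      (norm_transport_le hβ hC hT hp (Ioo_subset_Icc_self hs)) (norm_nonneg _))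

/-- Differentiation of a solution with respect to a parameter. -/
theorem hasDerivAt_transport_param {𝕜 : Type*} [NontriviallyNormedField 𝕜] [NormedAlgebra 𝕜 𝔸]
    [SMulCommClass ℝ 𝕜 𝔸]
    {A : 𝕜 → ℝ → 𝔸} {D : ℝ → 𝔸} {p₀ : 𝕜}
    {β C C' T : ℝ} (hβ : β < 1) (hC : 0 ≤ C) (hC' : 0 ≤ C') (hT : 0 ≤ T)
    (hA : ∀ᶠ p in 𝓝 p₀, WeaklySingular (A p) β C T)
    (hb : ∀ᶠ p in 𝓝 p₀, ∀ s ∈ Ioo 0 T, ‖A p s - A p₀ s‖ ≤ C' * s ^ (-β) * ‖p - p₀‖)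
    (hD : ∀ s ∈ Ioo 0 T, HasDerivAt (fun p => A p s) (D s) p₀) :
    HasDerivAt (fun p => transport (A p) T)
      (transport (A p₀) T * ∫ σ in (0 : ℝ)..T,
        cotransport (A p₀) σ * (D σ * transport (A p₀) σ)) p₀ := by
  rw [hasDerivAt_iff_tendsto_slope]
  have hl : (𝓝[≠] p₀) ≤ 𝓝 p₀ := nhdsWithin_le_nhds
  -- The scalar is now that of the difference quotient. The factor `transport (A p) s` in the
  -- integrand converges by the continuity result, applied on [0,s].
  refine tendsto_smul_transport_sub (c := fun p => (p - p₀)⁻¹) hβ hC hC' hT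
    (hA.filter_mono hl) hA.self_of_nhds ?_ ?_
  · filter_upwards [hb.filter_mono hl, self_mem_nhdsWithin] with p hp hne s hs
    have : 0 < ‖p - p₀‖ := norm_pos_iff.2 (sub_ne_zero.2 hne)
    rw [norm_smul, norm_inv, inv_mul_le_iff₀ this]
    linarith [hp s hs]
  · intro s hs
    have h1 := hasDerivAt_iff_tendsto_slope.1 (hD s hs)
    refine h1.mul ?_
    refine tendsto_transport hβ hC hs.1.le
      ((hA.mono fun p hp => hp.mono hs.2.le).filter_mono hl) (hA.self_of_nhds.mono hs.2.le) ?_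
    intro σ hσ
    exact ((hD σ ⟨hσ.1, hσ.2.trans hs.2⟩).continuousAt.tendsto).mono_left hl

end Transport

/-! ### Holomorphic dependence on a parameter, and connections of zero curvature. -/

section

variable {𝔸 : Type*} [NormedRing 𝔸] [NormedAlgebra ℝ 𝔸] [CompleteSpace 𝔸] [NormOneClass 𝔸]
  [IsDedekindFiniteMonoid 𝔸]

/-- A solution depends holomorphically on a parameter on which its equation does. -/
theorem differentiableOn_transport [NormedAlgebra ℂ 𝔸] [SMulCommClass ℝ ℂ 𝔸]
    {P Q : ℝ → 𝔸} {ℓ : ℝ → ℂ → ℂ} {Ω : Set ℂ} {β C T : ℝ} (hβ : β < 1) (hC : 0 ≤ C) (hT : 0 ≤ T)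
    (hP : WeaklySingular P β C T) (hQ : WeaklySingular Q β C T) (hΩ : IsOpen Ω)
    (hc : ContinuousOn (fun p : ℝ × ℂ => ℓ p.1 p.2) (Icc 0 T ×ˢ Ω))
    (hd : ∀ s ∈ Icc 0 T, DifferentiableOn ℂ (ℓ s) Ω) :
    DifferentiableOn ℂ (fun z => transport (fun s => P s + ℓ s z • Q s) T) Ω := by
  intro z₀ hz₀
  obtain ⟨r, hr, hrΩ⟩ := Metric.nhds_basis_closedBall.mem_iff.1 (hΩ.mem_nhds hz₀)
  obtain ⟨M, hM⟩ := ((isCompact_Icc.prod (isCompact_closedBall z₀ r)).exists_bound_of_continuousOn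
    (hc.mono (prod_mono_right hrΩ)))
  have hM : ∀ s ∈ Icc 0 T, ∀ z ∈ Metric.closedBall z₀ r, ‖ℓ s z‖ ≤ M := fun s hs z hz =>
    hM (s, z) ⟨hs, hz⟩
  have hM0 : 0 ≤ M := (norm_nonneg _).trans (hM 0 (left_mem_Icc.2 hT) z₀
    (Metric.mem_closedBall_self hr.le))
  have hball : ∀ᶠ z in 𝓝 z₀, z ∈ Metric.ball z₀ r := Metric.ball_mem_nhds z₀ hr
  -- The Schwarz lemma turns the bound M into a Lipschitz bound in z that is uniform in s, which
  -- provides the dominating function. Differences are at most 2M; the extra 1 is slack.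
  have hlip : ∀ z ∈ Metric.ball z₀ r, ∀ s ∈ Icc 0 T,
      ‖ℓ s z - ℓ s z₀‖ ≤ (2 * M + 1) / r * ‖z - z₀‖ := by
    intro z hz s hs
    rw [← dist_eq_norm, ← dist_eq_norm]
    refine Complex.dist_le_div_mul_dist_of_mapsTo_ball
      ((hd s hs).mono (Metric.ball_subset_closedBall.trans hrΩ)) ?_ hz
    intro u hu
    have h1 := hM s hs u (Metric.ball_subset_closedBall hu)
    have h2 := hM s hs z₀ (Metric.mem_closedBall_self hr.le)
    rw [mem_closedBall_iff_norm]
    linarith [norm_sub_le (ℓ s u) (ℓ s z₀)]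
  have key := hasDerivAt_transport_param (𝕜 := ℂ) (p₀ := z₀)
    (A := fun z s => P s + ℓ s z • Q s) (D := fun s => deriv (ℓ s) z₀ • Q s)
    (β := β) (C := C + M * C) (C' := (2 * M + 1) / r * C) (T := T)
    hβ (by positivity) (by positivity) hT ?_ ?_ ?_
  · exact key.differentiableAt.differentiableWithinAt
  · filter_upwards [hball] with z hz
    have hz' := Metric.ball_subset_closedBall hz
    refine ⟨hP.cont.add (ContinuousOn.smul ?_ hQ.cont), fun s hs => ?_⟩
    · exact hc.comp (f := fun s => (s, z)) (by fun_prop)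
        fun s hs => ⟨Ioo_subset_Icc_self hs, hrΩ hz'⟩
    · have h1 := hM s (Ioo_subset_Icc_self hs) z hz'
      have h2 := Real.rpow_nonneg hs.1.le (-β)
      calc _ ≤ ‖P s‖ + ‖ℓ s z‖ * ‖Q s‖ := (norm_add_le _ _).trans (by rw [norm_smul])
        _ ≤ C * s ^ (-β) + M * (C * s ^ (-β)) := by
          gcongr
          · exact hP.bound s hs
          · exact hQ.bound s hs
        _ = _ := by ring
  · filter_upwards [hball] with z hz s hs
    have h1 := hlip z hz s (Ioo_subset_Icc_self hs)
    have h2 := Real.rpow_nonneg hs.1.le (-β)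
    rw [add_sub_add_left_eq_sub, ← sub_smul, norm_smul]
    calc _ ≤ ((2 * M + 1) / r * ‖z - z₀‖) * (C * s ^ (-β)) := by
          gcongr
          exact hQ.bound s hs
      _ = _ := by ring
  · intro s hs
    have h1 := ((hd s (Ioo_subset_Icc_self hs)).differentiableAt (hΩ.mem_nhds hz₀)).hasDerivAt
    exact (h1.smul_const (Q s)).const_add (P s)

/-- If `U_t - V_s + [U,V] = 0`, the solution of `Φ_s = U Φ` along a horizontal segment changes with
the height of the segment as `V` at its ends prescribes. -/
theorem hasDerivAt_transport_of_flat {U U' : ℝ → ℝ → 𝔸} {W : ℝ → 𝔸} {β C C' T a b t₀ : ℝ}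
    (hβ : β < 1) (hC : 0 ≤ C) (hC' : 0 ≤ C') (hT : 0 ≤ T) (ht₀ : t₀ ∈ Ioo a b)
    (hU : ∀ t ∈ Ioo a b, WeaklySingular (fun s => U s t) β C T)
    (hU' : ∀ s ∈ Ioo 0 T, ∀ t ∈ Ioo a b, HasDerivAt (U s) (U' s t) t)
    (hb : ∀ s ∈ Ioo 0 T, ∀ t ∈ Ioo a b, ‖U' s t‖ ≤ C' * s ^ (-β))
    (hU'c : ContinuousOn (fun s => U' s t₀) (Ioo 0 T))
    (hW : ContinuousOn W (Icc 0 T))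
    (hW' : ∀ s ∈ Ioo 0 T, HasDerivAt W (U' s t₀ + U s t₀ * W s - W s * U s t₀) s) :
    HasDerivAt (fun t => transport (fun s => U s t) T)
      (W T * transport (fun s => U s t₀) T - transport (fun s => U s t₀) T * W 0) t₀ := by
  have hnhds : ∀ᶠ t in 𝓝 t₀, t ∈ Ioo a b := isOpen_Ioo.mem_nhds ht₀
  have h0 := hU t₀ ht₀
  have key := hasDerivAt_transport_param (𝕜 := ℝ) (p₀ := t₀)
    (A := fun t s => U s t) (D := fun s => U' s t₀)
    (β := β) (C := C) (C' := C') (T := T) hβ hC hC' hT ?_ ?_ ?_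
  · refine key.congr_deriv ?_
    have hD : WeaklySingular (fun s => U' s t₀) β C' T := ⟨hU'c, fun s hs => hb s hs t₀ ht₀⟩
    have hw := (hD.continuous_mul (transportBound_nonneg β C T)
      ((continuousOn_cotransport hβ hC hT h0).mono Ioo_subset_Icc_self)
      fun s hs => norm_cotransport_le hβ hC hT h0 (Ioo_subset_Icc_self hs)).mul_continuous
        (by have := transportBound_nonneg β C T; positivity)
      ((continuousOn_transport hβ hC hT h0).mono Ioo_subset_Icc_self)
      fun s hs => norm_transport_le hβ hC hT h0 (Ioo_subset_Icc_self hs)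
    simp only [← mul_assoc] at hw ⊢
    -- By flatness the integrand ΨU'Φ of the variation formula is the exact derivative of ΨWΦ, so
    -- only the two end values remain.
    rw [hw.integral_deriv hβ (Y := fun s => cotransport (fun s => U s t₀) s * W s *
      transport (fun s => U s t₀) s) (((continuousOn_cotransport hβ hC hT h0).mul hW).mul
      (continuousOn_transport hβ hC hT h0)) ?_ (right_mem_Icc.2 hT)]
    · simp only [cotransport_zero, transport_zero, mul_sub, one_mul, mul_one, ← mul_assoc]
      rw [transport_mul_cotransport hβ hC hT h0 (right_mem_Icc.2 hT), one_mul]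
    · intro s hs
      refine (((hasDerivAt_cotransport hβ hC h0 hs).fun_mul (hW' s hs)).fun_mul
        (hasDerivAt_transport hβ hC h0 hs)).congr_deriv ?_
      noncomm_ring
  · filter_upwards [hnhds] with t ht using hU t ht
  · filter_upwards [hnhds] with t ht s hs
    refine (convex_Ioo a b).norm_image_sub_le_of_norm_hasDerivWithin_le
      (f := U s) (f' := U' s) (fun t ht => (hU' s hs t ht).hasDerivWithinAt) (hb s hs) ht₀ ht
  · exact fun s hs => hU' s hs t₀ ht₀

/-- A flat connection with weak singularities on two sides of a rectangle has no holonomy. -/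
theorem transport_mul_transport_of_flat {U U' V : ℝ → ℝ → 𝔸} {β C X Y : ℝ} (hβ0 : 0 ≤ β)
    (hβ : β < 1) (hC : 0 ≤ C) (hX : 0 ≤ X) (hY : 0 ≤ Y)
    (hU : ∀ t ∈ Icc 0 Y, WeaklySingular (fun s => U s t) β C X)
    (hUc : ∀ s ∈ Ioo 0 X, ContinuousOn (U s) (Icc 0 Y))
    (hV0 : WeaklySingular (V 0) β C Y) (hVX : WeaklySingular (V X) β C Y)
    (hVc : ∀ t ∈ Ioo 0 Y, ContinuousOn (fun s => V s t) (Icc 0 X))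
    (hU' : ∀ s ∈ Ioo 0 X, ∀ t ∈ Ioo 0 Y, HasDerivAt (U s) (U' s t) t)
    (hb : ∀ s ∈ Ioo 0 X, ∀ t ∈ Ioo 0 Y, ‖U' s t‖ ≤ C * s ^ (-β) * t ^ (-β))
    (hU'c : ∀ t ∈ Ioo 0 Y, ContinuousOn (fun s => U' s t) (Ioo 0 X))
    (hV' : ∀ s ∈ Ioo 0 X, ∀ t ∈ Ioo 0 Y,
      HasDerivAt (fun s => V s t) (U' s t + U s t * V s t - V s t * U s t) s) :
    transport (fun s => U s Y) X * transport (V 0) Y =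
      transport (V X) Y * transport (fun s => U s 0) X := by
  have hder : ∀ t ∈ Ioo 0 Y, HasDerivAt (fun t => transport (fun s => U s t) X)
      (V X t * transport (fun s => U s t) X - transport (fun s => U s t) X * V 0 t) t := by
    intro t ht
    -- Staying above t/2 bounds the singular factor τ^(-β), so differentiation under the integral is
    -- legitimate near t.
    have ht2 : 0 < t / 2 := half_pos ht.1
    have hsub : Ioo (t / 2) Y ⊆ Ioo 0 Y := Ioo_subset_Ioo_left ht2.le
    refine hasDerivAt_transport_of_flat (U' := U') (W := fun s => V s t) (a := t / 2) (b := Y)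
      (C' := C * (t / 2) ^ (-β)) hβ hC (by positivity) hX ⟨half_lt_self ht.1, ht.2⟩
      (fun t ht => hU t (Ioo_subset_Icc_self (hsub ht))) (fun s hs t ht => hU' s hs t (hsub ht))
      ?_ (hU'c t ht) (hVc t ht) (fun s hs => hV' s hs t ht)
    intro s hs τ hτ
    have h1 := Real.rpow_nonneg hs.1.le (-β)
    have h2 : τ ^ (-β) ≤ (t / 2) ^ (-β) :=
      Real.rpow_le_rpow_of_nonpos ht2 hτ.1.le (by linarith)
    calc _ ≤ C * s ^ (-β) * τ ^ (-β) := hb s hs τ (hsub hτ)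
      _ ≤ C * s ^ (-β) * (t / 2) ^ (-β) := by gcongr
      _ = _ := by ring
  have hcont : ContinuousOn (fun t => transport (fun s => U s t) X) (Icc 0 Y) := by
    intro t ht
    refine tendsto_transport hβ hC hX ?_ (hU t ht) fun s hs => hUc s hs t ht
    filter_upwards [self_mem_nhdsWithin] with τ hτ using hU τ hτ
  have hYY : Y ∈ Icc 0 Y := right_mem_Icc.2 hY
  -- Transport across at height t, preceded by the left edge up to t and followed by the right edge
  -- back down, does not depend on t. Compare t = 0 with t = Y.
  have key := eq_of_hasDerivAt_zero (T := Y) (s := Y)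
    (Y := fun t => cotransport (V X) t * transport (fun s => U s t) X * transport (V 0) t)
    (((continuousOn_cotransport hβ hC hY hVX).mul hcont).mul (continuousOn_transport hβ hC hY hV0))
    (fun t ht => by
      refine (((hasDerivAt_cotransport hβ hC hVX ht).fun_mul (hder t ht)).fun_mul
        (hasDerivAt_transport hβ hC hV0 ht)).congr_deriv ?_
      noncomm_ring) hYY
  simp only [cotransport_zero, transport_zero, one_mul, mul_one] at key
  rw [← key, ← mul_assoc, ← mul_assoc, transport_mul_cotransport hβ hC hY hVX hYY, one_mul]

end

/-! ### Matrix entries -/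

/-- The continuous linear map taking a matrix to its `(i,j)` entry. -/
def entryCLM (i j : Fin 3) : Mat3 →L[ℂ] ℂ :=
  LinearMap.toContinuousLinearMap (Matrix.entryLinearMap ℂ ℂ i j)

theorem hasDerivAt_entry {Φ : ℝ → Mat3} {Φ' : Mat3} {s : ℝ} (h : HasDerivAt Φ Φ' s) (i j : Fin 3) :
    HasDerivAt (fun s => Φ s i j) (Φ' i j) s :=
  ((entryCLM i j).restrictScalars ℝ).hasFDerivAt.comp_hasDerivAt s h

theorem hasDerivAt_of_entries {Φ : ℝ → Mat3} {Φ' : Mat3} {s : ℝ}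
    (h : ∀ i j, HasDerivAt (fun s => Φ s i j) (Φ' i j) s) : HasDerivAt Φ Φ' s :=
  hasDerivAt_pi.2 fun i => hasDerivAt_pi.2 (h i)

theorem continuousOn_of_entries {X : Type*} [TopologicalSpace X] {Φ : X → Mat3} {S : Set X}
    (h : ∀ i j, ContinuousOn (fun s => Φ s i j) S) : ContinuousOn Φ S :=
  continuousOn_pi.2 fun i => continuousOn_pi.2 (h i)

theorem continuousOn_entry {X : Type*} [TopologicalSpace X] {Φ : X → Mat3} {S : Set X}
    (h : ContinuousOn Φ S) (i j : Fin 3) : ContinuousOn (fun s => Φ s i j) S :=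
  (entryCLM i j).continuous.comp_continuousOn h

theorem norm_entry_le (i j : Fin 3) (M : Mat3) : ‖M i j‖ ≤ ‖M‖ := by
  rw [Matrix.linfty_opNorm_def]
  have h1 : ‖M i j‖₊ ≤ ∑ k, ‖M i k‖₊ :=
    Finset.single_le_sum (f := fun k => ‖M i k‖₊) (fun _ _ => zero_le) (Finset.mem_univ j)
  exact_mod_cast h1.trans (Finset.le_sup (f := fun i => ∑ k, ‖M i k‖₊) (Finset.mem_univ i))

theorem norm_le_of_entries {M : Mat3} {c : ℝ} (h : ∀ i j, ‖M i j‖ ≤ c) : ‖M‖ ≤ 3 * c := by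
  have hc : 0 ≤ c := (norm_nonneg _).trans (h 0 0)
  lift c to NNReal using hc
  rw [Matrix.linfty_opNorm_def]
  have : (Finset.univ.sup fun i => ∑ k, ‖M i k‖₊) ≤ 3 * c := by
    refine Finset.sup_le fun i _ => ?_
    refine (Finset.sum_le_sum fun k _ => (show ‖M i k‖₊ ≤ c from h i k)).trans ?_
    simp
  exact_mod_cast this

theorem WeaklySingular.entry {A : ℝ → Mat3} {β C T : ℝ} (h : WeaklySingular A β C T)
    (i j : Fin 3) : WeaklySingular (fun s => A s i j) β C T :=
  ⟨continuousOn_entry h.cont i j, fun s hs => (norm_entry_le i j _).trans (h.bound s hs)⟩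

/-- A continuous Φ is bounded on [0,T], so AΦ is again weakly singular and the integral equation is
equivalent to the initial value problem, whose solution is unique. Existence and uniqueness of the
jump matrix rest on this. -/
theorem isVolterraValue_iff {A : ℝ → Mat3} {β C T : ℝ} {W : Mat3} (hβ : β < 1) (hC : 0 ≤ C)
    (hT : 0 ≤ T) (h : WeaklySingular A β C T) : IsVolterraValue A T W ↔ W = transport A T := by
  have hTT : T ∈ Icc 0 T := right_mem_Icc.2 hT
  constructor
  · rintro ⟨Φ, hΦ, hΦ', rfl⟩
    obtain ⟨B, hB⟩ := isCompact_Icc.exists_bound_of_continuousOn hΦ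
    have hw : WeaklySingular (fun s => A s * Φ s) β (C * B) T :=
      h.mul_continuous hC (hΦ.mono Ioo_subset_Icc_self) fun s hs => hB s (Ioo_subset_Icc_self hs)
    have hd : ∀ s ∈ Ioo 0 T, HasDerivAt Φ (A s * Φ s) s := by
      intro s hs
      refine hasDerivAt_of_entries fun i j => ?_
      refine (((hw.entry i j).hasDerivAt_integral hβ hs).const_add
        ((1 : Mat3) i j)).congr_of_eventuallyEq ?_
      filter_upwards [isOpen_Ioo.mem_nhds hs] with u hu
      exact hΦ' u (Ioo_subset_Icc_self hu) i j
    have h0 : Φ 0 = 1 := by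
      ext i j
      simpa using hΦ' 0 (left_mem_Icc.2 hT) i j
    have := eq_transport_mul hβ hC hT h hΦ hd hTT
    rwa [h0, mul_one] at this
  · rintro rfl
    refine ⟨transport A, continuousOn_transport hβ hC hT h, fun s hs i j => ?_, rfl⟩
    have hw : WeaklySingular (fun s => A s * transport A s) β (C * transportBound β C T) T :=
      h.mul_continuous hC ((continuousOn_transport hβ hC hT h).mono Ioo_subset_Icc_self)
        fun s hs => norm_transport_le hβ hC hT h (Ioo_subset_Icc_self hs)
    rw [(hw.entry i j).integral_deriv hβ (Y := fun s => transport A s i j)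
      (continuousOn_entry (continuousOn_transport hβ hC hT h) i j)
      (fun s hs => hasDerivAt_entry (hasDerivAt_transport hβ hC h hs) i j) hs, transport_zero]
    ring

/-! ### Sets of finite length are removable for continuous functions -/

/-- `K` is covered by `O(1/ε)` discs of radius `ε`. -/
def LinearlyCovered (K : Set ℂ) : Prop :=
  ∃ C : ℝ, ∀ ε : ℝ, 0 < ε → ε ≤ 1 → ∃ F : Finset ℂ, (F.card : ℝ) ≤ C / ε ∧
    K ⊆ ⋃ c ∈ F, Metric.closedBall c ε

theorem LinearlyCovered.union {K L : Set ℂ} (hK : LinearlyCovered K) (hL : LinearlyCovered L) :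
    LinearlyCovered (K ∪ L) := by
  classical
  obtain ⟨C, hC⟩ := hK
  obtain ⟨C', hC'⟩ := hL
  refine ⟨C + C', fun ε h0 h1 => ?_⟩
  obtain ⟨F, hF, hF'⟩ := hC ε h0 h1
  obtain ⟨G, hG, hG'⟩ := hC' ε h0 h1
  refine ⟨F ∪ G, ?_, union_subset (hF'.trans ?_) (hG'.trans ?_)⟩
  · rw [add_div]
    exact (Nat.cast_le.2 (Finset.card_union_le F G)).trans (by push_cast; exact add_le_add hF hG)
  · exact biUnion_subset_biUnion_left fun c hc => Finset.mem_union_left _ hc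
  · exact biUnion_subset_biUnion_left fun c hc => Finset.mem_union_right _ hc

theorem linearlyCovered_of_lipschitzOnWith {γ : ℝ → ℂ} {K : NNReal}
    (h : LipschitzOnWith K γ (Icc 0 1)) : LinearlyCovered (γ '' Icc 0 1) := by
  classical
  refine ⟨K + 3, fun ε h0 h1 => ?_⟩
  -- N equal parameter steps move γ by at most K/N ≤ ε each. The N + 1 ≤ K/ε + 3 grid points number
  -- at most (K + 3)/ε, as ε ≤ 1.
  set N : ℕ := ⌈(K : ℝ) / ε⌉₊ + 1
  have hN : (0 : ℝ) < N := by positivity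
  have hNK : (K : ℝ) / N ≤ ε := by
    rw [div_le_iff₀ hN]
    have : (K : ℝ) / ε ≤ N := (Nat.le_ceil _).trans (by simp [N])
    rwa [div_le_iff₀ h0, mul_comm] at this
  refine ⟨(Finset.range (N + 1)).image fun i : ℕ => γ (i / N), ?_, ?_⟩
  · have h2 : (N : ℝ) ≤ K / ε + 2 := by
      have := (Nat.ceil_lt_add_one (show (0 : ℝ) ≤ K / ε by positivity)).le
      push_cast [N]
      linarith
    have h3 : (3 : ℝ) ≤ 3 / ε := by rw [le_div_iff₀ h0]; linarith
    calc _ ≤ ((N + 1 : ℕ) : ℝ) := by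
          exact_mod_cast Finset.card_image_le.trans (Finset.card_range _).le
      _ ≤ K / ε + 3 := by push_cast; linarith
      _ ≤ K / ε + 3 / ε := by linarith
      _ = _ := by ring
  · rintro _ ⟨t, ht, rfl⟩
    have h2 : (⌊t * N⌋₊ : ℝ) ≤ t * N := Nat.floor_le (mul_nonneg ht.1 hN.le)
    have h3 : t * N < ⌊t * N⌋₊ + 1 := Nat.lt_floor_add_one _
    have h4 : (⌊t * N⌋₊ : ℝ) / N ≤ t := by rwa [div_le_iff₀ hN]
    have h5 : t - (⌊t * N⌋₊ : ℝ) / N ≤ 1 / N := by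
      rw [sub_le_iff_le_add, ← add_div, le_div_iff₀ hN]; linarith
    refine mem_iUnion₂.2 ⟨γ (⌊t * N⌋₊ / N), ?_, ?_⟩
    · refine Finset.mem_image.2 ⟨⌊t * N⌋₊, Finset.mem_range.2 ?_, rfl⟩
      have : (⌊t * N⌋₊ : ℝ) < (N + 1 : ℕ) := by
        push_cast
        nlinarith [ht.2]
      exact_mod_cast this
    · have h6 := h.dist_le_mul t ht (⌊t * N⌋₊ / N) ⟨by positivity, h4.trans ht.2⟩
      refine h6.trans (le_trans ?_ hNK)
      rw [Real.dist_eq, abs_of_nonneg (by linarith)]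
      calc (K : ℝ) * _ ≤ K * (1 / N) := by gcongr
        _ = _ := by ring

/-- The integral of `f` along the boundary of the rectangle `[a,b] × [c,d]`. -/
def rectIntegral (f : ℂ → ℂ) (a b c d : ℝ) : ℂ :=
  (∫ x in a..b, f (x + c * Complex.I)) - (∫ x in a..b, f (x + d * Complex.I)) +
    Complex.I • (∫ y in c..d, f (b + y * Complex.I)) - Complex.I • ∫ y in c..d, f (a + y * Complex.I)

/-- Opposite sides carry opposite signs, so only the increments of f across the rectangle enter. The
bound thus contains the oscillation of f in addition to the side lengths. -/
theorem norm_rectIntegral_le {f : ℂ → ℂ} (hf : Continuous f) {a b c d ω : ℝ}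
    (h1 : ∀ x ∈ [[a, b]], ‖f (x + c * Complex.I) - f (x + d * Complex.I)‖ ≤ ω)
    (h2 : ∀ y ∈ [[c, d]], ‖f (b + y * Complex.I) - f (a + y * Complex.I)‖ ≤ ω) :
    ‖rectIntegral f a b c d‖ ≤ ω * (|b - a| + |d - c|) := by
  have hi : ∀ (u v r : ℝ), IntervalIntegrable (fun x : ℝ => f (x + r * Complex.I)) volume u v :=
    fun u v r => (by fun_prop : Continuous fun x : ℝ => f (x + r * Complex.I)).intervalIntegrable _ _
  have hj : ∀ (u v r : ℝ), IntervalIntegrable (fun y : ℝ => f (r + y * Complex.I)) volume u v :=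
    fun u v r => (by fun_prop : Continuous fun y : ℝ => f (r + y * Complex.I)).intervalIntegrable _ _
  rw [rectIntegral, add_sub_assoc, ← smul_sub, ← intervalIntegral.integral_sub (hi _ _ _) (hi _ _ _),
    ← intervalIntegral.integral_sub (hj _ _ _) (hj _ _ _), mul_add]
  refine (norm_add_le _ _).trans (add_le_add ?_ ?_)
  · exact intervalIntegral.norm_integral_le_of_norm_le_const fun x hx =>
      h1 x (uIoc_subset_uIcc hx)
  · rw [norm_smul, Complex.norm_I, one_mul]
    exact intervalIntegral.norm_integral_le_of_norm_le_const fun x hx =>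
      h2 x (uIoc_subset_uIcc hx)

/-- The contributions of common sides cancel: one pair of sides telescopes, the other adds up to a
longer interval. -/
theorem sum_rectIntegral {f : ℂ → ℂ} (hf : Continuous f) (a c : ℕ → ℝ) (M : ℕ) :
    ∑ i ∈ Finset.range M, ∑ j ∈ Finset.range M,
      rectIntegral f (a i) (a (i + 1)) (c j) (c (j + 1)) =
      rectIntegral f (a 0) (a M) (c 0) (c M) := by
  have hi : ∀ (u v r : ℝ), IntervalIntegrable (fun x : ℝ => f (x + r * Complex.I)) volume u v :=
    fun u v r => (by fun_prop : Continuous fun x : ℝ => f (x + r * Complex.I)).intervalIntegrable _ _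
  have hj : ∀ (u v r : ℝ), IntervalIntegrable (fun y : ℝ => f (r + y * Complex.I)) volume u v :=
    fun u v r => (by fun_prop : Continuous fun y : ℝ => f (r + y * Complex.I)).intervalIntegrable _ _
  have hrow : ∀ i, ∑ j ∈ Finset.range M, rectIntegral f (a i) (a (i + 1)) (c j) (c (j + 1)) =
      rectIntegral f (a i) (a (i + 1)) (c 0) (c M) := by
    intro i
    simp only [rectIntegral]
    rw [Finset.sum_sub_distrib, Finset.sum_add_distrib, ← Finset.smul_sum, ← Finset.smul_sum,
      intervalIntegral.sum_integral_adjacent_intervals fun k _ => hj _ _ _,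
      intervalIntegral.sum_integral_adjacent_intervals fun k _ => hj _ _ _,
      Finset.sum_range_sub' fun j => ∫ x in a i..a (i + 1), f (x + c j * Complex.I)]
  simp only [hrow]
  simp only [rectIntegral, add_sub_assoc]
  rw [Finset.sum_add_distrib, Finset.sum_sub_distrib,
    intervalIntegral.sum_integral_adjacent_intervals fun k _ => hi _ _ _,
    intervalIntegral.sum_integral_adjacent_intervals fun k _ => hi _ _ _,
    Finset.sum_range_sub fun i => Complex.I • ∫ y in c 0..c M, f (a i + y * Complex.I)]

/-- The indices of the grid points `a + i p` within `2 |p|` of `r`. -/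
def nearbyIndices (a p r : ℝ) : Finset ℕ :=
  Finset.Icc ⌈(r - a) / p - 2⌉₊ (⌈(r - a) / p - 2⌉₊ + 4)

/-- An interval of length 4 holds at most five integers. If its lower end is negative, the natural
ceiling is 0 and the range still contains every natural number of the interval. The step p may be
negative. -/
theorem mem_nearbyIndices {a p r : ℝ} (hp : p ≠ 0) {i : ℕ} (h : |a + i * p - r| ≤ 2 * |p|) :
    i ∈ nearbyIndices a p r := by
  have hp' := abs_pos.2 hp
  have h1 : |i - (r - a) / p| ≤ 2 := by
    rw [← mul_le_mul_iff_left₀ hp', ← abs_mul, sub_mul, div_mul_cancel₀ _ hp]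
    rwa [show (i : ℝ) * p - (r - a) = a + i * p - r by ring]
  rw [abs_le] at h1
  refine Finset.mem_Icc.2 ⟨Nat.ceil_le.2 (by linarith), ?_⟩
  have h2 := Nat.le_ceil ((r - a) / p - 2)
  have : (i : ℝ) ≤ (⌈(r - a) / p - 2⌉₊ + 4 : ℕ) := by push_cast; linarith
  exact_mod_cast this

/-- Cut the rectangle into M² cells. Cells missing K contribute 0 by Cauchy's theorem. Only O(M)
cells meet K, and each contributes at most the oscillation ω of f on a cell times O(1/M). The total
is O(ω), and ω is arbitrary by uniform continuity. -/
theorem rectIntegral_eq_zero {f : ℂ → ℂ} (hf : Continuous f) {K : Set ℂ} (hK : LinearlyCovered K)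
    (hd : DifferentiableOn ℂ f Kᶜ) {a b c d : ℝ} (hab : a ≠ b) (hcd : c ≠ d) :
    rectIntegral f a b c d = 0 := by
  classical
  obtain ⟨C, hC⟩ := hK
  have hx : 0 < |b - a| := abs_pos.2 (sub_ne_zero.2 hab.symm)
  have hy : 0 < |d - c| := abs_pos.2 (sub_ne_zero.2 hcd.symm)
  set m := min |b - a| |d - c| with hm
  have hm0 : 0 < m := lt_min hx hy
  have key : ∀ ω > 0, ‖rectIntegral f a b c d‖ ≤ (25 * C * (|b - a| + |d - c|) / m) * ω := by
    intro ω hω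
    have hR : IsCompact ([[a, b]] ×ℂ [[c, d]]) := isCompact_uIcc.reProdIm isCompact_uIcc
    obtain ⟨δ, hδ, huc⟩ := Metric.uniformContinuousOn_iff.1
      (hR.uniformContinuousOn_of_continuous hf.continuousOn) ω hω
    -- M > m makes m/M an admissible radius for the covering of K; the other condition makes the
    -- cells smaller than δ.
    obtain ⟨M, hM⟩ := exists_nat_gt (max (m : ℝ) ((|b - a| + |d - c|) / δ))
    have hMm : m < M := (le_max_left _ _).trans_lt hM
    have hMδ : (|b - a| + |d - c|) / M < δ := by
      rw [div_lt_iff₀ (hm0.trans hMm), mul_comm, ← div_lt_iff₀ hδ]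
      exact (le_max_right _ _).trans_lt hM
    have hM0 : (0 : ℝ) < M := hm0.trans hMm
    set p := (b - a) / M with hp
    set q := (d - c) / M with hq
    have hpabs : |p| = |b - a| / M := by rw [hp, abs_div, Nat.abs_cast]
    have hqabs : |q| = |d - c| / M := by rw [hq, abs_div, Nat.abs_cast]
    have hp0 : p ≠ 0 := div_ne_zero (sub_ne_zero.2 hab.symm) hM0.ne'
    have hq0 : q ≠ 0 := div_ne_zero (sub_ne_zero.2 hcd.symm) hM0.ne'
    have hgrid : ∀ {u v : ℝ} {i : ℕ}, i ≤ M → u + i * ((v - u) / M) ∈ [[u, v]] := by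
      intro u v i hi
      have h1 : (i : ℝ) / M ≤ 1 := by rw [div_le_one hM0]; exact_mod_cast hi
      have h2 : 0 ≤ (i : ℝ) / M := by positivity
      rw [← segment_eq_uIcc, segment_eq_image']
      exact ⟨i / M, ⟨h2, h1⟩, by simp only [smul_eq_mul]; ring⟩
    obtain ⟨F, hF, hKF⟩ := hC (m / M) (by positivity) (by rw [div_le_one hM0]; exact hMm.le)
    set I : ℕ → ℕ → ℂ := fun i j =>
      rectIntegral f (a + i * p) (a + (i + 1 : ℕ) * p) (c + j * q) (c + (j + 1 : ℕ) * q)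
    have hsum : rectIntegral f a b c d =
        ∑ ij ∈ Finset.range M ×ˢ Finset.range M, I ij.1 ij.2 := by
      rw [Finset.sum_product]
      have := sum_rectIntegral hf (fun i => a + i * p) (fun j => c + j * q) M
      simp only [I]
      rw [this]
      congr 1 <;> simp only [Nat.cast_zero, zero_mul, add_zero, hp, hq] <;> field_simp <;> ring
    have hsmall : ∀ i < M, ∀ j < M, ‖I i j‖ ≤ ω * (|p| + |q|) := by
      intro i hi j hj
      have ha1 : a + i * p ∈ [[a, b]] := hgrid hi.le
      have ha2 : a + (i + 1 : ℕ) * p ∈ [[a, b]] := hgrid hi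
      have hc1 : c + j * q ∈ [[c, d]] := hgrid hj.le
      have hc2 : c + (j + 1 : ℕ) * q ∈ [[c, d]] := hgrid hj
      have hdp : a + (i + 1 : ℕ) * p - (a + i * p) = p := by push_cast; ring
      have hdq : c + (j + 1 : ℕ) * q - (c + j * q) = q := by push_cast; ring
      have := norm_rectIntegral_le hf (a := a + i * p) (b := a + (i + 1 : ℕ) * p)
        (c := c + j * q) (d := c + (j + 1 : ℕ) * q) (ω := ω) ?_ ?_
      · rwa [hdp, hdq] at this
      · intro x hx
        rw [← dist_eq_norm]
        refine (huc _ ?_ _ ?_ ?_).le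
        · simpa [Complex.mem_reProdIm, -Nat.cast_add] using ⟨uIcc_subset_uIcc ha1 ha2 hx, hc1⟩
        · simpa [Complex.mem_reProdIm, -Nat.cast_add] using ⟨uIcc_subset_uIcc ha1 ha2 hx, hc2⟩
        · rw [dist_eq_norm, add_sub_add_left_eq_sub, ← sub_mul, norm_mul, Complex.norm_I, mul_one,
            ← Complex.ofReal_sub, Complex.norm_real, Real.norm_eq_abs, abs_sub_comm, hdq, hqabs]
          refine lt_of_le_of_lt ?_ hMδ
          gcongr
          linarith
      · intro y hy
        rw [← dist_eq_norm]
        refine (huc _ ?_ _ ?_ ?_).le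
        · simpa [Complex.mem_reProdIm, -Nat.cast_add] using ⟨ha2, uIcc_subset_uIcc hc1 hc2 hy⟩
        · simpa [Complex.mem_reProdIm, -Nat.cast_add] using ⟨ha1, uIcc_subset_uIcc hc1 hc2 hy⟩
        · rw [dist_eq_norm, add_sub_add_right_eq_sub, ← Complex.ofReal_sub, Complex.norm_real,
            Real.norm_eq_abs, hdp, hpabs]
          refine lt_of_le_of_lt ?_ hMδ
          gcongr
          linarith
    -- The radius m/M is at most each side of a cell, so a cell meeting a covering disc has its
    -- corner within two steps of the centre in each coordinate. That leaves at most 5 · 5 = 25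
    -- cells for each disc.
    set B := F.biUnion fun k => nearbyIndices a p k.re ×ˢ nearbyIndices c q k.im
    have hB : (B.card : ℝ) ≤ C / (m / M) * 25 := by
      have h1 : B.card ≤ F.card * 25 := by
        refine Finset.card_biUnion_le_card_mul _ _ _ fun k _ => ?_
        have h2 : ∀ u v w : ℝ, (nearbyIndices u v w).card = 5 := fun u v w => by
          rw [nearbyIndices, Nat.card_Icc]; omega
        rw [Finset.card_product, h2, h2]
      calc (B.card : ℝ) ≤ F.card * 25 := by exact_mod_cast h1
        _ ≤ _ := by gcongr
    have hvanish : ∀ i j, (i, j) ∉ B → I i j = 0 := by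
      intro i j hij
      have hsub : ([[a + i * p, a + (i + 1 : ℕ) * p]] ×ℂ [[c + j * q, c + (j + 1 : ℕ) * q]]) ⊆ Kᶜ := by
        intro z hz hzK
        obtain ⟨k, hkF, hk⟩ := mem_iUnion₂.1 (hKF hzK)
        refine hij (Finset.mem_biUnion.2 ⟨k, hkF, Finset.mem_product.2 ⟨?_, ?_⟩⟩)
        · refine mem_nearbyIndices hp0 ?_
          have h1 := abs_sub_left_of_mem_uIcc hz.1
          rw [show a + (i + 1 : ℕ) * p - (a + i * p) = p by push_cast; ring] at h1
          have h2 : |z.re - k.re| ≤ |p| := by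
            rw [← Complex.sub_re]
            refine (Complex.abs_re_le_norm _).trans ((mem_closedBall_iff_norm.1 hk).trans ?_)
            rw [hpabs]
            gcongr
            exact min_le_left _ _
          have h3 : a + i * p - k.re = -(z.re - (a + i * p)) + (z.re - k.re) := by ring
          rw [h3]
          refine (abs_add_le _ _).trans ?_
          rw [abs_neg]
          linarith
        · refine mem_nearbyIndices hq0 ?_
          have h1 := abs_sub_left_of_mem_uIcc hz.2
          rw [show c + (j + 1 : ℕ) * q - (c + j * q) = q by push_cast; ring] at h1
          have h2 : |z.im - k.im| ≤ |q| := by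
            rw [← Complex.sub_im]
            refine (Complex.abs_im_le_norm _).trans ((mem_closedBall_iff_norm.1 hk).trans ?_)
            rw [hqabs]
            gcongr
            exact min_le_right _ _
          have h3 : c + j * q - k.im = -(z.im - (c + j * q)) + (z.im - k.im) := by ring
          rw [h3]
          refine (abs_add_le _ _).trans ?_
          rw [abs_neg]
          linarith
      exact Complex.integral_boundary_rect_eq_zero_of_differentiableOn f
        ⟨a + i * p, c + j * q⟩ ⟨a + (i + 1 : ℕ) * p, c + (j + 1 : ℕ) * q⟩ (hd.mono hsub)
    have hle : ‖rectIntegral f a b c d‖ ≤ B.card * (ω * (|p| + |q|)) := by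
      rw [hsum, ← Finset.sum_filter_of_ne (p := fun ij : ℕ × ℕ => ij ∈ B)
        (fun ij _ hne => by by_contra h; exact hne (hvanish ij.1 ij.2 h))]
      refine (norm_sum_le_of_le (f := fun ij : ℕ × ℕ => I ij.1 ij.2)
        (n := fun _ => ω * (|p| + |q|)) _ fun ij hij => ?_).trans ?_
      · have := (Finset.mem_product.1 (Finset.mem_filter.1 hij).1)
        exact hsmall _ (Finset.mem_range.1 this.1) _ (Finset.mem_range.1 this.2)
      · rw [Finset.sum_const, nsmul_eq_mul]
        gcongr
        exact fun ij hij => (Finset.mem_filter.1 hij).2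
    refine hle.trans ((mul_le_mul_of_nonneg_right hB (by positivity)).trans (le_of_eq ?_))
    rw [hpabs, hqabs]
    field_simp
  set Q := 25 * C * (|b - a| + |d - c|) / m
  rw [← norm_le_zero_iff]
  have hlim : Tendsto (fun ω : ℝ => Q * ω) (𝓝[>] 0) (𝓝 0) := by
    have : Tendsto (fun ω : ℝ => Q * ω) (𝓝 0) (𝓝 (Q * 0)) := (continuous_const.mul continuous_id).tendsto 0
    rw [mul_zero] at this
    exact this.mono_left nhdsWithin_le_nhds
  exact ge_of_tendsto hlim (by filter_upwards [self_mem_nhdsWithin] with ω hω using key ω hω)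

/-- **Painlevé's theorem**: a continuous function that is holomorphic off a set of finite length is
entire. -/
theorem differentiable_of_linearlyCovered {f : ℂ → ℂ} (hf : Continuous f) {K : Set ℂ}
    (hK : LinearlyCovered K) (hd : DifferentiableOn ℂ f Kᶜ) : Differentiable ℂ f := by
  rw [← differentiableOn_univ,
    ← Complex.isConservativeOn_and_continuousOn_iff_isDifferentiableOn isOpen_univ]
  refine ⟨fun z w _ => ?_, hf.continuousOn⟩
  rw [← add_eq_zero_iff_eq_neg, Complex.wedgeIntegral_add_wedgeIntegral_eq]
  -- Morera's criterion also asks about degenerate rectangles, which the grid argument does not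
  -- cover.
  by_cases hre : z.re = w.re
  · simp [hre]
  by_cases him : z.im = w.im
  · simp [him]
  exact rectIntegral_eq_zero hf hK hd hre him

/-! ### Winding numbers -/

theorem IsClockwiseLoop.isCompact_trace {γ : ℝ → ℂ} (h : IsClockwiseLoop γ) :
    IsCompact (trace γ) := by
  obtain ⟨K, hK⟩ := h.lipschitz
  exact isCompact_Icc.image_of_continuousOn hK.continuousOn

theorem IsClockwiseLoop.linearlyCovered {γ : ℝ → ℂ} (h : IsClockwiseLoop γ) :
    LinearlyCovered (trace γ) := by
  obtain ⟨K, hK⟩ := h.lipschitz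
  exact linearlyCovered_of_lipschitzOnWith hK

theorem IsClockwiseLoop.exists_deriv_le {γ : ℝ → ℂ} (h : IsClockwiseLoop γ) :
    ∃ K : ℝ, 0 ≤ K ∧ ∀ t ∈ Ioo (0 : ℝ) 1, ‖deriv γ t‖ ≤ K := by
  obtain ⟨K, hK⟩ := h.lipschitz
  exact ⟨K, K.2, fun t ht => norm_deriv_le_of_lipschitzOn (Icc_mem_nhds ht.1 ht.2) hK⟩

/-- Dominated convergence: near a point off the compact trace the denominators stay bounded away
from 0, and |γ'| is at most the Lipschitz constant. -/
theorem IsClockwiseLoop.continuousOn_wind {γ : ℝ → ℂ} (h : IsClockwiseLoop γ) :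
    ContinuousOn (wind γ) (trace γ)ᶜ := by
  obtain ⟨K, hK0, hK⟩ := h.exists_deriv_le
  have hγ : ContinuousOn γ (Icc 0 1) := h.lipschitz.choose_spec.continuousOn
  intro z hz
  refine ContinuousAt.continuousWithinAt ?_
  have hopen : IsOpen (trace γ)ᶜ := h.isCompact_trace.isClosed.isOpen_compl
  obtain ⟨r, hr, hball⟩ := Metric.isOpen_iff.1 hopen z hz
  have hdist : ∀ w ∈ Metric.ball z (r / 2), ∀ t ∈ Icc (0 : ℝ) 1, r / 2 ≤ ‖γ t - w‖ := by
    intro w hw t ht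
    by_contra hlt
    push Not at hlt
    have : γ t ∈ Metric.ball z r := by
      rw [Metric.mem_ball, dist_eq_norm]
      rw [Metric.mem_ball, dist_eq_norm] at hw
      calc ‖γ t - z‖ = ‖(γ t - w) + (w - z)‖ := by ring_nf
        _ ≤ _ := norm_add_le _ _
        _ < r := by linarith
    exact hball this ⟨t, ht, rfl⟩
  refine continuousAt_const.mul ?_
  refine intervalIntegral.continuousAt_of_dominated_interval (bound := fun _ => K / (r / 2)) ?_ ?_
    intervalIntegrable_const ?_
  · filter_upwards [Metric.ball_mem_nhds z (half_pos hr)] with w hw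
    refine AEStronglyMeasurable.mul (measurable_deriv γ).aestronglyMeasurable ?_
    refine aestronglyMeasurable_uIoc zero_le_one (ContinuousOn.inv₀ ?_ ?_)
    · exact (hγ.mono Ioo_subset_Icc_self).sub continuousOn_const
    · intro t ht h0
      have := hdist w hw t (Ioo_subset_Icc_self ht)
      rw [h0, norm_zero] at this
      linarith
  · filter_upwards [Metric.ball_mem_nhds z (half_pos hr)] with w hw
    filter_upwards [ae_mem_Ioo_of_mem_uIoc zero_le_one] with t ht h'
    rw [norm_div]
    exact div_le_div₀ hK0 (hK t (ht h')) (half_pos hr) (hdist w hw t (Ioo_subset_Icc_self (ht h')))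
  · filter_upwards [ae_mem_Ioo_of_mem_uIoc zero_le_one] with t ht h'
    refine continuousAt_const.div (by fun_prop) ?_
    have := hdist z (Metric.mem_ball_self (half_pos hr)) t (Ioo_subset_Icc_self (ht h'))
    exact norm_pos_iff.1 (by linarith)

/-- The winding number takes only the values 0 and -1, so by continuity each value is attained on an
open set. The Jordan curve theorem is not needed. -/
theorem IsClockwiseLoop.isOpen_inside {γ : ℝ → ℂ} (h : IsClockwiseLoop γ) :
    IsOpen (inside γ) := by
  have hopen : IsOpen (trace γ)ᶜ := h.isCompact_trace.isClosed.isOpen_compl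
  have : inside γ = (trace γ)ᶜ ∩ wind γ ⁻¹' {0}ᶜ := by
    ext z
    refine and_congr_right fun hz => ⟨fun hw => ?_, fun hw => ?_⟩
    · simp [hw]
    · exact (h.clockwise z hz).resolve_left hw
  rw [this]
  exact h.continuousOn_wind.isOpen_inter_preimage hopen isOpen_compl_singleton

theorem IsClockwiseLoop.isOpen_outside {γ : ℝ → ℂ} (h : IsClockwiseLoop γ) :
    IsOpen (outside γ) := by
  have hopen : IsOpen (trace γ)ᶜ := h.isCompact_trace.isClosed.isOpen_compl
  have : outside γ = (trace γ)ᶜ ∩ wind γ ⁻¹' {-1}ᶜ := by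
    ext z
    refine and_congr_right fun hz => ⟨fun hw => ?_, fun hw => ?_⟩
    · simp [hw]
    · exact (h.clockwise z hz).resolve_right hw
  rw [this]
  exact h.continuousOn_wind.isOpen_inter_preimage hopen isOpen_compl_singleton

theorem IsClockwiseLoop.compl_outside {γ : ℝ → ℂ} (h : IsClockwiseLoop γ) :
    (outside γ)ᶜ = trace γ ∪ inside γ := by
  ext z
  by_cases hz : z ∈ trace γ
  · simp [outside, hz]
  · rcases h.clockwise z hz with hw | hw <;> simp [outside, inside, hz, hw]

theorem disjoint_inside_outside (γ : ℝ → ℂ) : Disjoint (inside γ) (outside γ) :=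
  Set.disjoint_left.2 fun z h1 h2 => by
    have := h1.2.symm.trans h2.2
    norm_num at this

/-- Far from the trace the integrand is at most 1 in modulus, so the winding number is at most
1/(2π) < 1 and cannot be -1. -/
theorem IsClockwiseLoop.outside_mem_cocompact {γ : ℝ → ℂ} (h : IsClockwiseLoop γ) :
    outside γ ∈ cocompact ℂ := by
  obtain ⟨K, hK0, hK⟩ := h.exists_deriv_le
  obtain ⟨B, hB⟩ := h.isCompact_trace.isBounded.exists_norm_le
  rw [← Metric.cobounded_eq_cocompact, ← comap_norm_atTop]
  refine mem_comap.2 ⟨Ioi (B + K), Ioi_mem_atTop _, fun z hz => ?_⟩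
  have hz : B + K < ‖z‖ := hz
  have hzt : z ∉ trace γ := fun hzt => by linarith [hB z hzt]
  refine ⟨hzt, (h.clockwise z hzt).resolve_right fun hw => ?_⟩
  have h1 : ‖∫ t in (0 : ℝ)..1, deriv γ t / (γ t - z)‖ ≤ 1 * |(1 : ℝ) - 0| := by
    refine intervalIntegral.norm_integral_le_of_norm_le_const_ae ?_
    filter_upwards [ae_mem_Ioo_of_mem_uIoc zero_le_one] with t ht h'
    have ht := ht h'
    have h2 := hB (γ t) ⟨t, Ioo_subset_Icc_self ht, rfl⟩
    have h3 : K < ‖γ t - z‖ := by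
      have := norm_sub_norm_le z (γ t)
      rw [norm_sub_rev] at this
      linarith
    rw [norm_div, div_le_one (hK0.trans_lt h3)]
    exact (hK t ht).trans h3.le
  have h4 : ‖wind γ z‖ = 1 := by rw [hw]; simp
  rw [wind, norm_mul, norm_inv] at h4
  have h5 : ‖(2 * (Real.pi : ℂ) * Complex.I)‖ = 2 * Real.pi := by
    simp [abs_of_pos Real.pi_pos]
  rw [h5, inv_mul_eq_iff_eq_mul₀ (by positivity)] at h4
  rw [h4] at h1
  simp at h1
  linarith [Real.pi_gt_three]

/-- The circle about `c` of radius `r`, traversed clockwise. -/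
def clockwiseCircle (c : ℂ) (r t : ℝ) : ℂ := circleMap c r (-(2 * Real.pi) * t)

theorem trace_clockwiseCircle {c : ℂ} {r : ℝ} (hr : 0 < r) :
    trace (clockwiseCircle c r) ⊆ Metric.sphere c r := by
  rintro _ ⟨t, _, rfl⟩
  exact circleMap_mem_sphere c hr.le _

theorem wind_clockwiseCircle (c : ℂ) (r : ℝ) (z : ℂ) :
    wind (clockwiseCircle c r) z = -((2 * (Real.pi : ℂ) * Complex.I)⁻¹ * ∮ w in C(c, r), (w - z)⁻¹) := by
  have h1 : ∀ t, deriv (clockwiseCircle c r) t / (clockwiseCircle c r t - z) =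
      (-(2 * Real.pi) : ℝ) • (deriv (circleMap c r) (-(2 * Real.pi) * t) •
        (circleMap c r (-(2 * Real.pi) * t) - z)⁻¹) := by
    intro t
    have : HasDerivAt (clockwiseCircle c r)
        ((-(2 * Real.pi) : ℝ) • deriv (circleMap c r) (-(2 * Real.pi) * t)) t := by
      have h := (differentiable_circleMap c r).differentiableAt.hasDerivAt.scomp t
        ((hasDerivAt_id t).const_mul (-(2 * Real.pi)))
      rw [mul_one] at h
      exact h
    rw [this.deriv, clockwiseCircle, div_eq_mul_inv, smul_mul_assoc, smul_eq_mul]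
  have h2 : Function.Periodic (fun θ => deriv (circleMap c r) θ • (circleMap c r θ - z)⁻¹)
      (2 * Real.pi) := by
    intro θ
    simp only [deriv_circleMap, periodic_circleMap c r θ, periodic_circleMap 0 r θ]
  rw [wind, ← mul_neg]
  congr 1
  simp_rw [h1]
  rw [intervalIntegral.integral_smul]
  have h3 := intervalIntegral.smul_integral_comp_mul_left (a := 0) (b := 1)
    (fun θ => deriv (circleMap c r) θ • (circleMap c r θ - z)⁻¹) (-(2 * Real.pi))
  rw [h3, mul_zero, mul_one, intervalIntegral.integral_symm]
  -- Periodicity moves the angles from [-2π,0] to [0,2π].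
  have h4 := h2.intervalIntegral_add_eq (-(2 * Real.pi)) 0
  rw [neg_add_cancel, zero_add] at h4
  rw [h4]
  rfl

theorem wind_clockwiseCircle_of_mem_ball {c z : ℂ} {r : ℝ} (hz : z ∈ Metric.ball c r) :
    wind (clockwiseCircle c r) z = -1 := by
  rw [wind_clockwiseCircle, circleIntegral.integral_sub_inv_of_mem_ball hz, inv_mul_cancel₀]
  simp [Real.pi_ne_zero]

theorem wind_clockwiseCircle_of_notMem {c z : ℂ} {r : ℝ} (hr : 0 < r)
    (hz : z ∉ Metric.closedBall c r) : wind (clockwiseCircle c r) z = 0 := by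
  have hd : DifferentiableOn ℂ (fun w => (w - z)⁻¹) (Metric.closedBall c r) := fun w hw =>
    ((differentiableAt_id.sub_const z).inv
      (sub_ne_zero.2 fun h => hz (h ▸ hw))).differentiableWithinAt
  rw [wind_clockwiseCircle, (hd.diffContOnCl_ball subset_rfl).circleIntegral_eq_zero hr.le]
  simp

theorem isClockwiseLoop_clockwiseCircle {c : ℂ} {r : ℝ} (hr : 0 < r) :
    IsClockwiseLoop (clockwiseCircle c r) where
  lipschitz := by
    refine ⟨_, ((lipschitzWith_circleMap c r).comp
      (LipschitzWith.of_dist_le_mul (K := ‖-(2 * Real.pi)‖₊) fun x y => ?_)).lipschitzOnWith⟩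
    rw [dist_eq_norm, ← mul_sub, norm_mul, dist_eq_norm]
    rfl
  closed := by
    have := periodic_circleMap c r (-(2 * Real.pi))
    simp only [clockwiseCircle, mul_zero, mul_one]
    rw [← this, neg_add_cancel]
  simple := by
    intro s hs t ht hst
    obtain ⟨n, hn⟩ := (circleMap_eq_circleMap_iff c hr.ne').1 hst
    have h1 : ((-(2 * Real.pi) * s : ℝ) : ℂ) * Complex.I =
      ((-(2 * Real.pi) * t + n * (2 * Real.pi) : ℝ) : ℂ) * Complex.I := by
      rw [hn]; push_cast; ring
    have h2 := Complex.ofReal_injective (mul_right_cancel₀ Complex.I_ne_zero h1)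
    have h3 : t - s = n := by
      have : (2 * Real.pi) * (t - s) = (2 * Real.pi) * n := by linarith
      exact mul_left_cancel₀ (by positivity) this
    have h4 : n = 0 := by
      have ha : (n : ℝ) < 1 := by linarith [hs.1, ht.2]
      have hb : (-1 : ℝ) < n := by linarith [hs.2, ht.1]
      have ha' : n < 1 := by exact_mod_cast ha
      have hb' : -1 < n := by exact_mod_cast hb
      omega
    rw [h4] at h3
    push_cast at h3
    linarith
  clockwise := by
    intro z hz
    by_cases hb : z ∈ Metric.closedBall c r
    · right
      apply wind_clockwiseCircle_of_mem_ball
      rw [← Metric.ball_union_sphere] at hb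
      refine hb.resolve_right fun hs => hz ?_
      rw [← abs_of_pos hr, ← image_circleMap_Ioc] at hs
      obtain ⟨θ, hθ, rfl⟩ := hs
      have h0 : 0 < 2 * Real.pi := by positivity
      have h1 : θ / (2 * Real.pi) ≤ 1 := (div_le_one h0).2 hθ.2
      have h2 : 0 ≤ θ / (2 * Real.pi) := div_nonneg hθ.1.le h0.le
      -- At this parameter the clockwise angle is θ - 2π.
      refine ⟨1 - θ / (2 * Real.pi), ⟨by linarith, by linarith⟩, ?_⟩
      rw [clockwiseCircle, ← periodic_circleMap c r]
      congr 1
      field_simp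
      ring
    · exact Or.inl (wind_clockwiseCircle_of_notMem hr hb)

theorem ball_subset_inside_clockwiseCircle {c : ℂ} {r : ℝ} (hr : 0 < r) :
    Metric.ball c r ⊆ inside (clockwiseCircle c r) := fun _ hz =>
  ⟨fun h => (Metric.mem_ball.1 hz).ne (Metric.mem_sphere.1 (trace_clockwiseCircle hr h)),
    wind_clockwiseCircle_of_mem_ball hz⟩

theorem trace_union_inside_clockwiseCircle {c : ℂ} {r : ℝ} (hr : 0 < r) :
    trace (clockwiseCircle c r) ∪ inside (clockwiseCircle c r) ⊆ Metric.closedBall c r := by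
  refine union_subset ((trace_clockwiseCircle hr).trans Metric.sphere_subset_closedBall) ?_
  intro z hz
  by_contra h
  have := (wind_clockwiseCircle_of_notMem hr h).symm.trans hz.2
  norm_num at this

theorem compl_closedBall_subset_outside_clockwiseCircle {c : ℂ} {r : ℝ} (hr : 0 < r) :
    (Metric.closedBall c r)ᶜ ⊆ outside (clockwiseCircle c r) := fun _ hz =>
  ⟨fun h => hz (Metric.sphere_subset_closedBall (trace_clockwiseCircle hr h)),
    wind_clockwiseCircle_of_notMem hr hz⟩

/-! ### The Riemann–Hilbert problem with a factorized jump matrix -/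

theorem DifferentiableAt.matrix_entry {m : ℂ → Mat3} {z : ℂ} (h : DifferentiableAt ℂ m z)
    (i j : Fin 3) : DifferentiableAt ℂ (fun z => m z i j) z :=
  (entryCLM i j).differentiableAt.comp z h

theorem differentiableAt_matrix_inv {m : ℂ → Mat3} {z : ℂ} (h : DifferentiableAt ℂ m z)
    (hu : IsUnit (m z)) : DifferentiableAt ℂ (fun z => (m z)⁻¹) z := by
  obtain ⟨u, hu⟩ := hu
  have h1 : DifferentiableAt ℂ Ring.inverse (m z) := by
    rw [← hu]; exact differentiableAt_inverse u.isUnit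
  have h2 : (fun z => (m z)⁻¹) = fun z => Ring.inverse (m z) := by
    ext1 z; exact Matrix.nonsing_inv_eq_ringInverse _
  rw [h2]
  exact h1.comp z h

theorem continuousAt_matrix_inv {M : Mat3} (hu : IsUnit M) : ContinuousAt (fun M : Mat3 => M⁻¹) M := by
  obtain ⟨u, rfl⟩ := hu
  have h2 : (fun M : Mat3 => M⁻¹) = Ring.inverse := by
    ext1 z; exact Matrix.nonsing_inv_eq_ringInverse _
  rw [h2]
  exact NormedRing.inverse_continuousAt u

/-- `b₀`, `b₁` and `G` are holomorphic off `S₁`, `S₀` and `S₀ ∪ S₁`, and `b₀⁻¹ G`, `b₁⁻¹ G` are the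
jump matrices on two loops about `S₀` and `S₁`. -/
structure RHFactorization (γ₀ γ₁ : ℝ → ℂ) (S₀ S₁ : Set ℂ) (v G b₀ b₁ : ℂ → Mat3) : Prop where
  loop0 : IsClockwiseLoop γ₀
  loop1 : IsClockwiseLoop γ₁
  encircles0 : S₀ ⊆ inside γ₀
  encircles1 : S₁ ⊆ inside γ₁
  apart : Disjoint (trace γ₀ ∪ inside γ₀) (trace γ₁ ∪ inside γ₁)
  outer : ∀ z, z ∉ S₀ → z ∉ S₁ → DifferentiableAt ℂ G z ∧ IsUnit (G z)
  inner0 : ∀ z, z ∉ S₁ → DifferentiableAt ℂ b₀ z ∧ IsUnit (b₀ z)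
  inner1 : ∀ z, z ∉ S₀ → DifferentiableAt ℂ b₁ z ∧ IsUnit (b₁ z)
  jump0 : ∀ z ∈ trace γ₀, G z = b₀ z * v z
  jump1 : ∀ z ∈ trace γ₁, G z = b₁ z * v z
  infinity : ∀ i j, (fun z => G z i j - (1 : Mat3) i j) =O[cocompact ℂ] (fun z : ℂ => z⁻¹)

open Classical in
/-- The sectionally holomorphic function with values `b₀` and `b₁` inside the two loops and `G`
elsewhere. -/
def sectional (γ₀ γ₁ : ℝ → ℂ) (G b₀ b₁ : ℂ → Mat3) (z : ℂ) : Mat3 :=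
  if z ∈ inside γ₀ then b₀ z else if z ∈ inside γ₁ then b₁ z else G z

/-- M and m are multiplied from the right by the same w on crossing γ, so w cancels in M m⁻¹: P G⁻¹
= Q w (b w)⁻¹ = Q b⁻¹. On γ itself M takes its outer boundary value, so the quotient has one limit
along the inside, the outside and the trace, which together fill a neighbourhood. -/
theorem tendsto_mul_inv_of_jump {γ : ℝ → ℂ} (hγ : IsClockwiseLoop γ)
    {M m G b : ℂ → Mat3} {P Q w : Mat3} {z₀ : ℂ}
    (hm : ∀ᶠ z in 𝓝 z₀, (z ∈ inside γ → m z = b z) ∧ (z ∉ inside γ → m z = G z))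
    (hG : ContinuousAt G z₀) (hb : ContinuousAt b z₀) (hGu : IsUnit (G z₀)) (hbu : IsUnit (b z₀))
    (hout : Tendsto M (𝓝[outside γ] z₀) (𝓝 P)) (hin : Tendsto M (𝓝[inside γ] z₀) (𝓝 Q))
    (htr : Tendsto M (𝓝[trace γ] z₀) (𝓝 P)) (hPQ : P = Q * w) (hGb : G z₀ = b z₀ * w) :
    Tendsto (fun z => M z * (m z)⁻¹) (𝓝 z₀) (𝓝 (P * (G z₀)⁻¹)) := by
  have hw : IsUnit w := by
    have : w = (b z₀)⁻¹ * G z₀ := by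
      rw [hGb, ← mul_assoc, Matrix.nonsing_inv_mul _ ((Matrix.isUnit_iff_isUnit_det _).1 hbu), one_mul]
    rw [this]
    exact ((Matrix.isUnit_nonsing_inv_iff).2 hbu).mul hGu
  have hcover : 𝓝 z₀ = 𝓝[inside γ] z₀ ⊔ (𝓝[outside γ] z₀ ⊔ 𝓝[trace γ] z₀) := by
    rw [← nhdsWithin_union, ← nhdsWithin_union, ← nhdsWithin_univ]
    congr 1
    have := hγ.compl_outside
    ext z
    by_cases hz : z ∈ outside γ
    · simp [hz]
    · have : z ∈ trace γ ∪ inside γ := this ▸ hz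
      rcases this with h | h <;> simp [h]
  have houter : ∀ s, s ∩ inside γ = ∅ → Tendsto M (𝓝[s] z₀) (𝓝 P) →
      Tendsto (fun z => M z * (m z)⁻¹) (𝓝[s] z₀) (𝓝 (P * (G z₀)⁻¹)) := by
    intro s hs hM
    refine hM.mul (((continuousAt_matrix_inv hGu).tendsto.comp
      (hG.tendsto.mono_left nhdsWithin_le_nhds)).congr' ?_)
    filter_upwards [nhdsWithin_le_nhds hm, self_mem_nhdsWithin] with z hz hzs
    rw [hz.2 fun h => (hs ▸ (⟨hzs, h⟩ : z ∈ s ∩ inside γ) : z ∈ (∅ : Set ℂ))]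
    rfl
  rw [hcover]
  refine Tendsto.sup ?_ (Tendsto.sup (houter _ ?_ hout) (houter _ ?_ htr))
  · have : P * (G z₀)⁻¹ = Q * (b z₀)⁻¹ := by
      rw [hPQ, hGb, Matrix.mul_inv_rev, mul_assoc, ← mul_assoc w,
        Matrix.mul_nonsing_inv _ ((Matrix.isUnit_iff_isUnit_det _).1 hw), one_mul]
    rw [this]
    refine hin.mul (((continuousAt_matrix_inv hbu).tendsto.comp
      (hb.tendsto.mono_left nhdsWithin_le_nhds)).congr' ?_)
    filter_upwards [nhdsWithin_le_nhds hm, self_mem_nhdsWithin] with z hz hzs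
    rw [hz.1 hzs]
    rfl
  · exact (disjoint_inside_outside γ).symm.inter_eq
  · ext z; simp +contextual [inside]

/-! ### Existence and uniqueness for a factorized Riemann–Hilbert problem. -/

namespace RHFactorization

variable {γ₀ γ₁ : ℝ → ℂ} {S₀ S₁ : Set ℂ} {v G b₀ b₁ : ℂ → Mat3}

theorem sectional_inside0 (z : ℂ) (hz : z ∈ inside γ₀) :
    sectional γ₀ γ₁ G b₀ b₁ z = b₀ z := by
  simp [sectional, hz]

theorem sectional_inside1 (h : RHFactorization γ₀ γ₁ S₀ S₁ v G b₀ b₁) (z : ℂ) (hz : z ∈ inside γ₁) :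
    sectional γ₀ γ₁ G b₀ b₁ z = b₁ z := by
  have : z ∉ inside γ₀ := fun h' => Set.disjoint_left.1 h.apart (Or.inr h') (Or.inr hz)
  simp [sectional, hz, this]

theorem sectional_outer (z : ℂ) (hz : z ∉ inside γ₀) (hz' : z ∉ inside γ₁) :
    sectional γ₀ γ₁ G b₀ b₁ z = G z := by
  simp [sectional, hz, hz']

/-- The loops and their interiors are disjoint, and the outside is open: near one loop the other is
not felt, so the local analysis concerns one loop at a time. -/
theorem outside1_mem_nhds (h : RHFactorization γ₀ γ₁ S₀ S₁ v G b₀ b₁) {z : ℂ}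
    (hz : z ∈ trace γ₀ ∪ inside γ₀) : outside γ₁ ∈ 𝓝 z := by
  refine h.loop1.isOpen_outside.mem_nhds ?_
  by_contra h'
  have : z ∈ trace γ₁ ∪ inside γ₁ := h.loop1.compl_outside ▸ h'
  exact Set.disjoint_left.1 h.apart hz this

theorem outside0_mem_nhds (h : RHFactorization γ₀ γ₁ S₀ S₁ v G b₀ b₁) {z : ℂ}
    (hz : z ∈ trace γ₁ ∪ inside γ₁) : outside γ₀ ∈ 𝓝 z := by
  refine h.loop0.isOpen_outside.mem_nhds ?_
  by_contra h'
  have : z ∈ trace γ₀ ∪ inside γ₀ := h.loop0.compl_outside ▸ h'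
  exact Set.disjoint_left.1 h.apart this hz

theorem notMem_of_outside {γ : ℝ → ℂ} {S : Set ℂ} (h : S ⊆ inside γ) {z : ℂ} (hz : z ∈ outside γ) :
    z ∉ S := fun h' => Set.disjoint_left.1 (disjoint_inside_outside γ) (h h') hz

theorem notMem_of_trace {γ : ℝ → ℂ} {S : Set ℂ} (h : S ⊆ inside γ) {z : ℂ} (hz : z ∈ trace γ) :
    z ∉ S := fun h' => (h h').1 hz

theorem notMem_inside_of_outside {γ : ℝ → ℂ} {z : ℂ} (hz : z ∈ outside γ) : z ∉ inside γ :=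
  fun h' => Set.disjoint_left.1 (disjoint_inside_outside γ) h' hz

theorem sectional_near_trace0 (h : RHFactorization γ₀ γ₁ S₀ S₁ v G b₀ b₁) {z₀ : ℂ}
    (hz : z₀ ∈ trace γ₀) : ∀ᶠ z in 𝓝 z₀,
      (z ∈ inside γ₀ → sectional γ₀ γ₁ G b₀ b₁ z = b₀ z) ∧
      (z ∉ inside γ₀ → sectional γ₀ γ₁ G b₀ b₁ z = G z) := by
  filter_upwards [h.outside1_mem_nhds (Or.inl hz)] with z hz1
  exact ⟨sectional_inside0 z, fun hz0 => sectional_outer z hz0 (notMem_inside_of_outside hz1)⟩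

theorem sectional_near_trace1 (h : RHFactorization γ₀ γ₁ S₀ S₁ v G b₀ b₁) {z₀ : ℂ}
    (hz : z₀ ∈ trace γ₁) : ∀ᶠ z in 𝓝 z₀,
      (z ∈ inside γ₁ → sectional γ₀ γ₁ G b₀ b₁ z = b₁ z) ∧
      (z ∉ inside γ₁ → sectional γ₀ γ₁ G b₀ b₁ z = G z) := by
  filter_upwards [h.outside0_mem_nhds (Or.inl hz)] with z hz1
  exact ⟨h.sectional_inside1 z, fun hz0 => sectional_outer z (notMem_inside_of_outside hz1) hz0⟩

theorem outer_of_trace0 (h : RHFactorization γ₀ γ₁ S₀ S₁ v G b₀ b₁) {z : ℂ}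
    (hz : z ∈ trace γ₀) : DifferentiableAt ℂ G z ∧ IsUnit (G z) :=
  h.outer z (notMem_of_trace h.encircles0 hz)
    (notMem_of_outside h.encircles1 (mem_of_mem_nhds (h.outside1_mem_nhds (Or.inl hz))))

theorem outer_of_trace1 (h : RHFactorization γ₀ γ₁ S₀ S₁ v G b₀ b₁) {z : ℂ}
    (hz : z ∈ trace γ₁) : DifferentiableAt ℂ G z ∧ IsUnit (G z) :=
  h.outer z (notMem_of_outside h.encircles0 (mem_of_mem_nhds (h.outside0_mem_nhds (Or.inl hz))))
    (notMem_of_trace h.encircles1 hz)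

theorem inner0_of_mem (h : RHFactorization γ₀ γ₁ S₀ S₁ v G b₀ b₁) {z : ℂ}
    (hz : z ∈ trace γ₀ ∪ inside γ₀) : DifferentiableAt ℂ b₀ z ∧ IsUnit (b₀ z) :=
  h.inner0 z (notMem_of_outside h.encircles1 (mem_of_mem_nhds (h.outside1_mem_nhds hz)))

theorem inner1_of_mem (h : RHFactorization γ₀ γ₁ S₀ S₁ v G b₀ b₁) {z : ℂ}
    (hz : z ∈ trace γ₁ ∪ inside γ₁) : DifferentiableAt ℂ b₁ z ∧ IsUnit (b₁ z) :=
  h.inner1 z (notMem_of_outside h.encircles0 (mem_of_mem_nhds (h.outside0_mem_nhds hz)))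

theorem sectional_differentiableAt (h : RHFactorization γ₀ γ₁ S₀ S₁ v G b₀ b₁) {z : ℂ}
    (hz : z ∉ trace γ₀ ∪ trace γ₁) : DifferentiableAt ℂ (sectional γ₀ γ₁ G b₀ b₁) z ∧
      IsUnit (sectional γ₀ γ₁ G b₀ b₁ z) := by
  by_cases h0 : z ∈ inside γ₀
  · have h1 := h.inner0_of_mem (Or.inr h0)
    refine ⟨h1.1.congr_of_eventuallyEq ?_, by rw [sectional_inside0 z h0]; exact h1.2⟩
    filter_upwards [h.loop0.isOpen_inside.mem_nhds h0] with w hw using sectional_inside0 w hw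
  by_cases h0' : z ∈ inside γ₁
  · have h1 := h.inner1_of_mem (Or.inr h0')
    refine ⟨h1.1.congr_of_eventuallyEq ?_, by rw [h.sectional_inside1 z h0']; exact h1.2⟩
    filter_upwards [h.loop1.isOpen_inside.mem_nhds h0'] with w hw using h.sectional_inside1 w hw
  have hout0 : z ∈ outside γ₀ := by
    by_contra h'
    have : z ∈ trace γ₀ ∪ inside γ₀ := h.loop0.compl_outside ▸ h'
    exact this.elim (fun h => hz (Or.inl h)) h0
  have hout1 : z ∈ outside γ₁ := by
    by_contra h'
    have : z ∈ trace γ₁ ∪ inside γ₁ := h.loop1.compl_outside ▸ h'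
    exact this.elim (fun h => hz (Or.inr h)) h0'
  have h1 := h.outer z (notMem_of_outside h.encircles0 hout0) (notMem_of_outside h.encircles1 hout1)
  refine ⟨h1.1.congr_of_eventuallyEq ?_, by rw [sectional_outer z h0 h0']; exact h1.2⟩
  filter_upwards [h.loop0.isOpen_outside.mem_nhds hout0,
    h.loop1.isOpen_outside.mem_nhds hout1] with w hw hw'
  exact sectional_outer w (notMem_inside_of_outside hw) (notMem_inside_of_outside hw')

theorem sectional_eventually (h : RHFactorization γ₀ γ₁ S₀ S₁ v G b₀ b₁) :
    ∀ᶠ z in cocompact ℂ, z ∉ trace γ₀ ∪ trace γ₁ ∧ sectional γ₀ γ₁ G b₀ b₁ z = G z := by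
  filter_upwards [h.loop0.outside_mem_cocompact, h.loop1.outside_mem_cocompact] with z h0 h1
  exact ⟨fun hz => hz.elim h0.1 h1.1,
    sectional_outer z (notMem_inside_of_outside h0) (notMem_inside_of_outside h1)⟩

/-- The sectionally holomorphic function solves the Riemann–Hilbert problem. -/
theorem isRHSolution (h : RHFactorization γ₀ γ₁ S₀ S₁ v G b₀ b₁) :
    IsRHSolution γ₀ γ₁ v (sectional γ₀ γ₁ G b₀ b₁) where
  analytic i j z hz :=
    (DifferentiableAt.matrix_entry (h.sectional_differentiableAt hz).1 i j).differentiableWithinAt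
  jump := by
    classical
    have hne : ∀ z ∈ trace γ₁, z ∉ trace γ₀ := fun z h1 h0 =>
      Set.disjoint_left.1 h.apart (Or.inl h0) (Or.inl h1)
    -- The left-hand side of a clockwise loop is its outside, so m₊ is G on both loops, while m₋ is
    -- b₀ or b₁.
    refine ⟨G, fun z => if z ∈ trace γ₀ then b₀ z else b₁ z, ?_, ?_, ?_, ?_, ?_⟩
    · rintro z (hz | hz)
      · exact (h.outer_of_trace0 hz).1.continuousAt.continuousWithinAt
      · exact (h.outer_of_trace1 hz).1.continuousAt.continuousWithinAt
    · rintro z (hz | hz)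
      · refine ((h.inner0_of_mem (Or.inl hz)).1.continuousAt.continuousWithinAt).congr_of_eventuallyEq
          ?_ (by simp [hz])
        filter_upwards [nhdsWithin_le_nhds (h.outside1_mem_nhds (Or.inl hz)), self_mem_nhdsWithin]
          with w hw hw'
        simp [hw'.resolve_right hw.1]
      · refine ((h.inner1_of_mem (Or.inl hz)).1.continuousAt.continuousWithinAt).congr_of_eventuallyEq
          ?_ (by simp [hne z hz])
        filter_upwards [nhdsWithin_le_nhds (h.outside0_mem_nhds (Or.inl hz)), self_mem_nhdsWithin]
          with w hw hw'
        simp [hw.1]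
    · intro z hz
      have hev := h.sectional_near_trace0 hz
      simp only [hz, if_true]
      refine ⟨((h.outer_of_trace0 hz).1.continuousAt.tendsto.mono_left nhdsWithin_le_nhds).congr' ?_,
        ((h.inner0_of_mem (Or.inl hz)).1.continuousAt.tendsto.mono_left nhdsWithin_le_nhds).congr' ?_⟩
      · filter_upwards [nhdsWithin_le_nhds hev, self_mem_nhdsWithin] with w hw hw'
        exact (hw.2 (notMem_inside_of_outside hw')).symm
      · filter_upwards [self_mem_nhdsWithin] with w hw'
        exact (sectional_inside0 w hw').symm
    · intro z hz
      have hev := h.sectional_near_trace1 hz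
      simp only [hne z hz, if_false]
      refine ⟨((h.outer_of_trace1 hz).1.continuousAt.tendsto.mono_left nhdsWithin_le_nhds).congr' ?_,
        ((h.inner1_of_mem (Or.inl hz)).1.continuousAt.tendsto.mono_left nhdsWithin_le_nhds).congr' ?_⟩
      · filter_upwards [nhdsWithin_le_nhds hev, self_mem_nhdsWithin] with w hw hw'
        exact (hw.2 (notMem_inside_of_outside hw')).symm
      · filter_upwards [self_mem_nhdsWithin] with w hw'
        exact (h.sectional_inside1 w hw').symm
    · rintro z (hz | hz)
      · simp only [hz, if_true]; exact h.jump0 z hz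
      · simp only [hne z hz, if_false]; exact h.jump1 z hz
  infinity i j := by
    refine (h.infinity i j).congr' ?_ EventuallyEq.rfl
    filter_upwards [h.sectional_eventually] with z hz
    rw [hz.2]

theorem tendsto_one_of_isBigO {m : ℂ → Mat3}
    (h : ∀ i j, (fun z => m z i j - (1 : Mat3) i j) =O[cocompact ℂ] (fun z : ℂ => z⁻¹)) :
    Tendsto m (cocompact ℂ) (𝓝 1) := by
  refine tendsto_pi_nhds.2 fun i => tendsto_pi_nhds.2 fun j => ?_
  rw [← tendsto_sub_nhds_zero_iff]
  exact (h i j).trans_tendsto (by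
    rw [← Metric.cobounded_eq_cocompact]
    exact tendsto_inv₀_cobounded)

/-- The solution of the Riemann–Hilbert problem is unique. -/
theorem eqOn_of_isRHSolution (h : RHFactorization γ₀ γ₁ S₀ S₁ v G b₀ b₁) {m' : ℂ → Mat3}
    (hm' : IsRHSolution γ₀ γ₁ v m') :
    EqOn m' (sectional γ₀ γ₁ G b₀ b₁) (trace γ₀ ∪ trace γ₁)ᶜ := by
  classical
  set Γ := trace γ₀ ∪ trace γ₁ with hΓ
  have hΓc : IsClosed Γ := (h.loop0.isCompact_trace.union h.loop1.isCompact_trace).isClosed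
  obtain ⟨mp, mm, hmp, -, hb0, hb1, hj⟩ := hm'.jump
  set m := sectional γ₀ γ₁ G b₀ b₁ with hm
  -- The values of m' on Γ are arbitrary; replacing them by m₊ makes a continuous quotient possible.
  set M : ℂ → Mat3 := fun z => if z ∈ Γ then mp z else m' z with hM
  have hMd : ∀ z ∉ Γ, DifferentiableAt ℂ M z := by
    intro z hz
    have h1 : DifferentiableAt ℂ m' z := by
      refine differentiableAt_pi.2 fun i => differentiableAt_pi.2 fun j => ?_
      exact (hm'.analytic i j).differentiableAt (hΓc.isOpen_compl.mem_nhds hz)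
    refine h1.congr_of_eventuallyEq ?_
    filter_upwards [hΓc.isOpen_compl.mem_nhds hz] with w hw
    simp [hM, show w ∉ Γ from hw]
  set R : ℂ → Mat3 := fun z => M z * (m z)⁻¹ with hR
  have hRd : ∀ z ∉ Γ, DifferentiableAt ℂ R z := fun z hz =>
    (hMd z hz).mul (differentiableAt_matrix_inv (h.sectional_differentiableAt hz).1
      (h.sectional_differentiableAt hz).2)
  have hev : ∀ {γ : ℝ → ℂ} {z : ℂ}, (∀ᶠ w in 𝓝 z, w ∈ Γ → w ∈ trace γ) → trace γ ⊆ Γ →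
      z ∈ trace γ → ∀ {P Q}, Tendsto m' (𝓝[outside γ] z) (𝓝 P) → Tendsto m' (𝓝[inside γ] z) (𝓝 Q) →
      Tendsto M (𝓝[outside γ] z) (𝓝 P) ∧ Tendsto M (𝓝[inside γ] z) (𝓝 Q) ∧
      Tendsto M (𝓝[trace γ] z) (𝓝 (mp z)) := by
    intro γ z hz hsub hzγ P Q hP hQ
    refine ⟨hP.congr' ?_, hQ.congr' ?_, ((hmp z (hsub hzγ)).mono hsub).tendsto.congr' ?_⟩
    · filter_upwards [nhdsWithin_le_nhds hz, self_mem_nhdsWithin] with w hw hw'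
      simp [hM, show w ∉ Γ from fun h => hw'.1 (hw h)]
    · filter_upwards [nhdsWithin_le_nhds hz, self_mem_nhdsWithin] with w hw hw'
      simp [hM, show w ∉ Γ from fun h => hw'.1 (hw h)]
    · filter_upwards [self_mem_nhdsWithin] with w hw
      simp [hM, hsub hw]
  have hRc : Continuous R := by
    rw [continuous_iff_continuousAt]
    intro z
    by_cases hz : z ∉ Γ
    · exact (hRd z hz).continuousAt
    push Not at hz
    have hRz : R z = mp z * (m z)⁻¹ := by simp [hR, hM, hz]
    rw [ContinuousAt, hRz]
    rcases hz with hz | hz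
    · have hmz : m z = G z := sectional_outer z (fun h' => h'.1 hz)
        (notMem_inside_of_outside (mem_of_mem_nhds (h.outside1_mem_nhds (Or.inl hz))))
      rw [hmz]
      have hh := hev (γ := γ₀) (z := z) (by
        filter_upwards [h.outside1_mem_nhds (Or.inl hz)] with w hw hw'
        exact hw'.resolve_right hw.1) subset_union_left hz (hb0 z hz).1 (hb0 z hz).2
      exact tendsto_mul_inv_of_jump h.loop0 (h.sectional_near_trace0 hz)
        (h.outer_of_trace0 hz).1.continuousAt (h.inner0_of_mem (Or.inl hz)).1.continuousAt
        (h.outer_of_trace0 hz).2 (h.inner0_of_mem (Or.inl hz)).2 hh.1 hh.2.1 hh.2.2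
        (hj z (Or.inl hz)) (h.jump0 z hz)
    · have hmz : m z = G z := sectional_outer z
        (notMem_inside_of_outside (mem_of_mem_nhds (h.outside0_mem_nhds (Or.inl hz))))
        (fun h' => h'.1 hz)
      rw [hmz]
      have hh := hev (γ := γ₁) (z := z) (by
        filter_upwards [h.outside0_mem_nhds (Or.inl hz)] with w hw hw'
        exact hw'.resolve_left hw.1) subset_union_right hz (hb1 z hz).1 (hb1 z hz).2
      exact tendsto_mul_inv_of_jump h.loop1 (h.sectional_near_trace1 hz)
        (h.outer_of_trace1 hz).1.continuousAt (h.inner1_of_mem (Or.inl hz)).1.continuousAt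
        (h.outer_of_trace1 hz).2 (h.inner1_of_mem (Or.inl hz)).2 hh.1 hh.2.1 hh.2.2
        (hj z (Or.inr hz)) (h.jump1 z hz)
  -- Γ has finite length, so the continuous quotient is entire by Painlevé's theorem; its limit at
  -- infinity then makes it constant.
  have hRent : ∀ i j, Differentiable ℂ fun z => R z i j := fun i j =>
    differentiable_of_linearlyCovered ((entryCLM i j).continuous.comp hRc)
      (h.loop0.linearlyCovered.union h.loop1.linearlyCovered)
      fun z hz => (DifferentiableAt.matrix_entry (hRd z hz) i j).differentiableWithinAt
  have hlim : Tendsto R (cocompact ℂ) (𝓝 1) := by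
    have h1 : Tendsto M (cocompact ℂ) (𝓝 1) := by
      refine (tendsto_one_of_isBigO hm'.infinity).congr' ?_
      filter_upwards [h.sectional_eventually] with z hz
      simp [hM, show z ∉ Γ from hz.1]
    have h2 : Tendsto m (cocompact ℂ) (𝓝 1) := tendsto_one_of_isBigO h.isRHSolution.infinity
    have h3 := (continuousAt_matrix_inv (M := 1) isUnit_one).tendsto.comp h2
    have h4 := h1.mul h3
    simpa using h4
  have hR1 : ∀ z, R z = 1 := by
    intro z
    ext i j
    exact (hRent i j).apply_eq_of_tendsto_cocompact z
      (((entryCLM i j).continuous.tendsto 1).comp hlim)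
  intro z hz
  have h1 := hR1 z
  have h2 := (Matrix.isUnit_iff_isUnit_det _).1 (h.sectional_differentiableAt hz).2
  have h3 : M z = m' z := by simp [hM, show z ∉ Γ from hz]
  rw [← h3]
  calc M z = R z * m z := by rw [hR]; simp only; rw [mul_assoc, Matrix.nonsing_inv_mul _ h2, mul_one]
    _ = m z := by rw [h1, one_mul]

end RHFactorization

/-! ### The spectral parameter as a function on the `z`-plane -/

/-- The polynomial `4 z (k - s)`. -/
def specPoly (x y s : ℝ) (z : ℂ) : ℂ := (1 - y) * (z + 1) ^ 2 - x * (z - 1) ^ 2 - 4 * z * s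

/-- The function `(k - x) / (k - s)`. -/
def specRatio (x y s : ℝ) (z : ℂ) : ℂ := (1 - x - y) * (z + 1) ^ 2 / specPoly x y s z

/-- The principal root of `(k - x) / (k - s)`. -/
def specRoot (x y s : ℝ) (z : ℂ) : ℂ := Complex.sqrt (specRatio x y s z)

/-- The function `λ(s,y,·)`. -/
def specLam (x y s : ℝ) (z : ℂ) : ℂ := (z - 1) / (z + 1) * specRoot x y s z

theorem specPoly_self (x y : ℝ) (z : ℂ) : specPoly x y x z = (1 - x - y) * (z + 1) ^ 2 := by
  rw [specPoly]; ring

theorem specPoly_eq (x y s : ℝ) (z : ℂ) :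
    specPoly x y s z = (1 - x - y) * (z + 1) ^ 2 + 4 * z * (x - s) := by
  rw [specPoly]; ring

theorem ofReal_one_sub_sub_ne_zero {x y : ℝ} (hxy : x + y < 1) : (1 - x - y : ℂ) ≠ 0 := by
  have h : (1 - x - y : ℝ) ≠ 0 := by linarith
  exact_mod_cast h

/-- Multiply k = s by 4z. No separate condition z ≠ 0 survives, since the polynomial equals 1 - x -
y ≠ 0 at z = 0. -/
theorem mem_sigma0_iff {x y : ℝ} (hxy : x + y < 1) {z : ℂ} :
    z ∈ sigma0 x y ↔ ∃ s ∈ Icc 0 x, specPoly x y s z = 0 := by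
  have h0 := ofReal_one_sub_sub_ne_zero hxy
  constructor
  · rintro ⟨hz, s, hs, h⟩
    refine ⟨s, hs, ?_⟩
    rw [surfacePoint] at h
    simp only at h
    rw [div_eq_iff (by simpa using hz)] at h
    rw [specPoly, h]; ring
  · rintro ⟨s, hs, h⟩
    have hz : z ≠ 0 := by
      rintro rfl
      apply h0
      rw [specPoly] at h
      linear_combination h
    refine ⟨hz, s, hs, ?_⟩
    rw [surfacePoint]
    simp only
    rw [div_eq_iff (by simpa using hz)]
    rw [specPoly] at h
    linear_combination h

/-- The reflection k ↦ 1 - k, with x and y exchanged, is z ↦ -z, that is λ ↦ 1/λ. It reduces all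
statements about Σ₁ and the second root to those about Σ₀ and the first. -/
theorem mem_sigma1_iff {x y : ℝ} {z : ℂ} : z ∈ sigma1 x y ↔ -z ∈ sigma0 y x := by
  have key : ∀ t : ℝ, z ≠ 0 → ((surfacePoint x y z).2 = ((1 - t : ℝ) : ℂ) ↔
      (surfacePoint y x (-z)).2 = (t : ℂ)) := by
    intro t hz
    simp only [surfacePoint]
    rw [div_eq_iff (by simpa using hz), div_eq_iff (by simpa using hz)]
    push_cast
    constructor <;> intro h <;> linear_combination h
  constructor
  · rintro ⟨hz, s, hs, h⟩
    refine ⟨neg_ne_zero.2 hz, 1 - s, ⟨by linarith [hs.2], by linarith [hs.1]⟩, ?_⟩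
    rw [← key _ hz, h]
    simp
  · rintro ⟨hz, t, ht, h⟩
    have hz : z ≠ 0 := neg_ne_zero.1 hz
    exact ⟨hz, 1 - t, ⟨by linarith [ht.2], by linarith [ht.1]⟩, (key t hz).2 h⟩

theorem continuous_specPoly (x y : ℝ) : Continuous fun p : ℝ × ℂ => specPoly x y p.1 p.2 := by
  unfold specPoly; fun_prop

/-- A projection along the compact interval [0,x] is a closed map. -/
theorem isClosed_sigma0 {x y : ℝ} (hxy : x + y < 1) : IsClosed (sigma0 x y) := by
  have h2 : sigma0 x y = Prod.snd '' {p : Icc 0 x × ℂ | specPoly x y p.1 p.2 = 0} := by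
    ext z
    rw [mem_sigma0_iff hxy]
    constructor
    · rintro ⟨s, hs, h⟩
      exact ⟨(⟨s, hs⟩, z), h, rfl⟩
    · rintro ⟨⟨s, w⟩, h, rfl⟩
      exact ⟨s, s.2, h⟩
  have h3 : Continuous fun p : Icc 0 x × ℂ => specPoly x y p.1 p.2 := by
    unfold specPoly; fun_prop
  rw [h2]
  exact isClosedMap_snd_of_compactSpace _ (isClosed_eq h3 continuous_const)

theorem isClosed_sigma1 {x y : ℝ} (hxy : x + y < 1) : IsClosed (sigma1 x y) := by
  have : sigma1 x y = Neg.neg ⁻¹' sigma0 y x := by ext z; exact mem_sigma1_iff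
  rw [this]
  exact (isClosed_sigma0 (by linarith)).preimage continuous_neg

section

variable {x y s : ℝ} {z : ℂ}

theorem specPoly_ne_zero (hxy : x + y < 1) (hz : z ∉ sigma0 x y) (hs : s ∈ Icc 0 x) :
    specPoly x y s z ≠ 0 := fun h => hz ((mem_sigma0_iff hxy).2 ⟨s, hs, h⟩)

theorem add_one_ne_zero_of_notMem (hx : 0 ≤ x) (hxy : x + y < 1) (hz : z ∉ sigma0 x y) :
    z + 1 ≠ 0 := by
  intro h
  refine specPoly_ne_zero hxy hz (right_mem_Icc.2 hx) ?_
  rw [specPoly_self, h]; simp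

theorem sub_one_ne_zero_of_notMem (hy : 0 ≤ y) (hxy : x + y < 1) (hz : z ∉ sigma1 x y) :
    z - 1 ≠ 0 := by
  rw [mem_sigma1_iff] at hz
  have := add_one_ne_zero_of_notMem hy (by linarith) hz
  intro h
  apply this
  linear_combination -h

/-- If (k-x)/(k-s) = -r with r ≥ 0, then k = (x + rs)/(1 + r) is a convex combination of x and s,
hence in [0,x]. So off F(Σ₀) the principal root is never evaluated on its cut. -/
theorem specRatio_mem_slitPlane (hx : 0 ≤ x) (hxy : x + y < 1) (hz : z ∉ sigma0 x y)
    (hs : s ∈ Icc 0 x) : specRatio x y s z ∈ Complex.slitPlane := by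
  by_contra hq
  rw [Complex.mem_slitPlane_iff, not_or, not_lt, not_not] at hq
  set q := specRatio x y s z with hqdef
  set r : ℝ := -q.re with hr
  have hr0 : 0 ≤ r := by linarith [hq.1]
  have hqr : q = -(r : ℂ) := by
    apply Complex.ext
    · simp [hr]
    · simp [hq.2]
  have hP := specPoly_ne_zero hxy hz hs
  have h1 : (1 - x - y) * (z + 1) ^ 2 = -(r : ℂ) * specPoly x y s z := by
    rw [← hqr, hqdef, specRatio, div_mul_cancel₀ _ hP]
  have hr1 : (1 + r : ℂ) ≠ 0 := by
    have : (1 + r : ℝ) ≠ 0 := by positivity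
    exact_mod_cast this
  refine hz ((mem_sigma0_iff hxy).2 ⟨(x + r * s) / (1 + r), ⟨?_, ?_⟩, ?_⟩)
  · have := hs.1; positivity
  · rw [div_le_iff₀ (by positivity)]
    nlinarith [hs.2]
  · rw [specPoly_eq] at h1 ⊢
    push_cast
    field_simp
    linear_combination h1

theorem specRatio_ne_zero (hx : 0 ≤ x) (hxy : x + y < 1) (hz : z ∉ sigma0 x y)
    (hs : s ∈ Icc 0 x) : specRatio x y s z ≠ 0 :=
  Complex.slitPlane_ne_zero (specRatio_mem_slitPlane hx hxy hz hs)

theorem csqrt_sq (q : ℂ) : Complex.sqrt q ^ 2 = q :=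
  Complex.cpow_ofNat_inv_pow q 2

theorem csqrt_ne_zero {q : ℂ} (hq : q ≠ 0) : Complex.sqrt q ≠ 0 := fun h => by
  have := csqrt_sq q
  rw [h] at this
  exact hq (by simpa using this.symm)

theorem csqrt_inv {q : ℂ} (hq : q ∈ Complex.slitPlane) : Complex.sqrt q⁻¹ = (Complex.sqrt q)⁻¹ :=
  Complex.inv_cpow q _ (Complex.slitPlane_arg_ne_pi hq)

theorem hasDerivAt_csqrt {q : ℂ} (hq : q ∈ Complex.slitPlane) :
    HasDerivAt Complex.sqrt (1 / (2 * Complex.sqrt q)) q := by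
  have h0 := Complex.slitPlane_ne_zero hq
  have h := (hasDerivAt_id q).cpow_const (c := 2⁻¹) hq
  refine h.congr_deriv ?_
  have h1 := csqrt_ne_zero h0
  have h2 := csqrt_sq q
  simp only [id]
  rw [Complex.cpow_sub _ _ h0, Complex.cpow_one]
  change 2⁻¹ * (Complex.sqrt q / q) * 1 = _
  field_simp
  linear_combination h2

theorem specRoot_sq : specRoot x y s z ^ 2 = specRatio x y s z := csqrt_sq _

theorem specRoot_ne_zero (hx : 0 ≤ x) (hxy : x + y < 1) (hz : z ∉ sigma0 x y)
    (hs : s ∈ Icc 0 x) : specRoot x y s z ≠ 0 :=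
  csqrt_ne_zero (specRatio_ne_zero hx hxy hz hs)

theorem specRoot_self (hx : 0 ≤ x) (hxy : x + y < 1) (hz : z ∉ sigma0 x y) :
    specRoot x y x z = 1 := by
  rw [specRoot, specRatio, div_eq_one_iff_eq (specPoly_ne_zero hxy hz (right_mem_Icc.2 hx)) |>.2
    (specPoly_self x y z).symm, Complex.sqrt_one]

theorem specRoot_zero (hxy : x + y < 1) : specRoot x y s 0 = 1 := by
  have h0 := ofReal_one_sub_sub_ne_zero hxy
  rw [specRoot, specRatio, specPoly, show ((1 - x - y) * (0 + 1) ^ 2 /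
    ((1 - y) * (0 + 1) ^ 2 - x * (0 - 1) ^ 2 - 4 * 0 * s) : ℂ) = 1 by
      rw [div_eq_one_iff_eq] <;> [ring; (intro h; apply h0; linear_combination h)],
    Complex.sqrt_one]

theorem specLam_zero (hxy : x + y < 1) : specLam x y s 0 = -1 := by
  rw [specLam, specRoot_zero hxy]; norm_num

/-- The sheet exchange z ↦ 1/z leaves k unchanged, and the root depends on k only. -/
theorem specRoot_inv (hz : z ≠ 0) : specRoot x y s z⁻¹ = specRoot x y s z := by
  rw [specRoot, specRoot, specRatio, specRatio]
  congr 1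
  have : specPoly x y s z⁻¹ = specPoly x y s z / z ^ 2 := by
    rw [specPoly, specPoly]; field_simp; ring
  rw [this]
  by_cases hP : specPoly x y s z = 0
  · simp [hP]
  · field_simp; ring

theorem specLam_inv (hz : z ≠ 0) : specLam x y s z⁻¹ = -specLam x y s z := by
  rw [specLam, specLam, specRoot_inv hz]
  by_cases h : z + 1 = 0
  · have : z⁻¹ + 1 = 0 := by rw [eq_neg_of_add_eq_zero_left h]; norm_num
    rw [h, this]; simp
  · have h' : z⁻¹ + 1 ≠ 0 := fun h' => h (by field_simp at h'; linear_combination h')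
    have : (z⁻¹ - 1) / (z⁻¹ + 1) = -((z - 1) / (z + 1)) := by
      rw [div_eq_iff h']
      field_simp
      ring
    rw [this]; ring

theorem continuousOn_specRoot (hx : 0 ≤ x) (hxy : x + y < 1) :
    ContinuousOn (fun p : ℝ × ℂ => specRoot x y p.1 p.2) (Icc 0 x ×ˢ (sigma0 x y)ᶜ) := by
  rintro ⟨s, z⟩ ⟨hs, hz⟩
  refine ContinuousAt.continuousWithinAt ?_
  have h1 := (hasDerivAt_csqrt (specRatio_mem_slitPlane hx hxy hz hs)).continuousAt
  refine ContinuousAt.comp (f := fun p : ℝ × ℂ => specRatio x y p.1 p.2) h1 ?_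
  unfold specRatio
  exact ContinuousAt.div (by fun_prop) (continuous_specPoly x y).continuousAt
    (specPoly_ne_zero hxy hz hs)

theorem continuousOn_specLam (hx : 0 ≤ x) (hxy : x + y < 1) :
    ContinuousOn (fun p : ℝ × ℂ => specLam x y p.1 p.2) (Icc 0 x ×ˢ (sigma0 x y)ᶜ) := by
  unfold specLam
  refine ContinuousOn.mul (ContinuousOn.div (by fun_prop) (by fun_prop) ?_)
    (continuousOn_specRoot hx hxy)
  rintro ⟨s, z⟩ ⟨hs, hz⟩
  exact add_one_ne_zero_of_notMem hx hxy hz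

theorem differentiableOn_specRoot (hx : 0 ≤ x) (hxy : x + y < 1) (hs : s ∈ Icc 0 x) :
    DifferentiableOn ℂ (specRoot x y s) (sigma0 x y)ᶜ := by
  intro z hz
  refine DifferentiableAt.differentiableWithinAt ?_
  have h1 := (hasDerivAt_csqrt (specRatio_mem_slitPlane hx hxy hz hs)).differentiableAt
  refine DifferentiableAt.comp (f := fun z : ℂ => specRatio x y s z) z h1 ?_
  unfold specRatio
  refine DifferentiableAt.div (by fun_prop) ?_ (specPoly_ne_zero hxy hz hs)
  unfold specPoly
  fun_prop

theorem differentiableOn_specLam (hx : 0 ≤ x) (hxy : x + y < 1) (hs : s ∈ Icc 0 x) :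
    DifferentiableOn ℂ (specLam x y s) (sigma0 x y)ᶜ := by
  unfold specLam
  refine DifferentiableOn.mul (DifferentiableOn.div (by fun_prop) (by fun_prop) ?_)
    (differentiableOn_specRoot hx hxy hs)
  exact fun z hz => add_one_ne_zero_of_notMem hx hxy hz

theorem hasDerivAt_specRoot (hx : 0 ≤ x) (hxy : x + y < 1) (hz : z ∉ sigma0 x y)
    (hs : s ∈ Icc 0 x) : HasDerivAt (fun s : ℝ => specRoot x y s z)
      (specRoot x y s z * (2 * z / specPoly x y s z)) s := by
  have hP := specPoly_ne_zero hxy hz hs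
  have h1 : HasDerivAt (fun s : ℝ => specPoly x y s z) (-(4 * z)) s := by
    have := ((Complex.ofRealCLM.hasDerivAt (x := s)).const_mul (4 * z)).const_sub
      ((1 - y) * (z + 1) ^ 2 - x * (z - 1) ^ 2)
    simpa [specPoly] using this
  have h2 : HasDerivAt (fun s : ℝ => specRatio x y s z)
      (specRatio x y s z * (4 * z / specPoly x y s z)) s := by
    have := (hasDerivAt_const s ((1 - x - y) * (z + 1) ^ 2 : ℂ)).fun_div h1 hP
    refine this.congr_deriv ?_
    rw [specRatio]
    field_simp
    ring
  have h3 := (hasDerivAt_csqrt (specRatio_mem_slitPlane hx hxy hz hs)).comp s h2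
  refine h3.congr_deriv ?_
  have h4 := specRoot_ne_zero hx hxy hz hs
  have h5 := specRoot_sq (x := x) (y := y) (s := s) (z := z)
  change 1 / (2 * specRoot x y s z) * _ = _
  rw [← h5]
  field_simp
  norm_num

end

/-- The function `λ(s,t,·)`. -/
def lamFun (x y s t : ℝ) (z : ℂ) : ℂ := specLam x y s z / specRoot y x t (-z)

/-! ### Differential equations satisfied by λ(s,t,z). -/

section

variable {x y s t : ℝ} {z : ℂ}

theorem specLam_swap : specLam y x t (-z) = (z + 1) / (z - 1) * specRoot y x t (-z) := by
  rw [specLam, show -z - 1 = -(z + 1) by ring, show -z + 1 = -(z - 1) by ring, neg_div_neg_eq]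

/-- 1/λ is built as λ is, after exchange of the variables and z ↦ -z. This lets V be treated as the
first Lax matrix of the exchanged potentials. -/
theorem one_div_lamFun (hz1 : z - 1 ≠ 0) (hz2 : z + 1 ≠ 0) :
    1 / lamFun x y s t z = specLam y x t (-z) / specRoot x y s z := by
  rw [lamFun, specLam_swap, specLam]
  by_cases h1 : specRoot x y s z = 0
  · simp [h1]
  by_cases h2 : specRoot y x t (-z) = 0
  · simp [h2]
  field_simp

variable (hx : 0 ≤ x) (hy : 0 ≤ y) (hxy : x + y < 1) (hz0 : z ∉ sigma0 x y) (hz1 : z ∉ sigma1 x y)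
  (hs : s ∈ Icc 0 x) (ht : t ∈ Icc 0 y)

include hx hy hxy hz0 hz1 hs ht

theorem lamFun_ne_zero : lamFun x y s t z ≠ 0 := by
  refine div_ne_zero (mul_ne_zero (div_ne_zero ?_ ?_) ?_) ?_
  · exact sub_one_ne_zero_of_notMem hy hxy hz1
  · exact add_one_ne_zero_of_notMem hx hxy hz0
  · exact specRoot_ne_zero hx hxy hz0 hs
  · exact specRoot_ne_zero hy (by linarith) (mem_sigma1_iff.not.1 hz1) ht

theorem lamFun_sq : lamFun x y s t z ^ 2 = specPoly y x t (-z) / specPoly x y s z := by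
  have h0 := ofReal_one_sub_sub_ne_zero hxy
  have h1 := sub_one_ne_zero_of_notMem hy hxy hz1
  have h2 := add_one_ne_zero_of_notMem hx hxy hz0
  have h3 := specPoly_ne_zero hxy hz0 hs
  have h4 := specPoly_ne_zero (by linarith) (mem_sigma1_iff.not.1 hz1) ht
  have h5 : (1 - y - x : ℂ) ≠ 0 := by rwa [sub_right_comm]
  have h6 : -z + 1 ≠ 0 := fun h => h1 (by linear_combination -h)
  rw [lamFun, specLam, div_pow, mul_pow, specRoot_sq, specRoot_sq, specRatio, specRatio]
  field_simp
  ring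

theorem one_sub_lamFun_sq : 1 - lamFun x y s t z ^ 2 = 4 * z * (1 - s - t) / specPoly x y s z := by
  have h3 := specPoly_ne_zero hxy hz0 hs
  rw [lamFun_sq hx hy hxy hz0 hz1 hs ht, eq_div_iff h3, sub_mul, div_mul_cancel₀ _ h3,
    specPoly, specPoly]
  ring

/-- From λ² = (k-(1-t))/(k-s) one gets λ_s/λ = 1/(2(k-s)), and 1 - λ² = (1-s-t)/(k-s) removes k. The
t-derivative is found in the same way from 1/λ² - 1 = (1-s-t)/(k-(1-t)). -/
theorem hasDerivAt_lamFun_left : HasDerivAt (fun s => lamFun x y s t z)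
    (lamFun x y s t z * (1 - lamFun x y s t z ^ 2) * (1 / (2 * (1 - s - t)))) s := by
  have hst : (1 - s - t : ℂ) ≠ 0 := ofReal_one_sub_sub_ne_zero (by linarith [hs.2, ht.2])
  have h3 := specPoly_ne_zero hxy hz0 hs
  have h := ((hasDerivAt_specRoot hx hxy hz0 hs).const_mul ((z - 1) / (z + 1))).div_const
    (specRoot y x t (-z))
  refine h.congr_deriv ?_
  rw [one_sub_lamFun_sq hx hy hxy hz0 hz1 hs ht, lamFun, specLam]
  field_simp
  norm_num

theorem hasDerivAt_lamFun_right : HasDerivAt (fun t => lamFun x y s t z)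
    ((1 / lamFun x y s t z - lamFun x y s t z) * (1 / (2 * (1 - s - t)))) t := by
  have hst : (1 - s - t : ℂ) ≠ 0 := ofReal_one_sub_sub_ne_zero (by linarith [hs.2, ht.2])
  have hyx : y + x < 1 := by linarith
  have hz1' := mem_sigma1_iff.not.1 hz1
  have h3 := specPoly_ne_zero hxy hz0 hs
  have h4 := specPoly_ne_zero hyx hz1' ht
  have h5 := specRoot_ne_zero hy hyx hz1' ht
  have h6 := lamFun_ne_zero hx hy hxy hz0 hz1 hs ht
  have h := (hasDerivAt_const t (specLam x y s z)).fun_div (hasDerivAt_specRoot hy hyx hz1' ht) h5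
  refine h.congr_deriv ?_
  have h7 : (1 / lamFun x y s t z - lamFun x y s t z) =
      lamFun x y s t z * (4 * z * (1 - s - t) / specPoly y x t (-z)) := by
    have h8 := one_sub_lamFun_sq hx hy hxy hz0 hz1 hs ht
    have h9 := lamFun_sq hx hy hxy hz0 hz1 hs ht
    have : 4 * z * (1 - s - t) / specPoly y x t (-z) =
        (4 * z * (1 - s - t) / specPoly x y s z) / (specPoly y x t (-z) / specPoly x y s z) := by
      field_simp
    rw [this, ← h8, ← h9]
    field_simp
  rw [h7, lamFun]
  field_simp
  ring

omit hx in
-- One root in `lamAt` is that of the reciprocal of a value in the slit plane, where the principal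
-- root commutes with inversion.
theorem lamAt_surfacePoint (hz : z ≠ 0) : lamAt x y s t (surfacePoint x y z) = lamFun x y s t z := by
  have hyx : y + x < 1 := by linarith
  have hz1' := mem_sigma1_iff.not.1 hz1
  have h3 := specPoly_ne_zero hxy hz0 hs
  have h4 := specPoly_ne_zero hyx hz1' ht
  have hr1 : ((surfacePoint x y z).2 - x) / ((surfacePoint x y z).2 - s) = specRatio x y s z := by
    rw [surfacePoint, specRatio]
    simp only
    have e1 : ((1 - y) * (z + 1) ^ 2 - x * (z - 1) ^ 2) / (4 * z) - (x : ℂ) =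
        ((1 - x - y) * (z + 1) ^ 2) / (4 * z) := by field_simp; ring
    have e2 : ((1 - y) * (z + 1) ^ 2 - x * (z - 1) ^ 2) / (4 * z) - (s : ℂ) =
        specPoly x y s z / (4 * z) := by rw [specPoly]; field_simp
    rw [e1, e2, div_div_div_cancel_right₀ (by simpa using hz)]
  have hr2 : ((surfacePoint x y z).2 - (1 - t)) / ((surfacePoint x y z).2 - (1 - y)) =
      (specRatio y x t (-z))⁻¹ := by
    rw [surfacePoint, specRatio, inv_div]
    simp only
    have e1 : ((1 - y) * (z + 1) ^ 2 - x * (z - 1) ^ 2) / (4 * z) - (1 - t : ℂ) =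
        specPoly y x t (-z) / (4 * z) := by rw [specPoly]; field_simp; ring
    have e2 : ((1 - y) * (z + 1) ^ 2 - x * (z - 1) ^ 2) / (4 * z) - (1 - y : ℂ) =
        ((1 - y - x) * (-z + 1) ^ 2) / (4 * z) := by field_simp; ring
    rw [e1, e2, div_div_div_cancel_right₀ (by simpa using hz)]
  rw [lamAt, hr1, hr2, csqrt_inv (specRatio_mem_slitPlane hy hyx hz1' ht), lamFun, specLam]
  simp only [surfacePoint, specRoot]
  ring

end

/-- Half of the diameter of a disc about `F(Σ₀)`. -/
def sigmaRadius (x y : ℝ) : ℝ := 2 * (1 + x - y) / (1 - x - y)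

theorem two_le_sigmaRadius {x y : ℝ} (hx : 0 ≤ x) (hxy : x + y < 1) : 2 ≤ sigmaRadius x y := by
  rw [sigmaRadius, le_div_iff₀ (by linarith)]
  linarith

/-- Points over k = s solve z² - uz + 1 = 0 with u real and -T ≤ u ≤ -2, where T is `sigmaRadius`.
The roots are real and negative with product 1, so they lie in [-T, -1/T]. The disc about -T of
radius T - 1/(2T) contains this segment and stays in the left half-plane. -/
theorem sigma0_subset_ball {x y : ℝ} (hxy : x + y < 1) : sigma0 x y ⊆
    Metric.ball (-(sigmaRadius x y : ℂ)) (sigmaRadius x y - 1 / (2 * sigmaRadius x y)) := by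
  intro z hz
  obtain ⟨s, hs, h⟩ := (mem_sigma0_iff hxy).1 hz
  have hx : 0 ≤ x := hs.1.trans hs.2
  set T := sigmaRadius x y with hT
  have hT2 : 2 ≤ T := two_le_sigmaRadius hx hxy
  have hd : 0 < 1 - x - y := by linarith
  set u : ℝ := -2 * (x + 1 - y - 2 * s) / (1 - x - y) with hu
  have hu2 : u ≤ -2 := by
    rw [hu, div_le_iff₀ hd]; nlinarith [hs.2]
  have huT : -T ≤ u := by
    rw [hT, sigmaRadius, hu, ← neg_div]
    gcongr
    nlinarith [hs.1]
  have hquad : z ^ 2 - u * z + 1 = 0 := by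
    have h0 := ofReal_one_sub_sub_ne_zero hxy
    rw [specPoly] at h
    rw [hu]
    push_cast
    field_simp
    linear_combination h
  have hre := congrArg Complex.re hquad
  have him := congrArg Complex.im hquad
  simp [pow_two] at hre him
  -- A non-real root would have real part u/2, and then (Im z)² = 1 - u²/4 ≤ 0.
  have him0 : z.im = 0 := by
    have : z.im * (2 * z.re - u) = 0 := by linear_combination him
    rcases mul_eq_zero.1 this with h | h
    · exact h
    · have ha : z.re = u / 2 := by linarith
      rw [ha] at hre
      have : z.im * z.im ≤ 0 := by nlinarith
      nlinarith
  rw [him0] at hre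
  have hzre : z = (z.re : ℂ) := by apply Complex.ext <;> simp [him0]
  set a := z.re with ha
  have ha0 : a < 0 := by
    by_contra hneg
    push Not at hneg
    nlinarith [mul_nonneg hneg (by linarith : 0 ≤ -u), mul_nonneg hneg hneg]
  have h1 : -T ≤ a := by nlinarith
  have h2 : a * T ≤ -1 := by nlinarith
  rw [Metric.mem_ball, dist_eq_norm, sub_neg_eq_add, hzre, ← Complex.ofReal_add, Complex.norm_real,
    Real.norm_eq_abs, abs_of_nonneg (by linarith)]
  have h3 : a ≤ -(1 / T) := by
    rw [← neg_div, le_div_iff₀ (by linarith)]; exact h2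
  have h4 : 1 / (2 * T) < 1 / T := by
    apply one_div_lt_one_div_of_lt <;> linarith
  linarith

theorem sigma1_subset_ball {x y : ℝ} (hxy : x + y < 1) : sigma1 x y ⊆
    Metric.ball (sigmaRadius y x : ℂ) (sigmaRadius y x - 1 / (2 * sigmaRadius y x)) := by
  intro z hz
  have := sigma0_subset_ball (by linarith) (mem_sigma1_iff.1 hz)
  rw [Metric.mem_ball, dist_eq_norm] at this ⊢
  rwa [← norm_neg, neg_sub, sub_eq_neg_add, add_comm, ← sub_eq_add_neg, sub_neg_eq_add,
    neg_add_eq_sub] at this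

/-- Contours as required exist. -/
theorem exists_admissibleContours {x y : ℝ} (hx : 0 ≤ x) (hy : 0 ≤ y) (hxy : x + y < 1) :
    ∃ γ₀ γ₁, AdmissibleContours x y γ₀ γ₁ := by
  have aux : ∀ {x y : ℝ}, 0 ≤ x → x + y < 1 →
      0 < sigmaRadius x y - 1 / (2 * sigmaRadius x y) ∧ 0 < 1 / (2 * sigmaRadius x y) := by
    intro x y hx hxy
    have h2 := two_le_sigmaRadius hx hxy
    have : 1 / (2 * sigmaRadius x y) ≤ 1 / 4 := by
      apply one_div_le_one_div_of_le <;> linarith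
    exact ⟨by linarith, by positivity⟩
  obtain ⟨r0, e0⟩ := aux hx hxy
  obtain ⟨r1, e1⟩ := aux hy (by linarith : y + x < 1)
  -- The two closed discs lie in opposite open half-planes, hence are disjoint and avoid 0.
  have hneg : ∀ z ∈ Metric.closedBall (-(sigmaRadius x y : ℂ))
      (sigmaRadius x y - 1 / (2 * sigmaRadius x y)), z.re < 0 := by
    intro z hz
    rw [mem_closedBall_iff_norm, sub_neg_eq_add] at hz
    have := (Complex.abs_re_le_norm _).trans hz
    rw [Complex.add_re, Complex.ofReal_re] at this
    linarith [le_abs_self (z.re + sigmaRadius x y)]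
  have hpos : ∀ z ∈ Metric.closedBall (sigmaRadius y x : ℂ)
      (sigmaRadius y x - 1 / (2 * sigmaRadius y x)), 0 < z.re := by
    intro z hz
    rw [mem_closedBall_iff_norm] at hz
    have := (Complex.abs_re_le_norm _).trans hz
    rw [Complex.sub_re, Complex.ofReal_re] at this
    linarith [neg_abs_le (z.re - sigmaRadius y x)]
  refine ⟨_, _, isClockwiseLoop_clockwiseCircle r0, isClockwiseLoop_clockwiseCircle r1,
    (sigma0_subset_ball hxy).trans (ball_subset_inside_clockwiseCircle r0),
    (sigma1_subset_ball hxy).trans (ball_subset_inside_clockwiseCircle r1),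
    compl_closedBall_subset_outside_clockwiseCircle r0 fun h => by simpa using hneg 0 h,
    compl_closedBall_subset_outside_clockwiseCircle r1 fun h => by simpa using hpos 0 h, ?_⟩
  refine Disjoint.mono (trace_union_inside_clockwiseCircle r0)
    (trace_union_inside_clockwiseCircle r1) (Set.disjoint_left.2 fun z h0 h1 => ?_)
  exact lt_asymm (hneg z h0) (hpos z h1)

/-! ### Partial derivatives of solutions up to the edges of the triangle -/

theorem interior_triangle : interior triangle = {p : ℝ × ℝ | 0 < p.1 ∧ 0 < p.2 ∧ p.1 + p.2 < 1} := by
  apply Subset.antisymm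
  · intro p hp
    have hp' := interior_subset hp
    have h1 : ∀ᶠ r : ℝ in 𝓝 0, (p.1 - r, p.2 - r) ∈ triangle := by
      have hc : ContinuousAt (fun r : ℝ => (p.1 - r, p.2 - r)) 0 := by fun_prop
      refine hc.eventually_mem ?_
      simpa using mem_interior_iff_mem_nhds.1 hp
    have h2 : ∀ᶠ r : ℝ in 𝓝[>] 0, r ∈ Ioi (0 : ℝ) := self_mem_nhdsWithin
    obtain ⟨r, hr0, hr⟩ := (h2.and (nhdsWithin_le_nhds h1)).exists
    have hr0 : 0 < r := hr0
    exact ⟨by linarith [hr.1], by linarith [hr.2.1], hp'.2.2⟩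
  · refine interior_maximal (fun p hp => ⟨hp.1.le, hp.2.1.le, hp.2.2⟩) ?_
    exact (isOpen_lt continuous_const continuous_fst).inter
      ((isOpen_lt continuous_const continuous_snd).inter
      (isOpen_lt (continuous_fst.add continuous_snd) continuous_const))

theorem mem_interior_triangle {p : ℝ × ℝ} :
    p ∈ interior triangle ↔ 0 < p.1 ∧ 0 < p.2 ∧ p.1 + p.2 < 1 := by
  rw [interior_triangle]; rfl

theorem swap_mem_triangle {p : ℝ × ℝ} (hp : p ∈ triangle) : p.swap ∈ triangle :=
  ⟨hp.2.1, hp.1, by rw [Prod.fst_swap, Prod.snd_swap, add_comm]; exact hp.2.2⟩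

/-- As t → 0+ the functions u(·,t) converge pointwise, and their derivatives uniformly on compact
subintervals of (0,1), since the extended g is continuous up to the edge. So differentiation passes
to the limit. -/
theorem hasDerivAt_edge {u g : ℝ × ℝ → ℂ} {β : ℝ} (hu : ContinuousOn u triangle)
    (hg : ContinuousOn g triangle)
    (h : ∀ p ∈ interior triangle,
      HasDerivAt (fun s => u (s, p.2)) ((p.1 ^ (-β) : ℝ) * g p) p.1)
    {s : ℝ} (hs : s ∈ Ioo (0 : ℝ) 1) :
    HasDerivAt (fun s => u (s, 0)) ((s ^ (-β) : ℝ) * g (s, 0)) s := by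
  obtain ⟨a, ha0, has⟩ := exists_between hs.1
  obtain ⟨b, hsb, hb1⟩ := exists_between hs.2
  -- The height (1-b)/2 keeps the rectangle over [a,b] inside the triangle.
  have htri : ∀ t ∈ Icc 0 ((1 - b) / 2), ∀ σ ∈ Icc a b, (σ, t) ∈ triangle := fun t ht σ hσ =>
    ⟨ha0.le.trans hσ.1, ht.1, by have := ht.2; have := hσ.2; simp only; linarith⟩
  have hF : ContinuousOn (Function.uncurry fun t σ : ℝ => (((σ ^ (-β) : ℝ) : ℂ) * g (σ, t)))
      (Icc 0 ((1 - b) / 2) ×ˢ Icc a b) := by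
    refine ContinuousOn.mul ?_ ?_
    · refine Complex.continuous_ofReal.comp_continuousOn ?_
      refine continuousOn_snd.rpow_const fun p hp => Or.inl ?_
      exact (ha0.trans_le hp.2.1).ne'
    · refine hg.comp (f := fun p : ℝ × ℝ => (p.2, p.1)) (by fun_prop) fun p hp => ?_
      exact htri _ hp.1 _ hp.2
  have hb' : 0 < (1 - b) / 2 := by linarith
  have hsub : Ioo 0 ((1 - b) / 2) ∈ 𝓝[>] (0 : ℝ) := Ioo_mem_nhdsGT hb'
  refine hasDerivAt_of_tendstoLocallyUniformlyOn (l := 𝓝[>] (0 : ℝ)) (s := Ioo a b)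
    (f := fun t σ => u (σ, t)) (f' := fun t σ => ((σ ^ (-β) : ℝ) : ℂ) * g (σ, t))
    (g' := fun σ => ((σ ^ (-β) : ℝ) : ℂ) * g (σ, 0)) isOpen_Ioo ?_ ?_ ?_ ⟨has, hsb⟩
  · refine TendstoUniformlyOn.tendstoLocallyUniformlyOn ?_
    intro V hV
    obtain ⟨W, hW, hWV⟩ := isCompact_Icc.mem_uniformity_of_prod (hF)
      (q := (0 : ℝ)) ⟨le_rfl, hb'.le⟩ (symm_le_uniformity hV)
    have hW' : W ∈ 𝓝[>] (0 : ℝ) := by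
      rw [mem_nhdsWithin] at hW ⊢
      obtain ⟨O, hO, h0, hOW⟩ := hW
      refine ⟨O ∩ Iio ((1 - b) / 2), hO.inter isOpen_Iio, ⟨h0, hb'⟩, fun t ht => ?_⟩
      exact hOW ⟨ht.1.1, ht.2.le, ht.1.2.le⟩
    filter_upwards [hW'] with t ht σ hσ
    exact hWV t ht σ (Ioo_subset_Icc_self hσ)
  · filter_upwards [hsub] with t ht σ hσ
    refine h (σ, t) (mem_interior_triangle.2 ⟨ha0.trans hσ.1, ht.1, ?_⟩)
    have := ht.2; have := hσ.2; simp only; linarith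
  · intro σ hσ
    have hc : ContinuousWithinAt (fun t : ℝ => u (σ, t)) (Icc 0 ((1 - b) / 2)) 0 :=
      (hu.comp (f := fun t : ℝ => (σ, t)) (by fun_prop)
        fun t ht => htri t ht σ (Ioo_subset_Icc_self hσ)) 0 ⟨le_rfl, hb'.le⟩
    refine hc.tendsto.mono_left ?_
    rw [← nhdsWithin_Ioo_eq_nhdsGT hb']
    exact nhdsWithin_mono _ Ioo_subset_Icc_self

/-- `u` is a continuous function on the triangle, divided by the power `x ^ β`. -/
def SingularX (β : ℝ) (u : ℝ × ℝ → ℂ) : Prop :=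
  ∃ g, ContinuousOn g triangle ∧ ∀ p ∈ triangle, 0 < p.1 → u p = (p.1 ^ (-β) : ℝ) * g p

/-- First and mixed partial derivatives of `u`, extended to those edges of the triangle where they
exist, with weak singularities. -/
structure PartialData (β : ℝ) (u ux uy uxy : ℝ × ℝ → ℂ) : Prop where
  cont : ContinuousOn u triangle
  hasDeriv_x : ∀ p ∈ triangle, 0 < p.1 → HasDerivAt (fun s => u (s, p.2)) (ux p) p.1
  hasDeriv_y : ∀ p ∈ triangle, 0 < p.2 → HasDerivAt (fun t => u (p.1, t)) (uy p) p.2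
  hasDeriv_xy : ∀ p ∈ interior triangle, HasDerivAt (fun t => ux (p.1, t)) (uxy p) p.2
  hasDeriv_yx : ∀ p ∈ interior triangle, HasDerivAt (fun s => uy (s, p.2)) (uxy p) p.1
  reg_x : SingularX β ux
  reg_y : SingularX β (uy ∘ Prod.swap)

theorem rpow_neg_mul_cancel {s β : ℝ} (hs : 0 < s) (w : ℂ) :
    ((s ^ (-β) : ℝ) : ℂ) * (((s ^ β : ℝ) : ℂ) * w) = w := by
  rw [← mul_assoc, ← Complex.ofReal_mul, ← Real.rpow_add hs, neg_add_cancel, Real.rpow_zero]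
  simp

theorem SolutionRegular.exists_partialData {n : ℕ} (hn : 2 ≤ n) {β : ℝ} {u : ℝ × ℝ → ℂ}
    (h : SolutionRegular n β u) : ∃ ux uy uxy, PartialData β u ux uy uxy ∧
      ∀ p ∈ interior triangle, ux p = dx u p ∧ uy p = dy u p ∧ uxy p = dy (dx u) p := by
  obtain ⟨hc, hd, ⟨gx, hgx, hgx'⟩, ⟨gy, hgy, hgy'⟩, -⟩ := h
  have hC : ∀ p ∈ interior triangle, ContDiffAt ℝ 2 u p := fun p hp =>
    (hd.contDiffAt (isOpen_interior.mem_nhds hp)).of_le (by exact_mod_cast hn)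
  have hF : ∀ p ∈ interior triangle, HasFDerivAt u (fderiv ℝ u p) p := fun p hp =>
    ((hC p hp).differentiableAt (by norm_num)).hasFDerivAt
  have hX : ∀ (p : ℝ × ℝ), HasDerivAt (fun s : ℝ => (s, p.2)) ((1 : ℝ), (0 : ℝ)) p.1 := fun p =>
    (hasDerivAt_id p.1).prodMk (hasDerivAt_const p.1 p.2)
  have hY : ∀ (p : ℝ × ℝ), HasDerivAt (fun t : ℝ => (p.1, t)) ((0 : ℝ), (1 : ℝ)) p.2 := fun p =>
    (hasDerivAt_const p.2 p.1).prodMk (hasDerivAt_id p.2)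
  have hux : ∀ p ∈ interior triangle,
      HasDerivAt (fun s => u (s, p.2)) (fderiv ℝ u p (1, 0)) p.1 := fun p hp =>
    (hF p hp).comp_hasDerivAt p.1 (hX p)
  have huy : ∀ p ∈ interior triangle,
      HasDerivAt (fun t => u (p.1, t)) (fderiv ℝ u p (0, 1)) p.2 := fun p hp =>
    (hF p hp).comp_hasDerivAt p.2 (hY p)
  have hdx : ∀ p ∈ interior triangle, dx u p = fderiv ℝ u p (1, 0) := fun p hp => (hux p hp).deriv
  have hdy : ∀ p ∈ interior triangle, dy u p = fderiv ℝ u p (0, 1) := fun p hp => (huy p hp).deriv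
  have hFF : ∀ p ∈ interior triangle, HasFDerivAt (fderiv ℝ u) (fderiv ℝ (fderiv ℝ u) p) p :=
    fun p hp => (((hC p hp).fderiv_right (m := 1) (by norm_num)).differentiableAt
      (by norm_num)).hasFDerivAt
  have hxy : ∀ p ∈ interior triangle, HasDerivAt (fun t => fderiv ℝ u (p.1, t) (1, 0))
      (fderiv ℝ (fderiv ℝ u) p (0, 1) (1, 0)) p.2 := fun p hp =>
    ((ContinuousLinearMap.apply ℝ ℂ ((1 : ℝ), (0 : ℝ))).hasFDerivAt.comp_hasDerivAt p.2
      ((hFF p hp).comp_hasDerivAt p.2 (hY p)))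
  have hyx : ∀ p ∈ interior triangle, HasDerivAt (fun s => fderiv ℝ u (s, p.2) (0, 1))
      (fderiv ℝ (fderiv ℝ u) p (1, 0) (0, 1)) p.1 := fun p hp =>
    ((ContinuousLinearMap.apply ℝ ℂ ((0 : ℝ), (1 : ℝ))).hasFDerivAt.comp_hasDerivAt p.1
      ((hFF p hp).comp_hasDerivAt p.1 (hX p)))
  have hnx : ∀ p ∈ interior triangle, ∀ᶠ s in 𝓝 p.1, (s, p.2) ∈ interior triangle := fun p hp =>
    (hX p).continuousAt.eventually_mem (isOpen_interior.mem_nhds hp)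
  have hny : ∀ p ∈ interior triangle, ∀ᶠ t in 𝓝 p.2, (p.1, t) ∈ interior triangle := fun p hp =>
    (hY p).continuousAt.eventually_mem (isOpen_interior.mem_nhds hp)
  have hdxy : ∀ p ∈ interior triangle,
      dy (dx u) p = fderiv ℝ (fderiv ℝ u) p (0, 1) (1, 0) := fun p hp => by
    refine ((hxy p hp).congr_of_eventuallyEq ?_).deriv
    filter_upwards [hny p hp] with t ht using hdx _ ht
  have hgx1 : ∀ p ∈ interior triangle, ((p.1 ^ (-β) : ℝ) : ℂ) * gx p = dx u p := fun p hp => by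
    rw [hgx' hp]; exact rpow_neg_mul_cancel (mem_interior_triangle.1 hp).1 _
  have hgy1 : ∀ p ∈ interior triangle, ((p.2 ^ (-β) : ℝ) : ℂ) * gy p = dy u p := fun p hp => by
    rw [hgy' hp]; exact rpow_neg_mul_cancel (mem_interior_triangle.1 hp).2.1 _
  -- The continuous extensions divided by the powers agree with the partial derivatives inside and
  -- are their values on the edges.
  refine ⟨fun p => (p.1 ^ (-β) : ℝ) * gx p, fun p => (p.2 ^ (-β) : ℝ) * gy p, dy (dx u),
    ⟨hc, ?_, ?_, ?_, ?_, ⟨gx, hgx, fun _ _ _ => rfl⟩, 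
    ⟨gy ∘ Prod.swap, hgy.comp continuous_swap.continuousOn fun p hp => swap_mem_triangle hp,
      fun _ _ _ => rfl⟩⟩, fun p hp => ⟨hgx1 p hp, hgy1 p hp, rfl⟩⟩
  · rintro ⟨s, t⟩ hp hs
    by_cases ht : 0 < t
    · have hi : (s, t) ∈ interior triangle := mem_interior_triangle.2 ⟨hs, ht, hp.2.2⟩
      rw [hgx1 _ hi, hdx _ hi]
      exact hux _ hi
    · obtain rfl : t = 0 := le_antisymm (not_lt.1 ht) hp.2.1
      refine hasDerivAt_edge hc hgx (fun p hp => ?_) ⟨hs, by simpa using hp.2.2⟩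
      rw [hgx1 p hp, hdx p hp]
      exact hux p hp
  · rintro ⟨s, t⟩ hp ht
    by_cases hs : 0 < s
    · have hi : (s, t) ∈ interior triangle := mem_interior_triangle.2 ⟨hs, ht, hp.2.2⟩
      rw [hgy1 _ hi, hdy _ hi]
      exact huy _ hi
    · obtain rfl : s = 0 := le_antisymm (not_lt.1 hs) hp.1
      refine hasDerivAt_edge (u := u ∘ Prod.swap) (g := gy ∘ Prod.swap)
        (hc.comp continuous_swap.continuousOn fun p hp => swap_mem_triangle hp)
        (hgy.comp continuous_swap.continuousOn fun p hp => swap_mem_triangle hp)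
        (fun p hp => ?_) ⟨ht, by simpa using hp.2.2⟩
      have hp' : p.swap ∈ interior triangle := by
        rw [mem_interior_triangle] at hp ⊢
        exact ⟨hp.2.1, hp.1, by rw [Prod.fst_swap, Prod.snd_swap, add_comm]; exact hp.2.2⟩
      have h1 := hgy1 _ hp'
      rw [hdy _ hp'] at h1
      have h2 := huy _ hp'
      rw [← h1] at h2
      exact h2
  · intro p hp
    simp only
    rw [hdxy p hp]
    refine (hxy p hp).congr_of_eventuallyEq ?_
    filter_upwards [hny p hp] with t ht
    rw [hgx1 _ ht, hdx _ ht]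
  · intro p hp
    have hsymm : IsSymmSndFDerivAt ℝ u p := (hC p hp).isSymmSndFDerivAt (by simp)
    simp only
    rw [hdxy p hp, hsymm.eq]
    refine (hyx p hp).congr_of_eventuallyEq ?_
    filter_upwards [hnx p hp] with s hs
    rw [hgy1 _ hs, hdy _ hs]

/-! ### Algebra of the Lax pair -/

/-- The matrix of the Lax pair, with `c` in place of `conj a`. -/
def laxForm (a c p q l : ℂ) : Mat3 :=
  !![c, l * c, p; l * a, a, -(l * p); q, l * q, (a + c) / 2]

/-- The derivative of `laxForm`. -/
def laxFormDeriv (a c p q l a' c' p' q' l' : ℂ) : Mat3 :=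
  !![c', l' * c + l * c', p'; l' * a + l * a', a', -(l' * p + l * p');
    q', l' * q + l * q', (a' + c') / 2]

theorem laxMatrix_eq (a h : ℂ) (f : ℝ) (l : ℂ) : laxMatrix a h f l =
    laxForm a (star a) (Complex.I / (√f : ℂ) * h) (Complex.I / (√f : ℂ) * star h) l := by
  ext i j
  fin_cases i <;> fin_cases j <;> simp [laxMatrix, laxForm] <;> ring

/-- Being affine in the spectral parameter, the matrix has the shape to which
`differentiableOn_transport` applies. -/
theorem laxForm_eq_add_smul (a c p q l : ℂ) : laxForm a c p q l =
    laxForm a c p q 0 + l • (laxForm a c p q 1 - laxForm a c p q 0) := by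
  ext i j
  fin_cases i <;> fin_cases j <;> simp [laxForm]

theorem hasDerivAt_laxForm {a c p q l : ℝ → ℂ} {a' c' p' q' l' : ℂ} {s : ℝ}
    (ha : HasDerivAt a a' s) (hc : HasDerivAt c c' s) (hp : HasDerivAt p p' s)
    (hq : HasDerivAt q q' s) (hl : HasDerivAt l l' s) :
    HasDerivAt (fun s => laxForm (a s) (c s) (p s) (q s) (l s))
      (laxFormDeriv (a s) (c s) (p s) (q s) (l s) a' c' p' q' l') s := by
  refine hasDerivAt_of_entries fun i j => ?_
  fin_cases i <;> fin_cases j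
  · exact hc
  · exact hl.fun_mul hc
  · exact hp
  · exact hl.fun_mul ha
  · exact ha
  · exact (hl.fun_mul hp).fun_neg
  · exact hq
  · exact hl.fun_mul hq
  · exact (ha.fun_add hc).div_const 2

theorem continuousOn_laxForm {X : Type*} [TopologicalSpace X] {a c p q l : X → ℂ} {S : Set X}
    (ha : ContinuousOn a S) (hc : ContinuousOn c S) (hp : ContinuousOn p S)
    (hq : ContinuousOn q S) (hl : ContinuousOn l S) :
    ContinuousOn (fun s => laxForm (a s) (c s) (p s) (q s) (l s)) S := by
  refine continuousOn_of_entries fun i j => ?_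
  fin_cases i <;> fin_cases j <;> simp [laxForm] <;> fun_prop

theorem continuousOn_laxFormDeriv {X : Type*} [TopologicalSpace X]
    {a c p q l a' c' p' q' l' : X → ℂ} {S : Set X}
    (ha : ContinuousOn a S) (hc : ContinuousOn c S) (hp : ContinuousOn p S)
    (hq : ContinuousOn q S) (hl : ContinuousOn l S) (ha' : ContinuousOn a' S)
    (hc' : ContinuousOn c' S) (hp' : ContinuousOn p' S)
    (hq' : ContinuousOn q' S) (hl' : ContinuousOn l' S) :
    ContinuousOn (fun s => laxFormDeriv (a s) (c s) (p s) (q s) (l s) (a' s) (c' s) (p' s) (q' s)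
      (l' s)) S := by
  refine continuousOn_of_entries fun i j => ?_
  fin_cases i <;> fin_cases j <;> simp [laxFormDeriv] <;> fun_prop

theorem norm_laxForm_le {a c p q l : ℂ} {K M : ℝ} (ha : ‖a‖ ≤ K) (hc : ‖c‖ ≤ K) (hp : ‖p‖ ≤ K)
    (hq : ‖q‖ ≤ K) (hl : ‖l‖ ≤ M) : ‖laxForm a c p q l‖ ≤ 3 * ((1 + M) * K) := by
  have hK : 0 ≤ K := (norm_nonneg _).trans ha
  have hM : 0 ≤ M := (norm_nonneg _).trans hl
  have h1 : ∀ {u : ℂ}, ‖u‖ ≤ K → ‖u‖ ≤ (1 + M) * K := fun h => h.trans (by nlinarith)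
  have h2 : ∀ {u : ℂ}, ‖u‖ ≤ K → ‖l * u‖ ≤ (1 + M) * K := fun h =>
    (norm_mul_le_of_le hl h).trans (by nlinarith)
  refine norm_le_of_entries fun i j => ?_
  fin_cases i <;> fin_cases j
  · exact h1 hc
  · exact h2 hc
  · exact h1 hp
  · exact h2 ha
  · exact h1 ha
  · change ‖-(l * p)‖ ≤ _
    rw [norm_neg]; exact h2 hp
  · exact h1 hq
  · exact h2 hq
  · refine h1 (u := (a + c) / 2) ?_
    rw [norm_div]
    have := norm_add_le_of_le ha hc
    simp
    linarith

theorem norm_laxFormDeriv_le {a c p q l a' c' p' q' l' : ℂ} {K K' M : ℝ} (ha : ‖a‖ ≤ K)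
    (hc : ‖c‖ ≤ K) (hp : ‖p‖ ≤ K) (hq : ‖q‖ ≤ K) (hl : ‖l‖ ≤ M) (ha' : ‖a'‖ ≤ K')
    (hc' : ‖c'‖ ≤ K') (hp' : ‖p'‖ ≤ K') (hq' : ‖q'‖ ≤ K') (hl' : ‖l'‖ ≤ M) :
    ‖laxFormDeriv a c p q l a' c' p' q' l'‖ ≤ 3 * (M * K + (1 + M) * K') := by
  have hK : 0 ≤ K := (norm_nonneg _).trans ha
  have hK' : 0 ≤ K' := (norm_nonneg _).trans ha'
  have hM : 0 ≤ M := (norm_nonneg _).trans hl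
  have h1 : ∀ {u : ℂ}, ‖u‖ ≤ K' → ‖u‖ ≤ M * K + (1 + M) * K' := fun h => h.trans (by
    have := mul_nonneg hM hK; have := mul_nonneg hM hK'; nlinarith)
  have h2 : ∀ {u u' : ℂ}, ‖u‖ ≤ K → ‖u'‖ ≤ K' → ‖l' * u + l * u'‖ ≤ M * K + (1 + M) * K' :=
    fun h h' => (norm_add_le_of_le (norm_mul_le_of_le hl' h) (norm_mul_le_of_le hl h')).trans
      (by nlinarith)
  refine norm_le_of_entries fun i j => ?_
  fin_cases i <;> fin_cases j
  · exact h1 hc'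
  · exact h2 hc hc'
  · exact h1 hp'
  · exact h2 ha ha'
  · exact h1 ha'
  · change ‖-(l' * p + l * p')‖ ≤ _
    rw [norm_neg]; exact h2 hp hp'
  · exact h1 hq'
  · exact h2 hq hq'
  · refine h1 (u := (a' + c') / 2) ?_
    rw [norm_div]
    have := norm_add_le_of_le ha' hc'
    simp
    linarith

theorem WeaklySingular.laxForm {a c p q l : ℝ → ℂ} {β C T M : ℝ} (ha : WeaklySingular a β C T)
    (hc : WeaklySingular c β C T) (hp : WeaklySingular p β C T) (hq : WeaklySingular q β C T)
    (hl : ContinuousOn l (Ioo 0 T)) (hM : ∀ s ∈ Ioo 0 T, ‖l s‖ ≤ M) :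
    WeaklySingular (fun s => laxForm (a s) (c s) (p s) (q s) (l s)) β (3 * ((1 + M) * C)) T :=
  ⟨continuousOn_laxForm ha.cont hc.cont hp.cont hq.cont hl, fun s hs =>
    (norm_laxForm_le (ha.bound s hs) (hc.bound s hs) (hp.bound s hs) (hq.bound s hs)
      (hM s hs)).trans_eq (by ring)⟩

/-- The zero curvature condition `U_t + [U, V] = V_s`. -/
theorem laxForm_flat (a b ac bc p q p₂ q₂ w l : ℂ) (hl : l ≠ 0) :
    laxFormDeriv b bc p₂ q₂ (1 / l)
      (w * (a + b) + b * (a - ac) + p₂ * q) (w * (ac + bc) + bc * (ac - a) + q₂ * p)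
      (w * (p₂ + p) + b * p + a * p₂ - p₂ * ((a + ac) / 2))
      (w * (q₂ + q) + bc * q + ac * q₂ - q₂ * ((a + ac) / 2))
      (-((1 / l - l) * w)) =
    laxFormDeriv a ac p q l
      (w * (a + b) + a * (b - bc) + p * q₂) (w * (ac + bc) + ac * (bc - b) + q * p₂)
      (w * (p + p₂) + a * p₂ + b * p - p * ((b + bc) / 2))
      (w * (q + q₂) + ac * q₂ + bc * q - q * ((b + bc) / 2))
      ((1 / l - l) * w) +
    laxForm a ac p q l * laxForm b bc p₂ q₂ (1 / l) -
      laxForm b bc p₂ q₂ (1 / l) * laxForm a ac p q l := by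
  -- The conjugates are independent letters here, so each entry is a rational identity with no
  -- conjugation left.
  ext i j
  fin_cases i <;> fin_cases j <;> simp [laxForm, laxFormDeriv] <;> field_simp <;> ring

/-! ### Derivatives of the coefficients -/

theorem ofReal_fVal (e h : ℂ) : (fVal e h : ℂ) = (e + star e) / 2 - h * star h := by
  rw [fVal]
  push_cast
  congr 1
  · rw [Complex.re_eq_add_conj]; rfl
  · rw [← Complex.mul_conj']; rfl

theorem continuous_fVal : Continuous fun p : ℂ × ℂ => fVal p.1 p.2 := by
  unfold fVal; fun_prop

section

variable {e h : ℝ → ℂ} {e' h' : ℂ} {s : ℝ}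

/-- The logarithmic coefficient attached to the derivatives `e'`, `h'` of two potentials at values
`e`, `h`. -/
def logC (e h e' h' : ℂ) : ℂ := (e' - 2 * star h * h') / (2 * (fVal e h : ℂ))

theorem logC_mul {e h e' h' : ℂ} (hf : 0 < fVal e h) :
    e' = 2 * (fVal e h : ℂ) * logC e h e' h' + 2 * star h * h' := by
  have : (fVal e h : ℂ) ≠ 0 := by exact_mod_cast hf.ne'
  rw [logC]
  field_simp
  ring

/-- Twice the real part of the coefficient is the logarithmic derivative of f. -/
theorem hasDerivAt_ofReal_fVal (he : HasDerivAt e e' s) (hh : HasDerivAt h h' s)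
    (hf : 0 < fVal (e s) (h s)) :
    HasDerivAt (fun s => (fVal (e s) (h s) : ℂ)) ((fVal (e s) (h s) : ℂ) *
      (logC (e s) (h s) e' h' + star (logC (e s) (h s) e' h'))) s := by
  simp only [ofReal_fVal]
  refine (((he.fun_add he.star).div_const 2).fun_sub (hh.fun_mul hh.star)).congr_deriv ?_
  rw [← ofReal_fVal]
  have h1 := logC_mul (e' := e') (h' := h') hf
  have h2 := congrArg star h1
  simp only [star_add, star_mul', star_star, star_ofNat] at h2
  have h3 : star (fVal (e s) (h s) : ℂ) = (fVal (e s) (h s) : ℂ) := Complex.conj_ofReal _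
  rw [h3] at h2
  linear_combination (1 / 2) * h1 + (1 / 2) * h2

theorem hasDerivAt_sqrt_fVal (he : HasDerivAt e e' s) (hh : HasDerivAt h h' s)
    (hf : 0 < fVal (e s) (h s)) :
    HasDerivAt (fun s => (√(fVal (e s) (h s)) : ℂ)) ((√(fVal (e s) (h s)) : ℂ) *
      ((logC (e s) (h s) e' h' + star (logC (e s) (h s) e' h')) / 2)) s := by
  set f := fVal (e s) (h s) with hfdef
  set b := logC (e s) (h s) e' h' with hb
  have h1 := Complex.reCLM.hasFDerivAt.comp_hasDerivAt s (hasDerivAt_ofReal_fVal he hh hf)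
  have h2 : HasDerivAt (fun s => fVal (e s) (h s)) (f * (2 * b.re)) s := by
    refine h1.congr_deriv ?_
    have : (f : ℂ) * (b + star b) = ((f * (2 * b.re) : ℝ) : ℂ) := by
      have : b + star b = ((2 * b.re : ℝ) : ℂ) := Complex.add_conj b
      rw [this]; push_cast; ring
    rw [← hfdef, ← hb, this]
    rfl
  have h3 := (h2.sqrt hf.ne').ofReal_comp
  refine h3.congr_deriv ?_
  have h4 : b + star b = ((2 * b.re : ℝ) : ℂ) := Complex.add_conj b
  have h5 : (√f : ℝ) ≠ 0 := (Real.sqrt_pos.2 hf).ne'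
  have h6 : f * (2 * b.re) / (2 * √f) = √f * (2 * b.re / 2) := by
    rw [div_eq_iff (by positivity)]
    linear_combination (-2 * b.re) * Real.mul_self_sqrt hf.le
  rw [h4, ← hfdef, h6]
  push_cast
  ring

end

/-- The relations between the derivatives of two potentials that make up the Ernst–Maxwell
equations, at one point, in terms of the coefficients of the Lax pair. -/
theorem ernstMaxwell_coeff {e h ex ey exy hx hy hxy w : ℂ} (hf : 0 < fVal e h)
    (hE : (fVal e h : ℂ) * (exy - w * (ex + ey)) = ex * ey - star h * (ex * hy + ey * hx))
    (hH : (fVal e h : ℂ) * (hxy - w * (hx + hy)) =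
      1 / 2 * (ex * hy + ey * hx) - 2 * star h * hx * hy) :
    hxy = w * (hx + hy) + logC e h ex hx * hy + logC e h ey hy * hx ∧
    exy = 2 * star h * hxy + 2 * (fVal e h : ℂ) *
      (w * (logC e h ex hx + logC e h ey hy) + 2 * logC e h ex hx * logC e h ey hy) := by
  have hF : (fVal e h : ℂ) ≠ 0 := by exact_mod_cast hf.ne'
  have h1 := logC_mul (e' := ex) (h' := hx) hf
  have h2 := logC_mul (e' := ey) (h' := hy) hf
  set A := logC e h ex hx
  set B := logC e h ey hy
  set F := (fVal e h : ℂ)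
  have h3 : hxy = w * (hx + hy) + A * hy + B * hx := by
    apply mul_left_cancel₀ hF
    rw [h1, h2] at hH
    linear_combination hH
  refine ⟨h3, ?_⟩
  apply mul_left_cancel₀ hF
  rw [h1, h2] at hE
  rw [h3]
  linear_combination hE

section

variable {e h ex hx : ℝ → ℂ} {ey hy exy hxy w : ℂ} {s : ℝ}

/-- The first equation supplies the mixed derivative of E. Differentiating 1/f turns 2AB into A(B -
conj B), and differentiating conj H in the numerator leaves -H_x conj(H_y)/f, which is the product
of the two off-diagonal coefficients. -/
theorem hasDerivAt_logC (he : HasDerivAt e ey s) (hh : HasDerivAt h hy s)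
    (hex : HasDerivAt ex exy s) (hhx : HasDerivAt hx hxy s) (hf : 0 < fVal (e s) (h s))
    (hE : (fVal (e s) (h s) : ℂ) * (exy - w * (ex s + ey)) =
      ex s * ey - star (h s) * (ex s * hy + ey * hx s))
    (hH : (fVal (e s) (h s) : ℂ) * (hxy - w * (hx s + hy)) =
      1 / 2 * (ex s * hy + ey * hx s) - 2 * star (h s) * hx s * hy) :
    HasDerivAt (fun s => logC (e s) (h s) (ex s) (hx s))
      (w * (logC (e s) (h s) (ex s) (hx s) + logC (e s) (h s) ey hy) +
        logC (e s) (h s) (ex s) (hx s) *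
          (logC (e s) (h s) ey hy - star (logC (e s) (h s) ey hy)) +
        Complex.I / (√(fVal (e s) (h s)) : ℂ) * hx s *
          (Complex.I / (√(fVal (e s) (h s)) : ℂ) * star hy)) s := by
  have hF : (fVal (e s) (h s) : ℂ) ≠ 0 := by exact_mod_cast hf.ne'
  have hr : (√(fVal (e s) (h s)) : ℂ) ≠ 0 := by exact_mod_cast (Real.sqrt_pos.2 hf).ne'
  have hr2 : (√(fVal (e s) (h s)) : ℂ) ^ 2 = (fVal (e s) (h s) : ℂ) := by
    exact_mod_cast Real.sq_sqrt hf.le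
  obtain ⟨-, h4⟩ := ernstMaxwell_coeff hf hE hH
  have h1 := logC_mul (e' := ex s) (h' := hx s) hf
  have h5 := (hex.fun_sub ((hh.star.const_mul 2).fun_mul hhx)).fun_div
    ((hasDerivAt_ofReal_fVal he hh hf).const_mul 2) (mul_ne_zero two_ne_zero hF)
  refine h5.congr_deriv ?_
  rw [h4]
  have h6 : ex s - 2 * star (h s) * hx s =
      2 * (fVal (e s) (h s) : ℂ) * logC (e s) (h s) (ex s) (hx s) := by linear_combination h1
  rw [h6]
  have h7 : Complex.I / (√(fVal (e s) (h s)) : ℂ) * hx s *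
      (Complex.I / (√(fVal (e s) (h s)) : ℂ) * star hy) =
      -(hx s * star hy) / (fVal (e s) (h s) : ℂ) := by
    rw [← hr2]
    field_simp
    rw [Complex.I_sq]
    ring
  rw [h7]
  field_simp
  ring

theorem hasDerivAt_div_sqrt (he : HasDerivAt e ey s) (hh : HasDerivAt h hy s)
    (hhx : HasDerivAt hx hxy s) (hf : 0 < fVal (e s) (h s)) :
    HasDerivAt (fun s => Complex.I / (√(fVal (e s) (h s)) : ℂ) * hx s)
      (Complex.I / (√(fVal (e s) (h s)) : ℂ) * hxy - Complex.I / (√(fVal (e s) (h s)) : ℂ) * hx s *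
        ((logC (e s) (h s) ey hy + star (logC (e s) (h s) ey hy)) / 2)) s := by
  have hr : (√(fVal (e s) (h s)) : ℂ) ≠ 0 := by exact_mod_cast (Real.sqrt_pos.2 hf).ne'
  have := ((hasDerivAt_const s Complex.I).fun_div (hasDerivAt_sqrt_fVal he hh hf) hr).fun_mul hhx
  refine this.congr_deriv ?_
  field_simp
  ring

end

/-! ### Functions with a weak singularity at the edge of the triangle -/

namespace SingularX

variable {β : ℝ} {u v : ℝ × ℝ → ℂ}

theorem continuousOn (h : SingularX β u) : ContinuousOn u {p ∈ triangle | 0 < p.1} := by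
  obtain ⟨g, hg, hu⟩ := h
  refine ContinuousOn.congr (f := fun p : ℝ × ℝ => ((p.1 ^ (-β) : ℝ) : ℂ) * g p) ?_
    fun p hp => hu p hp.1 hp.2
  refine ContinuousOn.mul ?_ (hg.mono fun p hp => hp.1)
  refine Complex.continuous_ofReal.comp_continuousOn ?_
  exact continuousOn_fst.rpow_const fun p hp => Or.inl hp.2.ne'

theorem mul_left (h : SingularX β u) {c : ℝ × ℝ → ℂ} (hc : ContinuousOn c triangle) :
    SingularX β (fun p => c p * u p) := by
  obtain ⟨g, hg, hu⟩ := h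
  exact ⟨fun p => c p * g p, hc.mul hg, fun p hp hp' => by simp only [hu p hp hp']; ring⟩

theorem sub (h : SingularX β u) (h' : SingularX β v) : SingularX β (fun p => u p - v p) := by
  obtain ⟨g, hg, hu⟩ := h
  obtain ⟨k, hk, hv⟩ := h'
  exact ⟨fun p => g p - k p, hg.sub hk, fun p hp hp' => by simp only [hu p hp hp', hv p hp hp']; ring⟩

theorem star (h : SingularX β u) : SingularX β (fun p => Star.star (u p)) := by
  obtain ⟨g, hg, hu⟩ := h
  refine ⟨fun p => Star.star (g p), continuous_star.comp_continuousOn hg, fun p hp hp' => ?_⟩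
  simp only [hu p hp hp', star_mul']
  congr 1
  exact Complex.conj_ofReal _

/-- Eventually all sufficiently large constants bound a singular function on a rectangle. -/
theorem eventually_bound (h : SingularX β u) {X Y : ℝ} (hXY : X + Y < 1) : ∀ᶠ C in atTop,
    ∀ s ∈ Ioc 0 X, ∀ t ∈ Icc 0 Y, ‖u (s, t)‖ ≤ C * s ^ (-β) := by
  obtain ⟨g, hg, hu⟩ := h
  have hsub : Icc 0 X ×ˢ Icc 0 Y ⊆ triangle := fun p hp =>
    ⟨hp.1.1, hp.2.1, by linarith [hp.1.2, hp.2.2]⟩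
  obtain ⟨C, hC⟩ := (isCompact_Icc.prod isCompact_Icc).exists_bound_of_continuousOn (hg.mono hsub)
  filter_upwards [eventually_ge_atTop C] with C' hC' s hs t ht
  have hm : (s, t) ∈ Icc 0 X ×ˢ Icc 0 Y := ⟨⟨hs.1.le, hs.2⟩, ht⟩
  have h1 := Real.rpow_nonneg hs.1.le (-β)
  rw [hu _ (hsub hm) hs.1, norm_mul, Complex.norm_real, Real.norm_of_nonneg h1, mul_comm]
  gcongr
  exact (hC _ hm).trans hC'

end SingularX

theorem swap_mem_interior {p : ℝ × ℝ} (hp : p ∈ interior triangle) :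
    p.swap ∈ interior triangle := by
  rw [mem_interior_triangle] at hp ⊢
  exact ⟨hp.2.1, hp.1, by rw [Prod.fst_swap, Prod.snd_swap, add_comm]; exact hp.2.2⟩

theorem PartialData.swap {β : ℝ} {u ux uy uxy : ℝ × ℝ → ℂ} (h : PartialData β u ux uy uxy) :
    PartialData β (u ∘ Prod.swap) (uy ∘ Prod.swap) (ux ∘ Prod.swap) (uxy ∘ Prod.swap) where
  cont := h.cont.comp continuous_swap.continuousOn fun _ hp => swap_mem_triangle hp
  hasDeriv_x p hp hp' := h.hasDeriv_y p.swap (swap_mem_triangle hp) hp'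
  hasDeriv_y p hp hp' := h.hasDeriv_x p.swap (swap_mem_triangle hp) hp'
  hasDeriv_xy p hp := h.hasDeriv_yx p.swap (swap_mem_interior hp)
  hasDeriv_yx p hp := h.hasDeriv_xy p.swap (swap_mem_interior hp)
  reg_x := h.reg_y
  reg_y := h.reg_x

/-! ### Potentials and the coefficients of their Lax pair -/

/-- Two potentials with their partial derivatives. -/
structure Potentials where
  E : ℝ × ℝ → ℂ
  Ex : ℝ × ℝ → ℂ
  Ey : ℝ × ℝ → ℂ
  Exy : ℝ × ℝ → ℂ
  H : ℝ × ℝ → ℂ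
  Hx : ℝ × ℝ → ℂ
  Hy : ℝ × ℝ → ℂ
  Hxy : ℝ × ℝ → ℂ

namespace Potentials

/-- Exchange of the two variables. -/
def swap (P : Potentials) : Potentials where
  E := P.E ∘ Prod.swap
  Ex := P.Ey ∘ Prod.swap
  Ey := P.Ex ∘ Prod.swap
  Exy := P.Exy ∘ Prod.swap
  H := P.H ∘ Prod.swap
  Hx := P.Hy ∘ Prod.swap
  Hy := P.Hx ∘ Prod.swap
  Hxy := P.Hxy ∘ Prod.swap

/-- The function `Re E - |H|²`. -/
def f (P : Potentials) (p : ℝ × ℝ) : ℝ := fVal (P.E p) (P.H p)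

/-- The coefficient `A`. -/
def A (P : Potentials) (p : ℝ × ℝ) : ℂ := logC (P.E p) (P.H p) (P.Ex p) (P.Hx p)

/-- The coefficient `i f^(-1/2) H_x`. -/
def p (P : Potentials) (p : ℝ × ℝ) : ℂ := Complex.I / (√(P.f p) : ℂ) * P.Hx p

/-- The coefficient `i f^(-1/2) conj H_x`. -/
def q (P : Potentials) (p : ℝ × ℝ) : ℂ := Complex.I / (√(P.f p) : ℂ) * star (P.Hx p)

/-- The first matrix of the Lax pair. -/
def lax (P : Potentials) (p : ℝ × ℝ) (l : ℂ) : Mat3 := laxForm (P.A p) (star (P.A p)) (P.p p) (P.q p) l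

/-- The potentials solve the Ernst–Maxwell equations. -/
structure IsSolution (P : Potentials) (β : ℝ) : Prop where
  nonneg : 0 ≤ β
  lt_one : β < 1
  partialE : PartialData β P.E P.Ex P.Ey P.Exy
  partialH : PartialData β P.H P.Hx P.Hy P.Hxy
  pos : ∀ p ∈ triangle, 0 < P.f p
  eqE : ∀ p ∈ interior triangle, (P.f p : ℂ) *
    (P.Exy p - 1 / (2 * (1 - (p.1 : ℂ) - (p.2 : ℂ))) * (P.Ex p + P.Ey p)) =
      P.Ex p * P.Ey p - star (P.H p) * (P.Ex p * P.Hy p + P.Ey p * P.Hx p)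
  eqH : ∀ p ∈ interior triangle, (P.f p : ℂ) *
    (P.Hxy p - 1 / (2 * (1 - (p.1 : ℂ) - (p.2 : ℂ))) * (P.Hx p + P.Hy p)) =
      1 / 2 * (P.Ex p * P.Hy p + P.Ey p * P.Hx p) - 2 * star (P.H p) * P.Hx p * P.Hy p

variable {P : Potentials} {β : ℝ}

namespace IsSolution

/-- The equations are symmetric in the two variables, so V at (s,t) is the first Lax matrix of the
exchanged potentials at (t,s). Everything about V is obtained in this way. -/
theorem swap (h : P.IsSolution β) : P.swap.IsSolution β where
  nonneg := h.nonneg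
  lt_one := h.lt_one
  partialE := h.partialE.swap
  partialH := h.partialH.swap
  pos p hp := h.pos p.swap (swap_mem_triangle hp)
  eqE p hp := by
    have := h.eqE p.swap (swap_mem_interior hp)
    simp only [Prod.fst_swap, Prod.snd_swap] at this
    rw [sub_right_comm] at this
    simp only [Potentials.swap, Function.comp_apply]
    refine Eq.trans ?_ (this.trans (by ring))
    rw [add_comm (P.Ex p.swap)]
    rfl
  eqH p hp := by
    have := h.eqH p.swap (swap_mem_interior hp)
    simp only [Prod.fst_swap, Prod.snd_swap] at this
    rw [sub_right_comm] at this
    simp only [Potentials.swap, Function.comp_apply]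
    refine Eq.trans ?_ (this.trans (by ring))
    rw [add_comm (P.Hx p.swap)]
    rfl

theorem continuousOn_f (h : P.IsSolution β) : ContinuousOn P.f triangle :=
  continuous_fVal.comp_continuousOn (h.partialE.cont.prodMk h.partialH.cont)

theorem continuousOn_sqrt (h : P.IsSolution β) :
    ContinuousOn (fun p => Complex.I / (√(P.f p) : ℂ)) triangle := by
  refine continuousOn_const.div (Complex.continuous_ofReal.comp_continuousOn h.continuousOn_f.sqrt) ?_
  intro p hp
  exact_mod_cast (Real.sqrt_pos.2 (h.pos p hp)).ne'

theorem singular_A (h : P.IsSolution β) : SingularX β P.A := by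
  have h1 := (h.partialE.reg_x.sub (h.partialH.reg_x.mul_left
    (c := fun p => 2 * star (P.H p)) (continuousOn_const.mul
      (continuous_star.comp_continuousOn h.partialH.cont)))).mul_left
    (c := fun p => (2 * (P.f p : ℂ))⁻¹) ?_
  · refine (congrArg (SingularX β) (funext fun p => ?_)).mp h1
    rw [A, logC, div_eq_inv_mul]
    rfl
  · refine ContinuousOn.inv₀ (continuousOn_const.mul
      (Complex.continuous_ofReal.comp_continuousOn h.continuousOn_f)) fun p hp => ?_
    have := (h.pos p hp).ne'
    exact mul_ne_zero two_ne_zero (by exact_mod_cast this)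

theorem singular_p (h : P.IsSolution β) : SingularX β P.p :=
  h.partialH.reg_x.mul_left h.continuousOn_sqrt

theorem singular_q (h : P.IsSolution β) : SingularX β P.q :=
  h.partialH.reg_x.star.mul_left h.continuousOn_sqrt

end IsSolution

theorem star_I_div_sqrt (r : ℝ) : star (Complex.I / (√r : ℂ)) = -(Complex.I / (√r : ℂ)) := by
  change (starRingEnd ℂ) _ = _
  rw [map_div₀, Complex.conj_I, Complex.conj_ofReal, neg_div]

theorem star_one_div_two_mul (s t : ℝ) :
    star (1 / (2 * (1 - (s : ℂ) - (t : ℂ)))) = 1 / (2 * (1 - (s : ℂ) - (t : ℂ))) := by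
  have : (1 / (2 * (1 - (s : ℂ) - (t : ℂ)))) = ((1 / (2 * (1 - s - t)) : ℝ) : ℂ) := by push_cast; rfl
  rw [this]
  exact Complex.conj_ofReal _

theorem star_p (P : Potentials) (x : ℝ × ℝ) : star (P.p x) = -P.q x := by
  rw [p, q, star_mul', star_I_div_sqrt, neg_mul]

theorem star_q (P : Potentials) (x : ℝ × ℝ) : star (P.q x) = -P.p x := by
  rw [p, q, star_mul', star_I_div_sqrt, star_star, neg_mul]

section

variable (h : P.IsSolution β) {s t : ℝ} (hp : (s, t) ∈ interior triangle)
include h hp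

theorem IsSolution.hasDerivAt_A : HasDerivAt (fun t => P.A (s, t))
    (1 / (2 * (1 - (s : ℂ) - (t : ℂ))) * (P.A (s, t) + P.swap.A (t, s)) +
      P.A (s, t) * (P.swap.A (t, s) - star (P.swap.A (t, s))) + P.p (s, t) * P.swap.q (t, s)) t :=
  hasDerivAt_logC (h.partialE.hasDeriv_y _ (interior_subset hp) (mem_interior_triangle.1 hp).2.1)
    (h.partialH.hasDeriv_y _ (interior_subset hp) (mem_interior_triangle.1 hp).2.1)
    (h.partialE.hasDeriv_xy _ hp) (h.partialH.hasDeriv_xy _ hp) (h.pos _ (interior_subset hp))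
    (h.eqE _ hp) (h.eqH _ hp)

theorem IsSolution.hasDerivAt_p : HasDerivAt (fun t => P.p (s, t))
    (1 / (2 * (1 - (s : ℂ) - (t : ℂ))) * (P.p (s, t) + P.swap.p (t, s)) +
      P.A (s, t) * P.swap.p (t, s) + P.swap.A (t, s) * P.p (s, t) -
      P.p (s, t) * ((P.swap.A (t, s) + star (P.swap.A (t, s))) / 2)) t := by
  have h1 := hasDerivAt_div_sqrt
    (h.partialE.hasDeriv_y _ (interior_subset hp) (mem_interior_triangle.1 hp).2.1)
    (h.partialH.hasDeriv_y _ (interior_subset hp) (mem_interior_triangle.1 hp).2.1)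
    (h.partialH.hasDeriv_xy _ hp) (h.pos _ (interior_subset hp))
  refine h1.congr_deriv ?_
  have h2 := (ernstMaxwell_coeff (h.pos _ (interior_subset hp)) (h.eqE _ hp) (h.eqH _ hp)).1
  rw [h2]
  simp only [A, p, f, Potentials.swap, Function.comp_apply, Prod.swap_prod_mk]
  ring

/-- q = -conj p, so this is the conjugate of the formula for p; the weight 1/(2(1-s-t)) is real. -/
theorem IsSolution.hasDerivAt_q : HasDerivAt (fun t => P.q (s, t))
    (1 / (2 * (1 - (s : ℂ) - (t : ℂ))) * (P.q (s, t) + P.swap.q (t, s)) +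
      star (P.A (s, t)) * P.swap.q (t, s) + star (P.swap.A (t, s)) * P.q (s, t) -
      P.q (s, t) * ((P.swap.A (t, s) + star (P.swap.A (t, s))) / 2)) t := by
  have h1 := (h.hasDerivAt_p hp).star.fun_neg
  have h2 : (fun t => -star (P.p (s, t))) = fun t => P.q (s, t) := by
    funext t; rw [star_p, neg_neg]
  rw [h2] at h1
  refine h1.congr_deriv ?_
  have hw := star_one_div_two_mul s t
  simp only [star_add, star_sub, star_mul', star_p, star_star, hw, star_div₀, star_ofNat]
  ring

theorem IsSolution.hasDerivAt_star_A : HasDerivAt (fun t => star (P.A (s, t)))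
    (1 / (2 * (1 - (s : ℂ) - (t : ℂ))) * (star (P.A (s, t)) + star (P.swap.A (t, s))) +
      star (P.A (s, t)) * (star (P.swap.A (t, s)) - P.swap.A (t, s)) +
      P.q (s, t) * P.swap.p (t, s)) t := by
  refine (h.hasDerivAt_A hp).star.congr_deriv ?_
  have hw := star_one_div_two_mul s t
  simp only [star_add, star_sub, star_mul', star_p, star_q, star_star, hw]
  ring

end

/-- The partial derivative with respect to `y` of the first matrix of the Lax pair, if the spectral
function has the value `l` and the derivative `l'`. -/
def laxDeriv (P : Potentials) (s t : ℝ) (l l' : ℂ) : Mat3 :=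
  laxFormDeriv (P.A (s, t)) (star (P.A (s, t))) (P.p (s, t)) (P.q (s, t)) l
    (1 / (2 * (1 - (s : ℂ) - (t : ℂ))) * (P.A (s, t) + P.swap.A (t, s)) +
      P.A (s, t) * (P.swap.A (t, s) - star (P.swap.A (t, s))) + P.p (s, t) * P.swap.q (t, s))
    (1 / (2 * (1 - (s : ℂ) - (t : ℂ))) * (star (P.A (s, t)) + star (P.swap.A (t, s))) +
      star (P.A (s, t)) * (star (P.swap.A (t, s)) - P.swap.A (t, s)) +
      P.q (s, t) * P.swap.p (t, s))
    (1 / (2 * (1 - (s : ℂ) - (t : ℂ))) * (P.p (s, t) + P.swap.p (t, s)) +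
      P.A (s, t) * P.swap.p (t, s) + P.swap.A (t, s) * P.p (s, t) -
      P.p (s, t) * ((P.swap.A (t, s) + star (P.swap.A (t, s))) / 2))
    (1 / (2 * (1 - (s : ℂ) - (t : ℂ))) * (P.q (s, t) + P.swap.q (t, s)) +
      star (P.A (s, t)) * P.swap.q (t, s) + star (P.swap.A (t, s)) * P.q (s, t) -
      P.q (s, t) * ((P.swap.A (t, s) + star (P.swap.A (t, s))) / 2)) l'

theorem IsSolution.hasDerivAt_lax (h : P.IsSolution β) {s t : ℝ} (hp : (s, t) ∈ interior triangle)
    {l : ℝ → ℂ} {l' : ℂ} (hl : HasDerivAt l l' t) :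
    HasDerivAt (fun t => P.lax (s, t) (l t)) (P.laxDeriv s t (l t) l') t :=
  hasDerivAt_laxForm (h.hasDerivAt_A hp) (h.hasDerivAt_star_A hp) (h.hasDerivAt_p hp)
    (h.hasDerivAt_q hp) hl

/-- The zero curvature condition. -/
theorem laxDeriv_swap (P : Potentials) (s t : ℝ) {l : ℂ} (hl : l ≠ 0) :
    P.swap.laxDeriv t s (1 / l) (-((1 / l - l) * (1 / (2 * (1 - (s : ℂ) - (t : ℂ)))))) =
      P.laxDeriv s t l ((1 / l - l) * (1 / (2 * (1 - (s : ℂ) - (t : ℂ))))) +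
        P.lax (s, t) l * P.swap.lax (t, s) (1 / l) - P.swap.lax (t, s) (1 / l) * P.lax (s, t) l := by
  have hs : P.swap.swap = P := rfl
  have h := laxForm_flat (P.A (s, t)) (P.swap.A (t, s)) (star (P.A (s, t)))
    (star (P.swap.A (t, s))) (P.p (s, t)) (P.q (s, t)) (P.swap.p (t, s)) (P.swap.q (t, s))
    (1 / (2 * (1 - (s : ℂ) - (t : ℂ)))) l hl
  rw [lax, lax, laxDeriv, laxDeriv, hs, ← h, sub_right_comm (1 : ℂ) (t : ℂ) (s : ℂ)]
  rw [add_comm (P.swap.A (t, s)) (P.A (s, t)), add_comm (star (P.swap.A (t, s))) (star (P.A (s, t)))]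

end Potentials

/-! ### Zero curvature for a solution and independence of the path. -/

section

variable {x y s t : ℝ} {z : ℂ} (hx : 0 ≤ x) (hy : 0 ≤ y) (hxy : x + y < 1)
  (hz0 : z ∉ sigma0 x y) (hz1 : z ∉ sigma1 x y)
include hx hy hxy hz0 hz1

theorem continuousOn_lamFun :
    ContinuousOn (fun p : ℝ × ℝ => lamFun x y p.1 p.2 z) (Icc 0 x ×ˢ Icc 0 y) := by
  have hyx : y + x < 1 := by linarith
  have hz1' := mem_sigma1_iff.not.1 hz1
  refine ContinuousOn.div ?_ ?_ fun _ hp => specRoot_ne_zero hy hyx hz1' hp.2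
  · exact (continuousOn_specLam hx hxy).comp (f := fun p : ℝ × ℝ => (p.1, z)) (by fun_prop)
      fun p hp => ⟨hp.1, hz0⟩
  · exact (continuousOn_specRoot hy hyx).comp (f := fun p : ℝ × ℝ => (p.2, -z)) (by fun_prop)
      fun p hp => ⟨hp.2, hz1'⟩

theorem continuousOn_one_div_lamFun :
    ContinuousOn (fun p : ℝ × ℝ => 1 / lamFun x y p.1 p.2 z) (Icc 0 x ×ˢ Icc 0 y) :=
  continuousOn_const.div (continuousOn_lamFun hx hy hxy hz0 hz1) fun _ hp =>
    lamFun_ne_zero hx hy hxy hz0 hz1 hp.1 hp.2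

theorem hasDerivAt_one_div_lamFun (hs : s ∈ Icc 0 x) (ht : t ∈ Icc 0 y) :
    HasDerivAt (fun s => 1 / lamFun x y s t z)
      (-((1 / lamFun x y s t z - lamFun x y s t z) * (1 / (2 * (1 - (s : ℂ) - (t : ℂ)))))) s := by
  have h0 := lamFun_ne_zero hx hy hxy hz0 hz1 hs ht
  refine ((hasDerivAt_const s (1 : ℂ)).fun_div (hasDerivAt_lamFun_left hx hy hxy hz0 hz1 hs ht)
    h0).congr_deriv ?_
  field_simp
  ring

end

theorem norm_mul_le_of_singular {a b : ℂ} {C u v : ℝ} (hu : 0 ≤ C * u) (ha : ‖a‖ ≤ C * u)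
    (hb : ‖b‖ ≤ C * v) : ‖a * b‖ ≤ C ^ 2 * (u * v) :=
  (norm_mul_le _ _).trans ((mul_le_mul ha hb (norm_nonneg _) hu).trans_eq (by ring))

namespace Potentials

variable {P : Potentials} {β : ℝ}

/-- A common bound for the coefficients of the Lax pair on a rectangle. -/
structure Bound (P : Potentials) (β C X Y : ℝ) : Prop where
  A : ∀ s ∈ Ioc 0 X, ∀ t ∈ Icc 0 Y, ‖P.A (s, t)‖ ≤ C * s ^ (-β)
  p : ∀ s ∈ Ioc 0 X, ∀ t ∈ Icc 0 Y, ‖P.p (s, t)‖ ≤ C * s ^ (-β)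
  q : ∀ s ∈ Ioc 0 X, ∀ t ∈ Icc 0 Y, ‖P.q (s, t)‖ ≤ C * s ^ (-β)

theorem IsSolution.eventually_bound (h : P.IsSolution β) {X Y : ℝ} (hXY : X + Y < 1) :
    ∀ᶠ C in atTop, P.Bound β C X Y := by
  filter_upwards [h.singular_A.eventually_bound hXY, h.singular_p.eventually_bound hXY,
    h.singular_q.eventually_bound hXY] with C h1 h2 h3 using ⟨h1, h2, h3⟩

/-- Bounds holding for all large constants can be combined, so one C serves both potentials and
their exchange. -/
theorem IsSolution.exists_bound (h : P.IsSolution β) {X Y : ℝ} (hXY : X + Y < 1) :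
    ∃ C, 0 ≤ C ∧ P.Bound β C X Y ∧ P.swap.Bound β C Y X :=
  ((eventually_ge_atTop 0).and ((h.eventually_bound hXY).and
    (h.swap.eventually_bound (by linarith)))).exists

theorem IsSolution.weaklySingular_lax (h : P.IsSolution β) {X Y C M t : ℝ} (hXY : X + Y < 1)
    (hC : P.Bound β C X Y) (ht : t ∈ Icc 0 Y) {l : ℝ → ℂ} (hl : ContinuousOn l (Ioo 0 X))
    (hM : ∀ s ∈ Ioo 0 X, ‖l s‖ ≤ M) :
    WeaklySingular (fun s => P.lax (s, t) (l s)) β (3 * ((1 + M) * C)) X := by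
  have hm : MapsTo (fun s : ℝ => (s, t)) (Ioo 0 X) {p ∈ triangle | 0 < p.1} := fun s hs =>
    ⟨⟨hs.1.le, ht.1, by have := hs.2; have := ht.2; simp only; linarith⟩, hs.1⟩
  have hc : Continuous fun s : ℝ => (s, t) := by fun_prop
  have hA := h.singular_A.continuousOn.comp hc.continuousOn hm
  refine WeaklySingular.laxForm ⟨hA, fun s hs => ?_⟩
    ⟨continuous_star.comp_continuousOn hA, fun s hs => ?_⟩
    ⟨h.singular_p.continuousOn.comp hc.continuousOn hm, fun s hs => ?_⟩
    ⟨h.singular_q.continuousOn.comp hc.continuousOn hm, fun s hs => ?_⟩ hl hM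
  · exact hC.A s ⟨hs.1, hs.2.le⟩ t ht
  · exact (norm_star _).trans_le (hC.A s ⟨hs.1, hs.2.le⟩ t ht)
  · exact hC.p s ⟨hs.1, hs.2.le⟩ t ht
  · exact hC.q s ⟨hs.1, hs.2.le⟩ t ht

theorem IsSolution.continuousOn_lax (h : P.IsSolution β) {X : Type*} [TopologicalSpace X]
    {S : Set X} {φ : X → ℝ × ℝ} {l : X → ℂ} (hφ : ContinuousOn φ S)
    (hm : ∀ a ∈ S, φ a ∈ triangle ∧ 0 < (φ a).1) (hl : ContinuousOn l S) :
    ContinuousOn (fun a => P.lax (φ a) (l a)) S :=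
  continuousOn_laxForm (h.singular_A.continuousOn.comp hφ hm)
    (continuous_star.comp_continuousOn (h.singular_A.continuousOn.comp hφ hm))
    (h.singular_p.continuousOn.comp hφ hm) (h.singular_q.continuousOn.comp hφ hm) hl

/-- By the equations every term contains at most one coefficient of U, of size s^(-β), and at most
one of V up to bounded sums, of size t^(-β). A missing factor costs nothing, as both powers are at
least 1. The result is integrable in each variable separately. -/
theorem IsSolution.norm_laxDeriv_le {s t C W M X Y : ℝ} (h : P.IsSolution β) (hXY : X + Y < 1)
    (hC0 : 0 ≤ C) (hC : P.Bound β C X Y) (hC' : P.swap.Bound β C Y X) (hs : s ∈ Ioo 0 X)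
    (ht : t ∈ Ioo 0 Y) (hW : ‖1 / (2 * (1 - (s : ℂ) - (t : ℂ)))‖ ≤ W) {l l' : ℂ} (hl : ‖l‖ ≤ M)
    (hl' : ‖l'‖ ≤ M) : ‖P.laxDeriv s t l l'‖ ≤
      3 * (M * C + (1 + M) * (2 * W * C + 3 * C ^ 2)) * s ^ (-β) * t ^ (-β) := by
  set u := s ^ (-β) with hu
  set v := t ^ (-β) with hv
  set w := 1 / (2 * (1 - (s : ℂ) - (t : ℂ))) with hw
  have hW0 : 0 ≤ W := (norm_nonneg _).trans hW
  have hu1 : 1 ≤ u := by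
    have := Real.rpow_le_rpow_of_exponent_ge hs.1 (by linarith [hs.2, ht.1, ht.2] : s ≤ 1)
      (neg_nonpos.2 h.nonneg)
    rwa [Real.rpow_zero] at this
  have hv1 : 1 ≤ v := by
    have := Real.rpow_le_rpow_of_exponent_ge ht.1 (by linarith [ht.2, hs.1, hs.2] : t ≤ 1)
      (neg_nonpos.2 h.nonneg)
    rwa [Real.rpow_zero] at this
  have hs' : s ∈ Ioc 0 X := ⟨hs.1, hs.2.le⟩
  have ht' : t ∈ Ioc 0 Y := ⟨ht.1, ht.2.le⟩
  have hs'' : s ∈ Icc 0 X := ⟨hs.1.le, hs.2.le⟩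
  have ht'' : t ∈ Icc 0 Y := ⟨ht.1.le, ht.2.le⟩
  have a1 := hC.A s hs' t ht''
  have p1 := hC.p s hs' t ht''
  have q1 := hC.q s hs' t ht''
  have a2 := hC'.A t ht' s hs''
  have p2 := hC'.p t ht' s hs''
  have q2 := hC'.q t ht' s hs''
  have c1 : ‖star (P.A (s, t))‖ ≤ C * u := (norm_star _).trans_le a1
  have c2 : ‖star (P.swap.A (t, s))‖ ≤ C * v := (norm_star _).trans_le a2
  have hCu : 0 ≤ C * u := mul_nonneg hC0 (by linarith)
  have hCv : 0 ≤ C * v := mul_nonneg hC0 (by linarith)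
  have huv : C * u ≤ C * (u * v) := by gcongr; nlinarith
  have hvv : C * v ≤ C * (u * v) := by gcongr; nlinarith
  have sum : ∀ {a b : ℂ}, ‖a‖ ≤ C * u → ‖b‖ ≤ C * v → ‖w * (a + b)‖ ≤ 2 * W * C * (u * v) := by
    intro a b ha hb
    refine (norm_mul_le_of_le hW ((norm_add_le_of_le ha hb).trans (add_le_add huv hvv))).trans_eq ?_
    ring
  have prod : ∀ {a b : ℂ}, ‖a‖ ≤ C * u → ‖b‖ ≤ C * v → ‖a * b‖ ≤ C ^ 2 * (u * v) := fun ha hb =>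
    norm_mul_le_of_singular hCu ha hb
  have prod' : ∀ {a b : ℂ}, ‖a‖ ≤ C * v → ‖b‖ ≤ C * u → ‖a * b‖ ≤ C ^ 2 * (u * v) := fun ha hb => by
    rw [mul_comm]; exact prod hb ha
  have half : ∀ {a b : ℂ}, ‖a‖ ≤ C * v → ‖b‖ ≤ C * v → ‖(a + b) / 2‖ ≤ C * v := fun ha hb => by
    rw [norm_div]
    have := norm_add_le_of_le ha hb
    simp
    linarith
  refine (norm_laxFormDeriv_le (K := C * (u * v)) (K' := (2 * W * C + 3 * C ^ 2) * (u * v)) (M := M)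
    (a1.trans huv) (c1.trans huv) (p1.trans huv) (q1.trans huv) hl ?_ ?_ ?_ ?_ hl').trans_eq ?_
  · rw [mul_sub (P.A (s, t))]
    exact (norm_add_le_of_le (norm_add_le_of_le (sum a1 a2) (norm_sub_le_of_le (prod a1 a2)
      (prod a1 c2))) (prod p1 q2)).trans_eq (by ring)
  · rw [mul_sub (star (P.A (s, t)))]
    exact (norm_add_le_of_le (norm_add_le_of_le (sum c1 c2) (norm_sub_le_of_le (prod c1 c2)
      (prod c1 a2))) (prod q1 p2)).trans_eq (by ring)
  · exact (norm_sub_le_of_le (norm_add_le_of_le (norm_add_le_of_le (sum p1 p2) (prod a1 p2))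
      (prod' a2 p1)) (prod p1 (half a2 c2))).trans_eq (by ring)
  · exact (norm_sub_le_of_le (norm_add_le_of_le (norm_add_le_of_le (sum q1 q2) (prod c1 q2))
      (prod' c2 q1)) (prod q1 (half a2 c2))).trans_eq (by ring)
  · ring

theorem IsSolution.continuousOn_laxDeriv (h : P.IsSolution β) {X Y t : ℝ} (hXY : X + Y < 1)
    (ht : t ∈ Ioo 0 Y) {l l' : ℝ → ℂ} (hl : ContinuousOn l (Ioo 0 X))
    (hl' : ContinuousOn l' (Ioo 0 X)) :
    ContinuousOn (fun s => P.laxDeriv s t (l s) (l' s)) (Ioo 0 X) := by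
  have hm : MapsTo (fun s : ℝ => (s, t)) (Ioo 0 X) {p ∈ triangle | 0 < p.1} := fun s hs =>
    ⟨⟨hs.1.le, ht.1.le, by have := hs.2; have := ht.2; simp only; linarith⟩, hs.1⟩
  have hm' : MapsTo (fun s : ℝ => (t, s)) (Ioo 0 X) {p ∈ triangle | 0 < p.1} := fun s hs =>
    ⟨⟨ht.1.le, hs.1.le, by have := hs.2; have := ht.2; simp only; linarith⟩, ht.1⟩
  have hc : ContinuousOn (fun s : ℝ => (s, t)) (Ioo 0 X) := by fun_prop
  have hc' : ContinuousOn (fun s : ℝ => (t, s)) (Ioo 0 X) := by fun_prop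
  have a1 := h.singular_A.continuousOn.comp hc hm
  have p1 := h.singular_p.continuousOn.comp hc hm
  have q1 := h.singular_q.continuousOn.comp hc hm
  have a2 := h.swap.singular_A.continuousOn.comp hc' hm'
  have p2 := h.swap.singular_p.continuousOn.comp hc' hm'
  have q2 := h.swap.singular_q.continuousOn.comp hc' hm'
  have c1 := continuous_star.comp_continuousOn a1
  have c2 := continuous_star.comp_continuousOn a2
  have hw : ContinuousOn (fun s : ℝ => 1 / (2 * (1 - (s : ℂ) - (t : ℂ)))) (Ioo 0 X) := by
    refine continuousOn_const.div (by fun_prop) fun s hs => mul_ne_zero two_ne_zero ?_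
    exact ofReal_one_sub_sub_ne_zero (by linarith [hs.2, ht.2])
  simp only [Function.comp_def] at a1 p1 q1 a2 p2 q2 c1 c2
  unfold laxDeriv
  exact continuousOn_laxFormDeriv a1 c1 p1 q1 hl
    (((hw.mul (a1.add a2)).add (a1.mul (a2.sub c2))).add (p1.mul q2))
    (((hw.mul (c1.add c2)).add (c1.mul (c2.sub a2))).add (q1.mul p2))
    ((((hw.mul (p1.add p2)).add (a1.mul p2)).add (a2.mul p1)).sub
      (p1.mul ((a2.add c2).div_const 2)))
    ((((hw.mul (q1.add q2)).add (c1.mul q2)).add (c2.mul q1)).sub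
      (q1.mul ((a2.add c2).div_const 2))) hl'

/-- The two ways around a rectangle give the same solution of the Lax pair. -/
theorem IsSolution.transport_lax (h : P.IsSolution β) {x y : ℝ} {z : ℂ} (hx : 0 ≤ x) (hy : 0 ≤ y)
    (hxy : x + y < 1) (hz0 : z ∉ sigma0 x y) (hz1 : z ∉ sigma1 x y) :
    transport (fun s => P.lax (s, y) (lamFun x y s y z)) x *
        transport (fun t => P.swap.lax (t, 0) (1 / lamFun x y 0 t z)) y =
      transport (fun t => P.swap.lax (t, x) (1 / lamFun x y x t z)) y *
        transport (fun s => P.lax (s, 0) (lamFun x y s 0 z)) x := by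
  obtain ⟨C, hC0, hC, hC'⟩ := h.exists_bound hxy
  have hyx : y + x < 1 := by linarith
  have hR : IsCompact (Icc 0 x ×ˢ Icc 0 y) := isCompact_Icc.prod isCompact_Icc
  have h1 := continuousOn_lamFun hx hy hxy hz0 hz1
  have h2 := continuousOn_one_div_lamFun hx hy hxy hz0 hz1
  have hwc : ContinuousOn (fun p : ℝ × ℝ => 1 / (2 * (1 - (p.1 : ℂ) - (p.2 : ℂ))))
      (Icc 0 x ×ˢ Icc 0 y) := by
    refine continuousOn_const.div (by fun_prop) fun p hp => mul_ne_zero two_ne_zero ?_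
    exact ofReal_one_sub_sub_ne_zero (by linarith [hp.1.2, hp.2.2])
  obtain ⟨M1, hM1⟩ := hR.exists_bound_of_continuousOn h1
  obtain ⟨M2, hM2⟩ := hR.exists_bound_of_continuousOn h2
  obtain ⟨W, hW⟩ := hR.exists_bound_of_continuousOn hwc
  obtain ⟨M3, hM3⟩ := hR.exists_bound_of_continuousOn ((h2.sub h1).mul hwc)
  set M := max (max M1 M2) M3
  have hM1' : ∀ s ∈ Icc 0 x, ∀ t ∈ Icc 0 y, ‖lamFun x y s t z‖ ≤ M := fun s hs t ht =>
    (hM1 (s, t) ⟨hs, ht⟩).trans ((le_max_left _ _).trans (le_max_left _ _))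
  have hM2' : ∀ s ∈ Icc 0 x, ∀ t ∈ Icc 0 y, ‖1 / lamFun x y s t z‖ ≤ M := fun s hs t ht =>
    (hM2 (s, t) ⟨hs, ht⟩).trans ((le_max_right _ _).trans (le_max_left _ _))
  have hM3' : ∀ s ∈ Icc 0 x, ∀ t ∈ Icc 0 y, ‖(1 / lamFun x y s t z - lamFun x y s t z) *
      (1 / (2 * (1 - (s : ℂ) - (t : ℂ))))‖ ≤ M := fun s hs t ht =>
    (hM3 (s, t) ⟨hs, ht⟩).trans (le_max_right _ _)
  have hW0 : 0 ≤ W := (norm_nonneg _).trans (hW (0, 0) ⟨left_mem_Icc.2 hx, left_mem_Icc.2 hy⟩)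
  have hM0 : 0 ≤ M := (norm_nonneg _).trans (hM1' 0 (left_mem_Icc.2 hx) 0 (left_mem_Icc.2 hy))
  -- K dominates the bounds for U, V and U_t at once, as the flatness theorem takes a single
  -- constant.
  set K := 3 * (M * C + (1 + M) * (2 * W * C + 3 * C ^ 2)) + 3 * ((1 + M) * C) with hK
  have hK1 : 3 * ((1 + M) * C) ≤ K := by
    rw [hK]; have : 0 ≤ 3 * (M * C + (1 + M) * (2 * W * C + 3 * C ^ 2)) := by positivity
    linarith
  have hK2 : 3 * (M * C + (1 + M) * (2 * W * C + 3 * C ^ 2)) ≤ K := by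
    rw [hK]; have : 0 ≤ 3 * ((1 + M) * C) := by positivity
    linarith
  have hK0 : 0 ≤ K := le_trans (by positivity) hK1
  have up : ∀ {A : ℝ → Mat3} {T : ℝ}, WeaklySingular A β (3 * ((1 + M) * C)) T →
      WeaklySingular A β K T := fun hA => ⟨hA.cont, fun s hs => (hA.bound s hs).trans (by
    have := Real.rpow_nonneg hs.1.le (-β); gcongr)⟩
  have ioo : ∀ {s T : ℝ}, s ∈ Ioo 0 T → s ∈ Icc 0 T := fun hs => Ioo_subset_Icc_self hs
  have lc : ∀ t ∈ Icc 0 y, ContinuousOn (fun s => lamFun x y s t z) (Icc 0 x) := fun t ht =>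
    h1.comp (f := fun s : ℝ => (s, t)) (by fun_prop) fun s hs => ⟨hs, ht⟩
  have lc' : ∀ s ∈ Icc 0 x, ContinuousOn (fun t => lamFun x y s t z) (Icc 0 y) := fun s hs =>
    h1.comp (f := fun t : ℝ => (s, t)) (by fun_prop) fun t ht => ⟨hs, ht⟩
  have ic : ∀ t ∈ Icc 0 y, ContinuousOn (fun s => 1 / lamFun x y s t z) (Icc 0 x) := fun t ht =>
    h2.comp (f := fun s : ℝ => (s, t)) (by fun_prop) fun s hs => ⟨hs, ht⟩
  have ic' : ∀ s ∈ Icc 0 x, ContinuousOn (fun t => 1 / lamFun x y s t z) (Icc 0 y) := fun s hs =>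
    h2.comp (f := fun t : ℝ => (s, t)) (by fun_prop) fun t ht => ⟨hs, ht⟩
  have hV : ∀ s ∈ Icc 0 x, WeaklySingular (fun t => P.swap.lax (t, s) (1 / lamFun x y s t z)) β K y :=
    fun s hs => up (h.swap.weaklySingular_lax hyx hC' hs ((ic' s hs).mono Ioo_subset_Icc_self)
      fun t ht => hM2' s hs t (ioo ht))
  have hint : ∀ s ∈ Ioo 0 x, ∀ t ∈ Ioo 0 y, (s, t) ∈ interior triangle := fun s hs t ht =>
    mem_interior_triangle.2 ⟨hs.1, ht.1, by have := hs.2; have := ht.2; simp only; linarith⟩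
  refine transport_mul_transport_of_flat (U := fun s t => P.lax (s, t) (lamFun x y s t z))
    (U' := fun s t => P.laxDeriv s t (lamFun x y s t z)
      ((1 / lamFun x y s t z - lamFun x y s t z) * (1 / (2 * (1 - (s : ℂ) - (t : ℂ))))))
    (V := fun s t => P.swap.lax (t, s) (1 / lamFun x y s t z)) (C := K)
    h.nonneg h.lt_one hK0 hx hy ?_ ?_ (hV 0 (left_mem_Icc.2 hx)) (hV x (right_mem_Icc.2 hx)) ?_ ?_ ?_
    ?_ ?_
  · exact fun t ht => up (h.weaklySingular_lax hxy hC ht ((lc t ht).mono Ioo_subset_Icc_self)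
      fun s hs => hM1' s (ioo hs) t ht)
  · intro s hs
    refine h.continuousOn_lax (by fun_prop) (fun t ht => ⟨⟨hs.1.le, ht.1, ?_⟩, hs.1⟩) (lc' s (ioo hs))
    have := hs.2; have := ht.2; simp only; linarith
  · intro t ht
    refine h.swap.continuousOn_lax (by fun_prop) (fun s hs => ⟨⟨ht.1.le, hs.1, ?_⟩, ht.1⟩)
      (ic t (ioo ht))
    have := hs.2; have := ht.2; simp only; linarith
  · exact fun s hs t ht => h.hasDerivAt_lax (hint s hs t ht)
      (hasDerivAt_lamFun_right hx hy hxy hz0 hz1 (ioo hs) (ioo ht))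
  · intro s hs t ht
    have hu := Real.rpow_nonneg hs.1.le (-β)
    have hv := Real.rpow_nonneg ht.1.le (-β)
    refine (h.norm_laxDeriv_le hxy hC0 hC hC' hs ht (hW (s, t) ⟨ioo hs, ioo ht⟩)
      (hM1' s (ioo hs) t (ioo ht)) (hM3' s (ioo hs) t (ioo ht))).trans ?_
    gcongr
  · intro t ht
    refine h.continuousOn_laxDeriv hxy ht ((lc t (ioo ht)).mono Ioo_subset_Icc_self) ?_
    exact (((h2.sub h1).mul hwc).comp (f := fun s : ℝ => (s, t)) (by fun_prop)
      fun s hs => ⟨ioo hs, ioo ht⟩)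
  -- V_s is the t-derivative formula for the exchanged potentials; the zero curvature identity
  -- rewrites it in terms of U_t.
  · intro s hs t ht
    refine (h.swap.hasDerivAt_lax (swap_mem_interior (hint s hs t ht))
      (hasDerivAt_one_div_lamFun hx hy hxy hz0 hz1 (ioo hs) (ioo ht))).congr_deriv ?_
    exact laxDeriv_swap P s t (lamFun_ne_zero hx hy hxy hz0 hz1 (ioo hs) (ioo ht))

end Potentials

/-! ### The symmetry between the two sheets -/

/-- The matrix `diag(1, -1, 1)`. -/
def signMat : Mat3 := !![1, 0, 0; 0, -1, 0; 0, 0, 1]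

theorem signMat_mul_self : signMat * signMat = 1 := by
  ext i j
  fin_cases i <;> fin_cases j <;> simp [signMat]

/-- The parameter occurs exactly in the entries whose sign is changed by conjugation with
diag(1,-1,1). -/
theorem laxForm_neg (a c p q l : ℂ) :
    laxForm a c p q (-l) = signMat * laxForm a c p q l * signMat := by
  ext i j
  fin_cases i <;> fin_cases j <;> simp [signMat, laxForm, Matrix.mul_apply, Fin.sum_univ_three]

theorem transport_conj {A : ℝ → Mat3} {β C T : ℝ} (hβ : β < 1) (hC : 0 ≤ C) (hT : 0 ≤ T)
    (h : WeaklySingular (fun s => signMat * A s * signMat) β C T)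
    (h' : WeaklySingular A β C T) :
    transport (fun s => signMat * A s * signMat) T = signMat * transport A T * signMat := by
  have hc : ContinuousOn (fun s => signMat * transport A s * signMat) (Icc 0 T) :=
    (continuousOn_const.mul (continuousOn_transport hβ hC hT h')).mul continuousOn_const
  have := eq_transport_mul hβ hC hT h hc (fun s hs => by
    refine (((hasDerivAt_transport hβ hC h' hs).const_mul signMat).mul_const signMat).congr_deriv ?_
    have e : signMat * A s * signMat * (signMat * transport A s * signMat) =
        signMat * A s * (signMat * signMat) * transport A s * signMat := by noncomm_ring
    rw [e, signMat_mul_self]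
    noncomm_ring) (right_mem_Icc.2 hT)
  simp only [transport_zero, mul_one, signMat_mul_self] at this
  exact this.symm

/-- A solution of the Lax pair with spectral parameter one. -/
def gauge (e h : ℂ) : Mat3 :=
  !![(fVal e h : ℂ) - (e - 1) / 2, (fVal e h : ℂ) - (e + 1) / 2, Complex.I * h;
     (e - 1) / 2, (e + 1) / 2, -(Complex.I * h);
     Complex.I * (√(fVal e h) : ℂ) * star h, Complex.I * (√(fVal e h) : ℂ) * star h, (√(fVal e h) : ℂ)]

theorem gauge_one_zero : gauge 1 0 = 1 := by
  ext i j
  fin_cases i <;> fin_cases j <;> simp [gauge, fVal]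

/-- At λ = 1 the system can be solved in turn: the sum of the first two rows obeys y' = (A + conj A)
y and is (f, f, 0). The third row is then a scalar equation with integrating factor √f, and the
second row is obtained by integration. -/
theorem hasDerivAt_gauge {e h : ℝ → ℂ} {e' h' : ℂ} {s : ℝ} (he : HasDerivAt e e' s)
    (hh : HasDerivAt h h' s) (hf : 0 < fVal (e s) (h s)) :
    HasDerivAt (fun s => gauge (e s) (h s))
      (laxForm (logC (e s) (h s) e' h') (star (logC (e s) (h s) e' h'))
        (Complex.I / (√(fVal (e s) (h s)) : ℂ) * h')
        (Complex.I / (√(fVal (e s) (h s)) : ℂ) * star h') 1 * gauge (e s) (h s)) s := by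
  have h1 : e' = 2 * (fVal (e s) (h s) : ℂ) * logC (e s) (h s) e' h' +
      2 * (starRingEnd ℂ) (h s) * h' := logC_mul hf
  have hF := hasDerivAt_ofReal_fVal he hh hf
  have hR := hasDerivAt_sqrt_fVal he hh hf
  have hr : (√(fVal (e s) (h s)) : ℂ) ≠ 0 := by exact_mod_cast (Real.sqrt_pos.2 hf).ne'
  have hr2 : (fVal (e s) (h s) : ℂ) = (√(fVal (e s) (h s)) : ℂ) ^ 2 := by
    exact_mod_cast (Real.sq_sqrt hf.le).symm
  have hI := Complex.I_sq
  refine hasDerivAt_of_entries fun i j => ?_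
  set b := logC (e s) (h s) e' h'
  set r := (√(fVal (e s) (h s)) : ℂ) with hrdef
  set F := (fVal (e s) (h s) : ℂ) with hFdef
  fin_cases i <;> fin_cases j
  · refine (hF.fun_sub ((he.sub_const 1).div_const 2)).congr_deriv ?_
    simp [laxForm, gauge, Matrix.mul_apply, Fin.sum_univ_three, ← hFdef, ← hrdef]
    field_simp
    linear_combination -h1 - 2 * (starRingEnd ℂ) (h s) * h' * hI
  · refine (hF.fun_sub ((he.add_const 1).div_const 2)).congr_deriv ?_
    simp [laxForm, gauge, Matrix.mul_apply, Fin.sum_univ_three, ← hFdef, ← hrdef]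
    field_simp
    linear_combination -h1 - 2 * (starRingEnd ℂ) (h s) * h' * hI
  · refine (hh.const_mul Complex.I).congr_deriv ?_
    simp [laxForm, gauge, Matrix.mul_apply, Fin.sum_univ_three, ← hFdef, ← hrdef]
    field_simp
  · refine ((he.sub_const 1).div_const 2).congr_deriv ?_
    simp [laxForm, gauge, Matrix.mul_apply, Fin.sum_univ_three, ← hFdef, ← hrdef]
    field_simp
    linear_combination h1 + 2 * (starRingEnd ℂ) (h s) * h' * hI
  · refine ((he.add_const 1).div_const 2).congr_deriv ?_
    simp [laxForm, gauge, Matrix.mul_apply, Fin.sum_univ_three, ← hFdef, ← hrdef]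
    field_simp
    linear_combination h1 + 2 * (starRingEnd ℂ) (h s) * h' * hI
  · refine (hh.const_mul Complex.I).fun_neg.congr_deriv ?_
    simp [laxForm, gauge, Matrix.mul_apply, Fin.sum_univ_three, ← hFdef, ← hrdef]
    field_simp
  · refine ((hR.const_mul Complex.I).fun_mul hh.star).congr_deriv ?_
    simp [laxForm, gauge, Matrix.mul_apply, Fin.sum_univ_three, ← hFdef, ← hrdef]
    rw [hr2]
    field_simp
    ring
  · refine ((hR.const_mul Complex.I).fun_mul hh.star).congr_deriv ?_
    simp [laxForm, gauge, Matrix.mul_apply, Fin.sum_univ_three, ← hFdef, ← hrdef]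
    rw [hr2]
    field_simp
    ring
  · refine hR.congr_deriv ?_
    simp [laxForm, gauge, Matrix.mul_apply, Fin.sum_univ_three, ← hFdef, ← hrdef]
    field_simp

theorem continuousOn_gauge {X : Type*} [TopologicalSpace X] {e h : X → ℂ} {S : Set X}
    (he : ContinuousOn e S) (hh : ContinuousOn h S) :
    ContinuousOn (fun s => gauge (e s) (h s)) S := by
  have hf : ContinuousOn (fun s => fVal (e s) (h s)) S :=
    continuous_fVal.comp_continuousOn (he.prodMk hh)
  have h1 := Complex.continuous_ofReal.comp_continuousOn hf
  have h2 := Complex.continuous_ofReal.comp_continuousOn hf.sqrt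
  have h3 := continuous_star.comp_continuousOn hh
  simp only [Function.comp_def] at h1 h2 h3
  refine continuousOn_of_entries fun i j => ?_
  fin_cases i <;> fin_cases j
  · exact h1.sub ((he.sub continuousOn_const).div_const 2)
  · exact h1.sub ((he.add continuousOn_const).div_const 2)
  · exact continuousOn_const.mul hh
  · exact (he.sub continuousOn_const).div_const 2
  · exact (he.add continuousOn_const).div_const 2
  · exact (continuousOn_const.mul hh).neg
  · exact (continuousOn_const.mul h2).mul h3
  · exact (continuousOn_const.mul h2).mul h3
  · exact h2

/-- The potentials are recovered from the quotient of the values on the two sheets. -/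
theorem potentials_eq_of_gauge {e h : ℂ} {m : Mat3} (hf : 0 < fVal e h)
    (hm : gauge e h * m = signMat * gauge e h * signMat) :
    m 2 2 + m 0 0 + m 1 0 ≠ 0 ∧
      e = (m 2 2 + m 0 0 - m 1 0) / (m 2 2 + m 0 0 + m 1 0) ∧
      h = (-Complex.I * m 1 2) / (m 2 2 + m 0 0 + m 1 0) := by
  have hF : (fVal e h : ℂ) ≠ 0 := by exact_mod_cast hf.ne'
  have hr : (√(fVal e h) : ℂ) ≠ 0 := by exact_mod_cast (Real.sqrt_pos.2 hf).ne'
  have hfe := ofReal_fVal e h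
  -- The denominator of the formulas will turn out to be (1 + conj e)/f, and Re e > |h|² ≥ 0.
  have h1e : 1 + star e ≠ 0 := by
    intro h0
    have h2 := congrArg Complex.re h0
    have h3 : 0 < e.re := by
      have : 0 < e.re - ‖h‖ ^ 2 := hf
      nlinarith [sq_nonneg ‖h‖]
    have h4 : (star e).re = e.re := Complex.conj_re e
    rw [Complex.add_re, h4] at h2
    simp at h2
    linarith
  have entry : ∀ i j, (gauge e h * m) i j = (signMat * gauge e h * signMat) i j := fun i j => by rw [hm]
  have e00 := entry 0 0
  have e10 := entry 1 0
  have e20 := entry 2 0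
  have e02 := entry 0 2
  have e12 := entry 1 2
  have e22 := entry 2 2
  have hI := Complex.I_sq
  simp only [gauge, signMat, Matrix.mul_apply, Fin.sum_univ_three, Matrix.of_apply, Matrix.cons_val',
    Matrix.cons_val_zero, Matrix.cons_val_one, Matrix.cons_val, Matrix.cons_val_fin_one] at e00 e10 e20 e02 e12 e22
  set F := (fVal e h : ℂ)
  set r := (√(fVal e h) : ℂ)
  set k := star h
  -- Adding the first two rows of the gauge matrix gives (f, f, 0), which isolates the sums m₀ⱼ +
  -- m₁ⱼ; the third row then yields m₂ⱼ.
  have s0 : F * (m 0 0 + m 1 0) = F - e + 1 := by linear_combination e00 + e10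
  have s2 : F * (m 0 2 + m 1 2) = 2 * Complex.I * h := by linear_combination e02 + e12
  have t0 : Complex.I * k * (m 0 0 + m 1 0) + m 2 0 = Complex.I * k := by
    apply mul_left_cancel₀ hr
    linear_combination e20
  have t2 : Complex.I * k * (m 0 2 + m 1 2) + m 2 2 = 1 := by
    apply mul_left_cancel₀ hr
    linear_combination e22
  have u1 : F * (m 2 2 + m 0 0 + m 1 0) = 1 + star e := by
    linear_combination F * t2 + s0 - Complex.I * k * s2 - 2 * k * h * hI + 2 * hfe
  have u2 : F * m 1 0 = (1 - e) / 2 * (1 + star e) := by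
    linear_combination F * e10 - (e - 1) / 2 * s0 + Complex.I * h * (F * t0 - Complex.I * k * s0) +
      h * k * (e - 1) * hI + (1 - e) * hfe
  have u3 : F * m 1 2 = Complex.I * h * (1 + star e) := by
    linear_combination F * e12 - (e - 1) / 2 * s2 + Complex.I * h * (F * t2 - Complex.I * k * s2) -
      2 * Complex.I * h * k * h * hI + 2 * Complex.I * h * hfe
  have u4 : m 2 2 + m 0 0 + m 1 0 ≠ 0 := by
    intro h0
    rw [h0, mul_zero] at u1
    exact h1e u1.symm
  refine ⟨u4, ?_, ?_⟩
  · rw [eq_div_iff u4]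
    apply mul_left_cancel₀ hF
    linear_combination (e - 1) * u1 + 2 * u2
  · rw [eq_div_iff u4]
    apply mul_left_cancel₀ hF
    linear_combination h * u1 + Complex.I * u3 + h * (1 + star e) * hI

/-! ### Propagators along horizontal segments -/

theorem isUnit_transport {A : ℝ → Mat3} {β C T : ℝ} (hβ : β < 1) (hC : 0 ≤ C) (hT : 0 ≤ T)
    (h : WeaklySingular A β C T) : IsUnit (transport A T) :=
  ⟨⟨transport A T, cotransport A T, transport_mul_cotransport hβ hC hT h (right_mem_Icc.2 hT),
    cotransport_mul_transport hβ hC hT h (right_mem_Icc.2 hT)⟩, rfl⟩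

namespace Potentials

variable {P : Potentials} {β X t : ℝ}

/-- The solution of the first equation of the Lax pair along the segment from `(0,t)` to `(X,t)`, for
the spectral function `l`. -/
def propagator (P : Potentials) (X t : ℝ) (l : ℝ → ℂ) : Mat3 := transport (fun s => P.lax (s, t) (l s)) X

theorem lax_neg (P : Potentials) (x : ℝ × ℝ) (l : ℂ) :
    P.lax x (-l) = signMat * P.lax x l * signMat := laxForm_neg _ _ _ _ _

variable (h : P.IsSolution β) (hX : 0 ≤ X) (ht : 0 ≤ t) (hXt : X + t < 1)
include h hX ht hXt

theorem IsSolution.exists_weaklySingular {l : ℝ → ℂ} (hl : ContinuousOn l (Icc 0 X)) :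
    ∃ C, 0 ≤ C ∧ WeaklySingular (fun s => P.lax (s, t) (l s)) β C X := by
  obtain ⟨C, hC0, hC, -⟩ := h.exists_bound hXt
  obtain ⟨M, hM⟩ := isCompact_Icc.exists_bound_of_continuousOn hl
  have hM0 : 0 ≤ M := (norm_nonneg _).trans (hM 0 (left_mem_Icc.2 hX))
  exact ⟨_, by positivity, h.weaklySingular_lax hXt hC (right_mem_Icc.2 ht)
    (hl.mono Ioo_subset_Icc_self) fun s hs => hM s (Ioo_subset_Icc_self hs)⟩

theorem IsSolution.isUnit_propagator {l : ℝ → ℂ} (hl : ContinuousOn l (Icc 0 X)) :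
    IsUnit (P.propagator X t l) := by
  obtain ⟨C, hC0, hC⟩ := h.exists_weaklySingular hX ht hXt hl
  exact isUnit_transport h.lt_one hC0 hX hC

theorem IsSolution.propagator_neg {l : ℝ → ℂ} (hl : ContinuousOn l (Icc 0 X)) :
    P.propagator X t (fun s => -l s) = signMat * P.propagator X t l * signMat := by
  obtain ⟨C, hC0, hC⟩ := h.exists_weaklySingular hX ht hXt hl
  obtain ⟨C', hC0', hC'⟩ := h.exists_weaklySingular hX ht hXt hl.neg
  have up : ∀ {A : ℝ → Mat3} {K : ℝ}, K ≤ max C C' → WeaklySingular A β K X →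
      WeaklySingular A β (max C C') X := fun hK hA => ⟨hA.cont, fun s hs => (hA.bound s hs).trans (by
    have := Real.rpow_nonneg hs.1.le (-β); gcongr)⟩
  rw [propagator, propagator, ← transport_conj h.lt_one (hC0.trans (le_max_left C C')) hX ?_
    (up (le_max_left _ _) hC)]
  · simp only [lax_neg]
  · simp only [← lax_neg]
    exact up (le_max_right _ _) hC'

theorem IsSolution.differentiableOn_propagator {ℓ : ℝ → ℂ → ℂ} {Ω : Set ℂ} (hΩ : IsOpen Ω)
    (hc : ContinuousOn (fun p : ℝ × ℂ => ℓ p.1 p.2) (Icc 0 X ×ˢ Ω))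
    (hd : ∀ s ∈ Icc 0 X, DifferentiableOn ℂ (ℓ s) Ω) :
    DifferentiableOn ℂ (fun z => P.propagator X t fun s => ℓ s z) Ω := by
  obtain ⟨C, hC0, hC, -⟩ := h.exists_bound hXt
  have h0 : WeaklySingular (fun s => P.lax (s, t) 0) β (3 * ((1 + 1) * C)) X :=
    h.weaklySingular_lax (M := 1) hXt hC (right_mem_Icc.2 ht) continuousOn_const (by simp)
  have h1 : WeaklySingular (fun s => P.lax (s, t) 1) β (3 * ((1 + 1) * C)) X :=
    h.weaklySingular_lax (M := 1) hXt hC (right_mem_Icc.2 ht) continuousOn_const (by simp)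
  have h2 : WeaklySingular (fun s => P.lax (s, t) 1 - P.lax (s, t) 0) β
      (3 * ((1 + 1) * C) + 3 * ((1 + 1) * C)) X :=
    ⟨h1.cont.sub h0.cont, fun s hs => (norm_sub_le_of_le (h1.bound s hs) (h0.bound s hs)).trans_eq
      (by ring)⟩
  have h3 : WeaklySingular (fun s => P.lax (s, t) 0) β (3 * ((1 + 1) * C) + 3 * ((1 + 1) * C)) X :=
    ⟨h0.cont, fun s hs => (h0.bound s hs).trans (by
      have := Real.rpow_nonneg hs.1.le (-β); gcongr; linarith)⟩
  have := differentiableOn_transport h.lt_one (by positivity) hX h3 h2 hΩ hc hd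
  have e : (fun z => P.propagator X t fun s => ℓ s z) = fun z => transport (fun s =>
      P.lax (s, t) 0 + ℓ s z • (P.lax (s, t) 1 - P.lax (s, t) 0)) X := by
    funext z
    rw [propagator]
    congr 1
    funext s
    exact laxForm_eq_add_smul _ _ _ _ _
  rw [e]
  exact this

/-- The gauge matrix solves the system with λ = 1 along any horizontal segment, including the bottom
edge, so it is carried along by the propagator. -/
theorem IsSolution.gauge_eq : gauge (P.E (X, t)) (P.H (X, t)) =
    P.propagator X t (fun _ => 1) * gauge (P.E (0, t)) (P.H (0, t)) := by
  obtain ⟨C, hC0, hC⟩ := h.exists_weaklySingular hX ht hXt (l := fun _ => 1) continuousOn_const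
  have hm : ∀ s ∈ Icc 0 X, (s, t) ∈ triangle := fun s hs =>
    ⟨hs.1, ht, by have := hs.2; simp only; linarith⟩
  have hc : ContinuousOn (fun s : ℝ => (s, t)) (Icc 0 X) := by fun_prop
  refine eq_transport_mul (Φ := fun s => gauge (P.E (s, t)) (P.H (s, t))) h.lt_one hC0 hX hC ?_ ?_
    (right_mem_Icc.2 hX)
  · exact continuousOn_gauge (h.partialE.cont.comp hc hm) (h.partialH.cont.comp hc hm)
  · intro s hs
    have hs' := hm s (Ioo_subset_Icc_self hs)
    exact hasDerivAt_gauge (h.partialE.hasDeriv_x _ hs' hs.1) (h.partialH.hasDeriv_x _ hs' hs.1)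
      (h.pos _ hs')

end Potentials

/-! ### The factorization of the jump matrix -/

/-- In the coordinate w = 1/z the function extends differentiably to w = 0 with value 1, so it
differs from 1 by O(w). -/
theorem isBigO_of_eventually_inv {G K : ℂ → Mat3} (hK : DifferentiableAt ℂ K 0) (hK0 : K 0 = 1)
    (hG : ∀ᶠ w in 𝓝 0, w ≠ 0 → G w⁻¹ = K w) (i j : Fin 3) :
    (fun z => G z i j - (1 : Mat3) i j) =O[cocompact ℂ] (fun z : ℂ => z⁻¹) := by
  have h1 : (fun w => K w i j - (1 : Mat3) i j) =O[𝓝 0] (fun w : ℂ => w) := by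
    have := (DifferentiableAt.matrix_entry hK i j).isBigO_sub
    simpa [hK0] using this
  have h2 : Tendsto (fun z : ℂ => z⁻¹) (cocompact ℂ) (𝓝 0) := by
    rw [← Metric.cobounded_eq_cocompact]; exact tendsto_inv₀_cobounded
  refine (h1.comp_tendsto h2).congr' ?_ EventuallyEq.rfl
  have h3 : ∀ᶠ z : ℂ in cocompact ℂ, z ≠ 0 := (isCompact_singleton (x := (0 : ℂ))).compl_mem_cocompact
  filter_upwards [h2.eventually hG, h3] with z hz hz0
  have := hz (inv_ne_zero hz0)
  rw [inv_inv] at this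
  simp only [Function.comp_apply, this]

section

variable {x y : ℝ} (hx : 0 ≤ x) (hy : 0 ≤ y) (hxy : x + y < 1)

theorem zero_notMem_sigma : (0 : ℂ) ∉ sigma0 x y ∪ sigma1 x y := by
  rintro (h | h) <;> exact h.1 rfl

theorem isOpen_compl_sigma (hxy : x + y < 1) : IsOpen (sigma0 x y ∪ sigma1 x y)ᶜ :=
  ((isClosed_sigma0 hxy).union (isClosed_sigma1 hxy)).isOpen_compl

include hx hy hxy

theorem continuousOn_lamFun_bottom : ContinuousOn (fun p : ℝ × ℂ => lamFun x y p.1 0 p.2)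
    (Icc 0 x ×ˢ (sigma0 x y ∪ sigma1 x y)ᶜ) := by
  have hyx : y + x < 1 := by linarith
  refine ContinuousOn.div ?_ ?_ ?_
  · exact (continuousOn_specLam hx hxy).mono (prod_mono_right (compl_subset_compl.2 subset_union_left))
  · refine (continuousOn_specRoot hy hyx).comp (f := fun p : ℝ × ℂ => ((0 : ℝ), -p.2)) (by fun_prop) ?_
    exact fun p hp => ⟨left_mem_Icc.2 hy, mem_sigma1_iff.not.1 fun h => hp.2 (Or.inr h)⟩
  · exact fun p hp => specRoot_ne_zero hy hyx (mem_sigma1_iff.not.1 fun h => hp.2 (Or.inr h))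
      (left_mem_Icc.2 hy)

theorem differentiableOn_lamFun_bottom {s : ℝ} (hs : s ∈ Icc 0 x) :
    DifferentiableOn ℂ (lamFun x y s 0) (sigma0 x y ∪ sigma1 x y)ᶜ := by
  have hyx : y + x < 1 := by linarith
  refine DifferentiableOn.div ?_ ?_ ?_
  · exact (differentiableOn_specLam hx hxy hs).mono (compl_subset_compl.2 subset_union_left)
  · refine (differentiableOn_specRoot hy hyx (left_mem_Icc.2 hy)).comp (f := fun z : ℂ => -z)
      (by fun_prop) ?_
    exact fun z hz => mem_sigma1_iff.not.1 fun h => hz (Or.inr h)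
  · exact fun z hz => specRoot_ne_zero hy hyx (mem_sigma1_iff.not.1 fun h => hz (Or.inr h))
      (left_mem_Icc.2 hy)

end

namespace Potentials

variable {P : Potentials} {β x y : ℝ}

/-- The eigenfunction that starts on the bottom edge, at the corner `(x,y)`. -/
def outerFun (P : Potentials) (x y : ℝ) (z : ℂ) : Mat3 :=
  P.swap.propagator y x (fun t => specLam y x t (-z)) * P.propagator x 0 (fun s => lamFun x y s 0 z)

variable (h : P.IsSolution β) (hx : 0 ≤ x) (hy : 0 ≤ y) (hxy : x + y < 1)
include h hx hy hxy

/-- Along the top edge λ has no root cut over [1-y,1] left, so the propagator is holomorphic across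
F(Σ₁) and can serve inside Γ₁. -/
theorem IsSolution.inner_top {z : ℂ} (hz : z ∉ sigma0 x y) :
    DifferentiableAt ℂ (fun z => P.propagator x y fun s => specLam x y s z) z ∧
      IsUnit (P.propagator x y fun s => specLam x y s z) := by
  have hΩ : IsOpen (sigma0 x y)ᶜ := (isClosed_sigma0 hxy).isOpen_compl
  refine ⟨(h.differentiableOn_propagator hx hy hxy hΩ (continuousOn_specLam hx hxy) fun s hs =>
    differentiableOn_specLam hx hxy hs).differentiableAt (hΩ.mem_nhds hz), ?_⟩
  exact h.isUnit_propagator hx hy hxy ((continuousOn_specLam hx hxy).comp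
    (f := fun s : ℝ => (s, z)) (by fun_prop) fun s hs => ⟨hs, hz⟩)

theorem IsSolution.inner_right {z : ℂ} (hz : z ∉ sigma1 x y) :
    DifferentiableAt ℂ (fun z => P.swap.propagator y x fun t => specLam y x t (-z)) z ∧
      IsUnit (P.swap.propagator y x fun t => specLam y x t (-z)) := by
  have h1 := h.swap.inner_top hy hx (by linarith) (mem_sigma1_iff.not.1 hz)
  exact ⟨h1.1.comp (f := fun z : ℂ => -z) z differentiableAt_id.neg, h1.2⟩

theorem IsSolution.outer {z : ℂ} (hz0 : z ∉ sigma0 x y) (hz1 : z ∉ sigma1 x y) :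
    DifferentiableAt ℂ (P.outerFun x y) z ∧ IsUnit (P.outerFun x y z) := by
  have hz : z ∈ (sigma0 x y ∪ sigma1 x y)ᶜ := fun h => h.elim hz0 hz1
  have h1 := h.inner_right hx hy hxy hz1
  have h2 := (h.differentiableOn_propagator hx le_rfl (by linarith) (isOpen_compl_sigma hxy)
    (continuousOn_lamFun_bottom hx hy hxy) fun s hs =>
      differentiableOn_lamFun_bottom hx hy hxy hs).differentiableAt
      ((isOpen_compl_sigma hxy).mem_nhds hz)
  have h3 := h.isUnit_propagator hx le_rfl (by linarith) (l := fun s => lamFun x y s 0 z)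
    ((continuousOn_lamFun_bottom hx hy hxy).comp (f := fun s : ℝ => (s, z)) (by fun_prop)
      fun s hs => ⟨hs, hz⟩)
  exact ⟨h1.1.mul h2, h1.2.mul h3⟩

/-- The same eigenfunction, from the left edge. -/
theorem IsSolution.outerFun_eq {z : ℂ} (hz0 : z ∉ sigma0 x y) (hz1 : z ∉ sigma1 x y) :
    P.outerFun x y z = (P.propagator x y fun s => specLam x y s z) *
      P.swap.propagator y 0 fun t => 1 / lamFun x y 0 t z := by
  have hz1' := mem_sigma1_iff.not.1 hz1
  have hm := sub_one_ne_zero_of_notMem hy hxy hz1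
  have hp := add_one_ne_zero_of_notMem hx hxy hz0
  -- On the top and right edges one of the two roots equals 1, which separates the two sets of
  -- singularities.
  have e1 : (fun s => P.lax (s, y) (lamFun x y s y z)) = fun s => P.lax (s, y) (specLam x y s z) := by
    funext s
    rw [lamFun, specRoot_self hy (by linarith) hz1', div_one]
  have e2 : (fun t => P.swap.lax (t, x) (1 / lamFun x y x t z)) =
      fun t => P.swap.lax (t, x) (specLam y x t (-z)) := by
    funext t
    rw [one_div_lamFun hm hp, specRoot_self hx hxy hz0, div_one]
  have := h.transport_lax hx hy hxy hz0 hz1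
  rw [e1, e2] at this
  exact this.symm

/-- A change of sign of λ along the whole path conjugates each factor by diag(1,-1,1), and the two
inner copies cancel. -/
theorem IsSolution.outerFun_neg_lam {z w : ℂ} (hw0 : w ∉ sigma0 x y) (hw1 : w ∉ sigma1 x y)
    (h1 : ∀ t, specLam y x t (-z) = -specLam y x t (-w)) (h2 : ∀ s, lamFun x y s 0 z = -lamFun x y s 0 w) :
    P.outerFun x y z = signMat * P.outerFun x y w * signMat := by
  have hw : w ∈ (sigma0 x y ∪ sigma1 x y)ᶜ := fun h => h.elim hw0 hw1
  have hyx : y + x < 1 := by linarith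
  have h3 := h.propagator_neg hx le_rfl (by linarith) (l := fun s => lamFun x y s 0 w)
    ((continuousOn_lamFun_bottom hx hy hxy).comp (f := fun s : ℝ => (s, w)) (by fun_prop)
      fun s hs => ⟨hs, hw⟩)
  have h4 := h.swap.propagator_neg hy hx hyx (l := fun t => specLam y x t (-w))
    ((continuousOn_specLam hy hyx).comp (f := fun s : ℝ => (s, -w)) (by fun_prop)
      fun s hs => ⟨hs, mem_sigma1_iff.not.1 hw1⟩)
  rw [outerFun, funext h1, funext h2, h3, h4, outerFun]
  have e : ∀ a b : Mat3, signMat * a * signMat * (signMat * b * signMat) =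
      signMat * a * (signMat * signMat) * b * signMat := fun a b => by noncomm_ring
  rw [e, signMat_mul_self]
  noncomm_ring

theorem IsSolution.outerFun_inv {w : ℂ} (hw : w ≠ 0) (hw0 : w ∉ sigma0 x y) (hw1 : w ∉ sigma1 x y) :
    P.outerFun x y w⁻¹ = signMat * P.outerFun x y w * signMat := by
  refine h.outerFun_neg_lam hx hy hxy hw0 hw1 (fun t => ?_) fun s => ?_
  · rw [← inv_neg, specLam_inv (neg_ne_zero.2 hw)]
  · rw [lamFun, lamFun, ← inv_neg, specLam_inv hw, specRoot_inv (neg_ne_zero.2 hw), neg_div]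

/-- At z = 0 one has λ = -1 along the whole path. Up to conjugation this is λ = 1, where the gauge
matrix is the solution; it starts from the identity by the normalization at the origin. -/
theorem IsSolution.outerFun_zero (hE : P.E (0, 0) = 1) (hH : P.H (0, 0) = 0) :
    P.outerFun x y 0 = signMat * gauge (P.E (x, y)) (P.H (x, y)) * signMat := by
  have hyx : y + x < 1 := by linarith
  have h1 := h.gauge_eq hx le_rfl (by linarith)
  have h2 := h.swap.gauge_eq hy hx hyx
  rw [hE, hH, gauge_one_zero, mul_one] at h1
  have h3 : gauge (P.E (x, y)) (P.H (x, y)) = P.swap.propagator y x (fun _ => 1) *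
      P.propagator x 0 (fun _ => 1) := by rw [← h1]; exact h2
  have h4 := h.propagator_neg hx le_rfl (by linarith) (l := fun _ => 1) continuousOn_const
  have h5 := h.swap.propagator_neg hy hx hyx (l := fun _ => 1) continuousOn_const
  have e1 : (fun t => specLam y x t (-0)) = fun _ => -1 := by
    funext t; rw [neg_zero, specLam_zero hyx]
  have e2 : (fun s => lamFun x y s 0 0) = fun _ => -1 := by
    funext s; rw [lamFun, neg_zero, specLam_zero hxy, specRoot_zero hyx, div_one]
  rw [outerFun, e1, e2, h4, h5, h3]
  have e : ∀ a b : Mat3, signMat * a * signMat * (signMat * b * signMat) =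
      signMat * a * (signMat * signMat) * b * signMat := fun a b => by noncomm_ring
  rw [e, signMat_mul_self]
  noncomm_ring

/-- The eigenfunctions, normalized at infinity, factor the jump matrix. -/
theorem IsSolution.rhFactorization (hE : P.E (0, 0) = 1) (hH : P.H (0, 0) = 0) {γ₀ γ₁ : ℝ → ℂ}
    (hγ : AdmissibleContours x y γ₀ γ₁) {v : ℂ → Mat3}
    (hv0 : ∀ z ∈ trace γ₀, v z = P.propagator x 0 fun s => lamFun x y s 0 z)
    (hv1 : ∀ z ∈ trace γ₁, v z = P.swap.propagator y 0 fun t => 1 / lamFun x y 0 t z) :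
    ∃ G b₀ b₁ : ℂ → Mat3, RHFactorization γ₀ γ₁ (sigma0 x y) (sigma1 x y) v G b₀ b₁ ∧
      gauge (P.E (x, y)) (P.H (x, y)) * G 0 =
        signMat * gauge (P.E (x, y)) (P.H (x, y)) * signMat := by
  have h0 := h.outerFun_zero hx hy hxy hE hH
  set N := gauge (P.E (x, y)) (P.H (x, y)) with hN
  have z0 : (0 : ℂ) ∉ sigma0 x y := fun h => h.1 rfl
  have z1 : (0 : ℂ) ∉ sigma1 x y := fun h => h.1 rfl
  have hS : IsUnit signMat := ⟨⟨signMat, signMat, signMat_mul_self, signMat_mul_self⟩, rfl⟩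
  have hNu : IsUnit N := by
    have e : N = signMat * P.outerFun x y 0 * signMat := by
      rw [h0]
      have : signMat * (signMat * N * signMat) * signMat =
          (signMat * signMat) * N * (signMat * signMat) := by noncomm_ring
      rw [this, signMat_mul_self]; simp
    rw [e]
    exact (hS.mul (h.outer hx hy hxy z0 z1).2).mul hS
  obtain ⟨u, hu⟩ := hNu
  have hiN : (↑u⁻¹ : Mat3) * N = 1 := by rw [← hu]; exact u.inv_mul
  have hNi : N * (↑u⁻¹ : Mat3) = 1 := by rw [← hu]; exact u.mul_inv
  -- Multiplication from the left by N⁻¹ leaves the jump unchanged and normalizes at infinity, where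
  -- the eigenfunction tends to S(SNS)S = N.
  refine ⟨fun z => (↑u⁻¹ : Mat3) * P.outerFun x y z,
    fun z => (↑u⁻¹ : Mat3) * P.swap.propagator y x fun t => specLam y x t (-z),
    fun z => (↑u⁻¹ : Mat3) * P.propagator x y fun s => specLam x y s z,
    ⟨hγ.loop0, hγ.loop1, hγ.encircles0, hγ.encircles1, hγ.apart, ?_, ?_, ?_, ?_, ?_, ?_⟩, ?_⟩
  · intro z hz hz'
    have := h.outer hx hy hxy hz hz'
    exact ⟨this.1.const_mul _, u⁻¹.isUnit.mul this.2⟩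
  · intro z hz
    have := h.inner_right hx hy hxy hz
    exact ⟨this.1.const_mul _, u⁻¹.isUnit.mul this.2⟩
  · intro z hz
    have := h.inner_top hx hy hxy hz
    exact ⟨this.1.const_mul _, u⁻¹.isUnit.mul this.2⟩
  · intro z hz
    rw [hv0 z hz, mul_assoc]
    rfl
  · intro z hz
    have hz1 : z ∉ sigma1 x y := RHFactorization.notMem_of_trace hγ.encircles1 hz
    have hz0 : z ∉ sigma0 x y := fun h0 =>
      Set.disjoint_left.1 hγ.apart (Or.inr (hγ.encircles0 h0)) (Or.inl hz)
    rw [hv1 z hz, mul_assoc, h.outerFun_eq hx hy hxy hz0 hz1]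
  · refine isBigO_of_eventually_inv
      (K := fun w => (↑u⁻¹ : Mat3) * (signMat * P.outerFun x y w * signMat)) ?_ ?_ ?_
    · exact (((h.outer hx hy hxy z0 z1).1.const_mul _).mul_const _).const_mul _
    · simp only [h0]
      have : signMat * (signMat * N * signMat) * signMat =
          (signMat * signMat) * N * (signMat * signMat) := by noncomm_ring
      rw [this, signMat_mul_self, one_mul, mul_one, hiN]
    · filter_upwards [(isOpen_compl_sigma hxy).mem_nhds zero_notMem_sigma] with w hw hw0
      rw [h.outerFun_inv hx hy hxy hw0 (fun h => hw (Or.inl h)) (fun h => hw (Or.inr h))]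
  · simp only
    rw [← mul_assoc, hNi, one_mul, h0]

end Potentials

/-! ### Solutions of the Goursat problem -/

/-- End points do not matter in the integrals, so the derivatives of the data may take arbitrary
values there. -/
theorem IsVolterraValue.congr {A B : ℝ → Mat3} {T : ℝ} {W : Mat3} (hW : IsVolterraValue A T W)
    (hAB : EqOn A B (Ioo 0 T)) : IsVolterraValue B T W := by
  obtain ⟨Φ, hΦ, hΦ', hT⟩ := hW
  refine ⟨Φ, hΦ, fun s hs i j => ?_, hT⟩
  rw [hΦ' s hs i j]
  congr 1
  refine intervalIntegral.integral_congr_ae ?_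
  filter_upwards [ae_mem_Ioo_of_mem_uIoc hs.1] with t ht ht'
  rw [hAB ⟨(ht ht').1, (ht ht').2.trans_le hs.2⟩]

theorem IsGoursatSolution.exists_potentials {n : ℕ} (hn : 2 ≤ n) {d : GoursatData}
    {E H : ℝ × ℝ → ℂ} (hs : IsGoursatSolution n d E H) :
    ∃ (P : Potentials) (β : ℝ), P.IsSolution β ∧ P.E = E ∧ P.H = H := by
  obtain ⟨β, hβ, hE, hH⟩ := hs.regular
  obtain ⟨Ex, Ey, Exy, hE1, hE2⟩ := hE.exists_partialData hn
  obtain ⟨Hx, Hy, Hxy, hH1, hH2⟩ := hH.exists_partialData hn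
  refine ⟨⟨E, Ex, Ey, Exy, H, Hx, Hy, Hxy⟩, β, ⟨hβ.1, hβ.2, hE1, hH1, hs.pos, fun p hp => ?_,
    fun p hp => ?_⟩, rfl, rfl⟩
  · have := (hs.equations p hp).1
    obtain ⟨h1, h2, h3⟩ := hE2 p hp
    obtain ⟨h4, h5, -⟩ := hH2 p hp
    simp only [Potentials.f]
    rw [h1, h2, h3, h4, h5, ← this]
    ring
  · have := (hs.equations p hp).2
    obtain ⟨h1, h2, -⟩ := hE2 p hp
    obtain ⟨h4, h5, h6⟩ := hH2 p hp
    simp only [Potentials.f]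
    rw [h1, h2, h4, h5, h6, ← this]
    ring

namespace Potentials

variable {P : Potentials} {β : ℝ}

/-- The solution restricts to the data on the edge and is differentiable along it, so the
derivatives of the data are the tangential derivatives of the solution. -/
theorem IsSolution.laxMatrix_bottom (h : P.IsSolution β) {e k : ℝ → ℂ}
    (he : ∀ s ∈ Ico (0 : ℝ) 1, P.E (s, 0) = e s) (hk : ∀ s ∈ Ico (0 : ℝ) 1, P.H (s, 0) = k s) {s : ℝ}
    (hs : s ∈ Ioo (0 : ℝ) 1) (l : ℂ) :
    laxMatrix (logCoeff e k s) (deriv k s) (fVal (e s) (k s)) l = P.lax (s, 0) l := by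
  have hm : (s, (0 : ℝ)) ∈ triangle := ⟨hs.1.le, le_rfl, by simpa using hs.2⟩
  have hnh : ∀ᶠ σ in 𝓝 s, σ ∈ Ico (0 : ℝ) 1 :=
    mem_of_superset (isOpen_Ioo.mem_nhds hs) Ioo_subset_Ico_self
  have he' : deriv e s = P.Ex (s, 0) := by
    refine ((h.partialE.hasDeriv_x _ hm hs.1).congr_of_eventuallyEq ?_).deriv
    filter_upwards [hnh] with σ hσ using (he σ hσ).symm
  have hk' : deriv k s = P.Hx (s, 0) := by
    refine ((h.partialH.hasDeriv_x _ hm hs.1).congr_of_eventuallyEq ?_).deriv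
    filter_upwards [hnh] with σ hσ using (hk σ hσ).symm
  rw [laxMatrix_eq, logCoeff, he', hk', ← he s ⟨hs.1.le, hs.2⟩, ← hk s ⟨hs.1.le, hs.2⟩]
  rfl

end Potentials

/-- The values of a solution at a corner in terms of a Riemann–Hilbert problem. -/
theorem IsGoursatSolution.riemannHilbert {n : ℕ} (hn : 2 ≤ n) {d : GoursatData}
    (hd0 : d.E0 0 = 1) (hd1 : d.H0 0 = 0)
    {E H : ℝ × ℝ → ℂ} (hs : IsGoursatSolution n d E H) {x y : ℝ} (hxy : (x, y) ∈ triangle)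
    {γ₀ γ₁ : ℝ → ℂ} (hγ : AdmissibleContours x y γ₀ γ₁) :
    ∃ v : ℂ → Mat3, IsJumpMatrix d x y γ₀ γ₁ v ∧
      (∀ v' : ℂ → Mat3, IsJumpMatrix d x y γ₀ γ₁ v' → EqOn v' v (trace γ₀ ∪ trace γ₁)) ∧
      ∃ m : ℂ → Mat3, IsRHSolution γ₀ γ₁ v m ∧
        (∀ m' : ℂ → Mat3, IsRHSolution γ₀ γ₁ v m' → EqOn m' m (trace γ₀ ∪ trace γ₁)ᶜ) ∧
        m 0 2 2 + m 0 0 0 + m 0 1 0 ≠ 0 ∧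
        E (x, y) = (m 0 2 2 + m 0 0 0 - m 0 1 0) / (m 0 2 2 + m 0 0 0 + m 0 1 0) ∧
        H (x, y) = (-Complex.I * m 0 1 2) / (m 0 2 2 + m 0 0 0 + m 0 1 0) := by
  classical
  obtain ⟨P, β, h, rfl, rfl⟩ := hs.exists_potentials hn
  obtain ⟨hx : 0 ≤ x, hy : 0 ≤ y, hxy' : x + y < 1⟩ := id hxy
  have hx1 : x + 0 < 1 := by linarith
  have hy1 : y + 0 < 1 := by linarith
  have hsig : ∀ z ∈ trace γ₀ ∪ trace γ₁, z ∉ sigma0 x y ∧ z ∉ sigma1 x y ∧ z ≠ 0 := by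
    rintro z (hz | hz)
    · exact ⟨RHFactorization.notMem_of_trace hγ.encircles0 hz, fun h1 =>
        Set.disjoint_left.1 hγ.apart (Or.inl hz) (Or.inr (hγ.encircles1 h1)),
        fun h0 => hγ.zero0.1 (h0 ▸ hz)⟩
    · exact ⟨fun h0 => Set.disjoint_left.1 hγ.apart (Or.inr (hγ.encircles0 h0)) (Or.inl hz),
        RHFactorization.notMem_of_trace hγ.encircles1 hz, fun h0 => hγ.zero1.1 (h0 ▸ hz)⟩
  set v0 : ℂ → Mat3 := fun z => P.propagator x 0 fun s => lamFun x y s 0 z with hv0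
  set v1 : ℂ → Mat3 := fun z => P.swap.propagator y 0 fun t => 1 / lamFun x y 0 t z with hv1
  -- The Volterra equation has exactly one value, the propagator along the bottom edge. Existence
  -- and uniqueness of the jump matrix are both contained in this equivalence.
  have iff0 : ∀ z ∈ trace γ₀, ∀ W, IsVolterraValue (matU0 d x y (surfacePoint x y z)) x W ↔
      W = v0 z := by
    intro z hz W
    obtain ⟨z0, z1, zz⟩ := hsig z (Or.inl hz)
    have hl : ContinuousOn (fun s => lamFun x y s 0 z) (Icc 0 x) :=
      (continuousOn_lamFun hx hy hxy' z0 z1).comp (f := fun s : ℝ => (s, (0 : ℝ))) (by fun_prop)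
        fun s hs => ⟨hs, left_mem_Icc.2 hy⟩
    obtain ⟨C, hC0, hC⟩ := h.exists_weaklySingular hx le_rfl hx1 hl
    have he : EqOn (matU0 d x y (surfacePoint x y z)) (fun s => P.lax (s, 0) (lamFun x y s 0 z))
        (Ioo 0 x) := by
      intro s hsx
      simp only [matU0]
      rw [h.laxMatrix_bottom (fun σ hσ => (hs.bottom σ hσ).1) (fun σ hσ => (hs.bottom σ hσ).2)
        ⟨hsx.1, by linarith [hsx.2]⟩, lamAt_surfacePoint hy hxy' z0 z1 (Ioo_subset_Icc_self hsx)
        (left_mem_Icc.2 hy) zz]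
    exact Iff.trans ⟨fun hW => hW.congr he, fun hW => hW.congr he.symm⟩
      (isVolterraValue_iff h.lt_one hC0 hx hC)
  have iff1 : ∀ z ∈ trace γ₁, ∀ W, IsVolterraValue (matV1 d x y (surfacePoint x y z)) y W ↔
      W = v1 z := by
    intro z hz W
    obtain ⟨z0, z1, zz⟩ := hsig z (Or.inr hz)
    have hl : ContinuousOn (fun t => 1 / lamFun x y 0 t z) (Icc 0 y) :=
      (continuousOn_one_div_lamFun hx hy hxy' z0 z1).comp (f := fun t : ℝ => ((0 : ℝ), t))
        (by fun_prop) fun t ht => ⟨left_mem_Icc.2 hx, ht⟩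
    obtain ⟨C, hC0, hC⟩ := h.swap.exists_weaklySingular hy le_rfl hy1 hl
    have he : EqOn (matV1 d x y (surfacePoint x y z))
        (fun t => P.swap.lax (t, 0) (1 / lamFun x y 0 t z)) (Ioo 0 y) := by
      intro t hty
      simp only [matV1]
      rw [h.swap.laxMatrix_bottom (fun σ hσ => (hs.left σ hσ).1) (fun σ hσ => (hs.left σ hσ).2)
        ⟨hty.1, by linarith [hty.2]⟩, lamAt_surfacePoint hy hxy' z0 z1 (left_mem_Icc.2 hx)
        (Ioo_subset_Icc_self hty) zz]
    exact Iff.trans ⟨fun hW => hW.congr he, fun hW => hW.congr he.symm⟩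
      (isVolterraValue_iff h.lt_one hC0 hy hC)
  have hne : ∀ z ∈ trace γ₁, z ∉ trace γ₀ := fun z h1 h0 =>
    Set.disjoint_left.1 hγ.apart (Or.inl h0) (Or.inl h1)
  set v : ℂ → Mat3 := fun z => if z ∈ trace γ₀ then v0 z else v1 z with hv
  have e0 : ∀ z ∈ trace γ₀, v z = v0 z := fun z hz => if_pos hz
  have e1 : ∀ z ∈ trace γ₁, v z = v1 z := fun z hz => if_neg (hne z hz)
  have hE0 : P.E (0, 0) = 1 := by rw [(hs.bottom 0 ⟨le_rfl, one_pos⟩).1, hd0]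
  have hH0 : P.H (0, 0) = 0 := by rw [(hs.bottom 0 ⟨le_rfl, one_pos⟩).2, hd1]
  obtain ⟨G, b₀, b₁, hF, hG⟩ := h.rhFactorization hx hy hxy' hE0 hH0 hγ e0 e1
  refine ⟨v, ⟨fun z hz => (iff0 z hz _).2 (e0 z hz), fun z hz => (iff1 z hz _).2 (e1 z hz)⟩, ?_,
    sectional γ₀ γ₁ G b₀ b₁, hF.isRHSolution, fun m' hm' => hF.eqOn_of_isRHSolution hm', ?_⟩
  · rintro v' ⟨h0, h1⟩ z (hz | hz)
    · rw [e0 z hz]; exact (iff0 z hz _).1 (h0 z hz)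
    · rw [e1 z hz]; exact (iff1 z hz _).1 (h1 z hz)
  -- The origin lies outside both loops, so m(0) is the value of the outer factor.
  · rw [RHFactorization.sectional_outer 0 (RHFactorization.notMem_inside_of_outside hγ.zero0)
      (RHFactorization.notMem_inside_of_outside hγ.zero1)]
    exact potentials_eq_of_gauge (h.pos _ hxy) hG

theorem boundaryMatrix_congr {e k e' k' : ℝ → ℂ} {T : ℝ} (he : ∀ s ∈ Icc 0 T, e s = e' s ∧ k s = k' s)
    {s : ℝ} (hs : s ∈ Ioo 0 T) (l : ℂ) :
    laxMatrix (logCoeff e k s) (deriv k s) (fVal (e s) (k s)) l =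
      laxMatrix (logCoeff e' k' s) (deriv k' s) (fVal (e' s) (k' s)) l := by
  have hn : Icc 0 T ∈ 𝓝 s := mem_of_superset (isOpen_Ioo.mem_nhds hs) Ioo_subset_Icc_self
  have h1 : deriv e s = deriv e' s := EventuallyEq.deriv_eq (by
    filter_upwards [hn] with σ hσ using (he σ hσ).1)
  have h2 : deriv k s = deriv k' s := EventuallyEq.deriv_eq (by
    filter_upwards [hn] with σ hσ using (he σ hσ).2)
  obtain ⟨h3, h4⟩ := he s (Ioo_subset_Icc_self hs)
  rw [logCoeff, logCoeff, h1, h2, h3, h4]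

theorem IsRHSolution.congr {γ₀ γ₁ : ℝ → ℂ} {v v' m : ℂ → Mat3} (h : IsRHSolution γ₀ γ₁ v m)
    (hv : EqOn v v' (trace γ₀ ∪ trace γ₁)) : IsRHSolution γ₀ γ₁ v' m where
  analytic := h.analytic
  jump := by
    obtain ⟨mp, mm, h1, h2, h3, h4, h5⟩ := h.jump
    exact ⟨mp, mm, h1, h2, h3, h4, fun z hz => by rw [h5 z hz, hv hz]⟩
  infinity := h.infinity

/-- A solution at a corner depends only on the data on the adjacent segments. -/
theorem IsGoursatSolution.eq_of_eqOn_data {n n' : ℕ} (hn : 2 ≤ n) (hn' : 2 ≤ n') {d d' : GoursatData}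
    (hd0 : d.E0 0 = 1) (hd1 : d.H0 0 = 0) (hd0' : d'.E0 0 = 1) (hd1' : d'.H0 0 = 0)
    {E H E' H' : ℝ × ℝ → ℂ} (hs : IsGoursatSolution n d E H) (hs' : IsGoursatSolution n' d' E' H')
    {x y : ℝ} (hxy : (x, y) ∈ triangle) (h0 : ∀ s ∈ Icc 0 x, d.E0 s = d'.E0 s ∧ d.H0 s = d'.H0 s)
    (h1 : ∀ t ∈ Icc 0 y, d.E1 t = d'.E1 t ∧ d.H1 t = d'.H1 t) :
    E (x, y) = E' (x, y) ∧ H (x, y) = H' (x, y) := by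
  -- The contour depends on (x,y) only, so it can be shared by both solutions, which then have the
  -- same jump matrix on it.
  obtain ⟨γ₀, γ₁, hγ⟩ := exists_admissibleContours hxy.1 hxy.2.1 hxy.2.2
  obtain ⟨v, -, hvu, m, -, hmu, -, hE, hH⟩ := hs.riemannHilbert hn hd0 hd1 hxy hγ
  obtain ⟨v', ⟨hv0, hv1⟩, -, m', hm', -, -, hE', hH'⟩ := hs'.riemannHilbert hn' hd0' hd1' hxy hγ
  have hv : EqOn v' v (trace γ₀ ∪ trace γ₁) := by
    refine hvu v' ⟨fun z hz => (hv0 z hz).congr fun s hs => ?_,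
      fun z hz => (hv1 z hz).congr fun t ht => ?_⟩
    · exact (boundaryMatrix_congr h0 hs _).symm
    · exact (boundaryMatrix_congr h1 ht _).symm
  -- Uniqueness determines the solution off Γ only, which suffices because 0 is not on Γ.
  have hm : m' 0 = m 0 := hmu m' (hm'.congr hv) fun hz => hz.elim hγ.zero0.1 hγ.zero1.1
  exact ⟨by rw [hE, hE', hm], by rw [hH, hH', hm]⟩

end ErnstMaxwell

end

theorem theorem3p1 (n : ℕ) (hn : 2 ≤ n) (α : ℝ) (hα : α ∈ Ico (0 : ℝ) 1)
    (d : GoursatData) (hd : d.Admissible n α) :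
    -- uniqueness
    (∀ E H E' H' : ℝ × ℝ → ℂ, IsGoursatSolution n d E H → IsGoursatSolution n d E' H' →
      EqOn E E' triangle ∧ EqOn H H' triangle) ∧
    -- representation through the Riemann–Hilbert problem
    (∀ E H : ℝ × ℝ → ℂ, IsGoursatSolution n d E H →
      ∀ x y : ℝ, (x, y) ∈ triangle → ∀ γ₀ γ₁ : ℝ → ℂ, AdmissibleContours x y γ₀ γ₁ →
        ∃ v : ℂ → Mat3, IsJumpMatrix d x y γ₀ γ₁ v ∧
          (∀ v' : ℂ → Mat3, IsJumpMatrix d x y γ₀ γ₁ v' → EqOn v' v (trace γ₀ ∪ trace γ₁)) ∧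
          ∃ m : ℂ → Mat3, IsRHSolution γ₀ γ₁ v m ∧
            (∀ m' : ℂ → Mat3, IsRHSolution γ₀ γ₁ v m' → EqOn m' m (trace γ₀ ∪ trace γ₁)ᶜ) ∧
            m 0 2 2 + m 0 0 0 + m 0 1 0 ≠ 0 ∧
            E (x, y) = (m 0 2 2 + m 0 0 0 - m 0 1 0) / (m 0 2 2 + m 0 0 0 + m 0 1 0) ∧
            H (x, y) = (-Complex.I * m 0 1 2) / (m 0 2 2 + m 0 0 0 + m 0 1 0)) ∧
    -- dependence on the data on `[0,x]` and `[0,y]` only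
    (∀ (n' : ℕ) (α' : ℝ) (d' : GoursatData), 2 ≤ n' → α' ∈ Ico (0 : ℝ) 1 → d'.Admissible n' α' →
      ∀ E H E' H' : ℝ × ℝ → ℂ, IsGoursatSolution n d E H → IsGoursatSolution n' d' E' H' →
        ∀ x y : ℝ, (x, y) ∈ triangle →
          (∀ s ∈ Icc 0 x, d.E0 s = d'.E0 s ∧ d.H0 s = d'.H0 s) →
          (∀ t ∈ Icc 0 y, d.E1 t = d'.E1 t ∧ d.H1 t = d'.H1 t) →
          E (x, y) = E' (x, y) ∧ H (x, y) = H' (x, y)) := by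
  obtain ⟨-, -, -, -, h0, -, h1, -⟩ := hd
  refine ⟨fun E H E' H' hs hs' => ⟨fun p hp => ?_, fun p hp => ?_⟩, fun E H hs x y hxy γ₀ γ₁ hγ =>
    hs.riemannHilbert hn h0 h1 hxy hγ, fun n' α' d' hn' _ hd' E H E' H' hs hs' x y hxy hx hy => ?_⟩
  -- Uniqueness is the case of equal data in the statement on local dependence.
  · exact (hs.eq_of_eqOn_data hn hn h0 h1 h0 h1 hs' hp (fun _ _ => ⟨rfl, rfl⟩)
      fun _ _ => ⟨rfl, rfl⟩).1
  · exact (hs.eq_of_eqOn_data hn hn h0 h1 h0 h1 hs' hp (fun _ _ => ⟨rfl, rfl⟩)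
      fun _ _ => ⟨rfl, rfl⟩).2
  · obtain ⟨-, -, -, -, h0', -, h1', -⟩ := hd'
    exact hs.eq_of_eqOn_data hn hn' h0 h1 h0' h1' hs' hxy hx hy
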